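/- Let $(M,g)$ be a compact two-dimensional smooth manifold without boundary with a smooth Riemannian metric $g$, and let $f:M\to\mathbb R$ be a Morse function (smooth, with nondegenerate Hessian at each of its critical points). A saddle point is a critical point of $f$ that is not a local extremum. A gradient flow line is the image of a solution $\gamma:\mathbb R\to M$ of $\gamma'(t)=-\nabla f(\gamma(t))$; it starts (ends) at $c$ if $\gamma(t)\to c$ as $t\to-\infty$ ($t\to+\infty$). A Neumann line is a nonconstant gradient flow line that starts or ends at a saddle point of $f$. A flow line meets a point $c$ if it passes through $c$ or starts or ends at $c$. The unit tangent vectors of a set $S\subset M$ at $c$ are the limits of the $g$-normalized directions from $c$ to $x$ (in a chart around $c$) as $x\in S\setminus\{c\}$ tends to $c$ along a sequence. 1. Let $c$ be a saddle point of $f$. Then there are exactly four Neumann lines that meet $c$. Each of them has exactly one unit tangent vector at $c$, and the lines can be numbered cyclically such that the angle at $c$ between any two consecutive ones is $\pi/2$ (and any two opposite ones make the angle $\pi$). 2. Let $c$ be a local extremum of $f$ at which the Hessian of $f$ is not a multiple of $g$. Then each Neumann line that meets $c$ has exactly one unit tangent vector at $c$, and the angle at $c$ between any two Neumann lines that meet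 $c$ is $0$, $\pi$ or $\pi/2$. 3. Assume moreover that $f$ is an eigenfunction, i.e. $f\neq 0$ and $-\Delta f=\lambda f$ for some $\lambda\in\mathbb R$, where $\Delta$ is the Laplace-Beltrami operator of $g$. A nodal line is a connected component of the set of the noncritical points of $f$ in $f^{-1}(0)$. Let $c$ lie in the closure of a nodal line $N$, and let $L$ be a Neumann line that meets $c$. Then $N$ and $L$ have unit tangent vectors at $c$. If $c$ is a saddle point, then each tangent line of $N$ at $c$ and each tangent line of $L$ at $c$ make the angle $\pi/4$; otherwise they make the angle $\pi/2$. Here the angle between two lines is the unoriented one, in $[0,\pi/2]$. -/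

import Mathlib

open Set Filter Topology
open scoped Manifold ContDiff

noncomputable section

namespace NeumannLines

/-- The model space `ℝ²` of a surface. -/
abbrev Plane : Type := EuclideanSpace ℝ (Fin 2)

/-- The standard basis vectors of `ℝ²`. -/
def basisVec (i : Fin 2) : Plane := EuclideanSpace.single i 1

section Surface

variable {M : Type*} [TopologicalSpace M] [ChartedSpace Plane M] [IsManifold (𝓡 2) ∞ M]

/-- Smooth Riemannian metrics on the surface `M`. -/
abbrev SurfaceMetric (M : Type*) [TopologicalSpace M] [ChartedSpace Plane M]
    [IsManifold (𝓡 2) ∞ M] : Type _ :=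
  Bundle.ContMDiffRiemannianMetric (B := M) (𝓡 2) ∞ Plane
    (fun x : M => TangentSpace (𝓡 2) x)

/-- The angle in `[0, π]` between two tangent vectors at `c`, measured by the metric `g`. -/
def angle (g : SurfaceMetric M) (c : M) (u v : TangentSpace (𝓡 2) c) : ℝ :=
  Real.arccos (g.inner c u v / (√(g.inner c u u) * √(g.inner c v v)))

/-- The angle in `[0, π/2]` between the (unoriented) straight lines of `T_c M` that are
spanned by two tangent vectors at `c`. -/
def lineAngle (g : SurfaceMetric M) (c : M) (u v : TangentSpace (𝓡 2) c) : ℝ :=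
  min (angle g c u v) (Real.pi - angle g c u v)

/-- `p` is a critical point of `f`. -/
def IsCritical (f : M → ℝ) (p : M) : Prop := mfderiv (𝓡 2) 𝓘(ℝ, ℝ) f p = 0

/-- The Hessian of `f` at `p`, as a bilinear form on `T_p M`: the second derivative of `f` in the
chart through which `T_p M` is identified with `ℝ²`. It is used at critical points only, where it
does not depend on the chart. -/
def hessian (f : M → ℝ) (p : M) (u v : TangentSpace (𝓡 2) p) : ℝ :=
  fderiv ℝ (fderiv ℝ (f ∘ (extChartAt (𝓡 2) p).symm)) (extChartAt (𝓡 2) p p) u v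

/-- A Morse function: smooth, and with nondegenerate Hessian at every critical point. -/
def IsMorse (f : M → ℝ) : Prop :=
  ContMDiff (𝓡 2) 𝓘(ℝ, ℝ) ∞ f ∧
    ∀ p, IsCritical f p → ∀ u : TangentSpace (𝓡 2) p, (∀ v, hessian f p u v = 0) → u = 0

/-- A saddle point: a critical point that is not a local extremum. -/
def IsSaddle (f : M → ℝ) (p : M) : Prop := IsCritical f p ∧ ¬ IsLocalExtr f p

/-- The Hessian of `f` at `p` is a multiple of the metric at `p`. -/
def HessianProportional (g : SurfaceMetric M) (f : M → ℝ) (p : M) : Prop :=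
  ∃ k : ℝ, ∀ u v : TangentSpace (𝓡 2) p, hessian f p u v = k * g.inner p u v

/-- Existence of the Riemannian gradient. -/
theorem exists_grad (g : SurfaceMetric M) (f : M → ℝ) (p : M) :
    ∃ X : TangentSpace (𝓡 2) p, ∀ w : TangentSpace (𝓡 2) p,
      g.inner p X w = mfderiv (𝓡 2) 𝓘(ℝ, ℝ) f p w := by
  have : FiniteDimensional ℝ (TangentSpace (𝓡 2) p) :=
    inferInstanceAs (FiniteDimensional ℝ Plane)
  let B : TangentSpace (𝓡 2) p →ₗ[ℝ] Module.Dual ℝ (TangentSpace (𝓡 2) p) :=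
    { toFun := fun u => (g.inner p u).toLinearMap
      map_add' := fun u v => by ext w; simp
      map_smul' := fun a u => by ext w; simp }
  have hinj : Function.Injective B := by
    rw [← LinearMap.ker_eq_bot, LinearMap.ker_eq_bot']
    intro u hu
    by_contra hne
    have h1 := g.pos p u hne
    have h2 : B u u = 0 := by rw [hu]; rfl
    exact absurd h2 (ne_of_gt h1)
  have hsurj : Function.Surjective B :=
    (LinearMap.injective_iff_surjective_of_finrank_eq_finrank
      (Subspace.dual_finrank_eq (K := ℝ) (V := TangentSpace (𝓡 2) p)).symm).1 hinj
  obtain ⟨X, hX⟩ := hsurj (mfderiv (𝓡 2) 𝓘(ℝ, ℝ) f p).toLinearMap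
  exact ⟨X, fun w => by have := congrArg (fun l => l w) hX; exact this⟩

/-- The Riemannian gradient `∇f`, determined by `g(∇f, w) = df(w)` for all `w`. -/
def grad (g : SurfaceMetric M) (f : M → ℝ) (p : M) : TangentSpace (𝓡 2) p :=
  (exists_grad g f p).choose

theorem inner_grad (g : SurfaceMetric M) (f : M → ℝ) (p : M) (w : TangentSpace (𝓡 2) p) :
    g.inner p (grad g f p) w = mfderiv (𝓡 2) 𝓘(ℝ, ℝ) f p w :=
  (exists_grad g f p).choose_spec w

/-- `γ : ℝ → M` is a trajectory of the flow of `-∇f`. -/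
def IsTrajectory (g : SurfaceMetric M) (f : M → ℝ) (γ : ℝ → M) : Prop :=
  IsMIntegralCurve (I := 𝓡 2) γ (fun x => -grad g f x)

/-- `γ` starts or ends at `c`. -/
def StartsOrEndsAt (γ : ℝ → M) (c : M) : Prop :=
  Tendsto γ atBot (𝓝 c) ∨ Tendsto γ atTop (𝓝 c)

/-- A Neumann line of `f`: a (nonconstant) gradient flow line, that is the image of a
trajectory, which starts or ends at a saddle point of `f`. -/
def IsNeumannLine (g : SurfaceMetric M) (f : M → ℝ) (L : Set M) : Prop :=
  ∃ γ : ℝ → M, IsTrajectory g f γ ∧ (∃ s t, γ s ≠ γ t) ∧ range γ = L ∧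
    ∃ r, IsSaddle f r ∧ StartsOrEndsAt γ r

/-- The gradient flow line `L` meets the point `c`: it passes through `c`, or it starts or ends
at `c`. -/
def MeetsAt (g : SurfaceMetric M) (f : M → ℝ) (L : Set M) (c : M) : Prop :=
  c ∈ L ∨ ∃ γ : ℝ → M, IsTrajectory g f γ ∧ range γ = L ∧ StartsOrEndsAt γ c

/-- The vector of `T_c M` that points from `c` to `x` in the chart through which `T_c M` is
identified with `ℝ²`. -/
def secant (c x : M) : TangentSpace (𝓡 2) c :=
  (extChartAt (𝓡 2) c x - extChartAt (𝓡 2) c c : Plane)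

/-- The unit tangent vectors of the set `S` at `c`: the limits of the directions from `c` to `x`
as `x ∈ S \ {c}` tends to `c` along a sequence. If `c` is an endpoint of a curve `S` then this set
is `{v}` exactly when `S` has at `c` the tangent ray spanned by the unit vector `v`; if the curve
passes smoothly through `c` then the set consists of the two unit vectors of its tangent line. -/
def unitTangents (g : SurfaceMetric M) (S : Set M) (c : M) : Set (TangentSpace (𝓡 2) c) :=
  {v | ∃ x : ℕ → M, (∀ n, x n ∈ S ∧ x n ≠ c) ∧ Tendsto x atTop (𝓝 c) ∧
    Tendsto (fun n => (√(g.inner c (secant c (x n)) (secant c (x n))))⁻¹ • secant c (x n))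
      atTop (𝓝 v)}

/-- The Gram matrix `(g_ij)` of the metric in the chart at `p`, at the coordinates `z`. -/
def metricMatrix (g : SurfaceMetric M) (p : M) (z : Plane) : Matrix (Fin 2) (Fin 2) ℝ :=
  Matrix.of fun i j =>
    g.inner ((extChartAt (𝓡 2) p).symm z)
      (mfderiv 𝓘(ℝ, Plane) (𝓡 2) (extChartAt (𝓡 2) p).symm z (basisVec i))
      (mfderiv 𝓘(ℝ, Plane) (𝓡 2) (extChartAt (𝓡 2) p).symm z (basisVec j))

/-- The Laplace-Beltrami operator, `Δf = |g|^(-1/2) ∂_i (|g|^(1/2) g^ij ∂_j f)`, computed at `p`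
in the chart at `p`. -/
def laplaceBeltrami (g : SurfaceMetric M) (f : M → ℝ) (p : M) : ℝ :=
  (√(metricMatrix g p (extChartAt (𝓡 2) p p)).det)⁻¹ *
    ∑ i, fderiv ℝ
      (fun z => √(metricMatrix g p z).det *
        ∑ j, (metricMatrix g p z)⁻¹ i j *
          fderiv ℝ (f ∘ (extChartAt (𝓡 2) p).symm) z (basisVec j))
      (extChartAt (𝓡 2) p p) (basisVec i)

/-- A Morse eigenfunction of the Laplace-Beltrami operator. -/
def IsMorseEigenfunction (g : SurfaceMetric M) (f : M → ℝ) : Prop :=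
  IsMorse f ∧ f ≠ 0 ∧ ∃ eig : ℝ, ∀ p, -laplaceBeltrami g f p = eig * f p

/-- A nodal line of `f`: a connected component of the nodal set `f = 0` with the critical
points of `f` removed. -/
def IsNodalLine (f : M → ℝ) (N : Set M) : Prop :=
  ∃ x, f x = 0 ∧ ¬ IsCritical f x ∧
    N = connectedComponentIn {y | f y = 0 ∧ ¬ IsCritical f y} x

end Surface

end NeumannLines

end

open NeumannLines

namespace NeumannLines

noncomputable section

set_option linter.unusedSectionVars false

/-! ### Scalar differential inequalities -/

/-! In the chart at a critical point `c` the field `-∇f` vanishes, and its linearization is `-G⁻¹H`,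
where `G` is the metric and `H` the Hessian at `c`. A `G`-orthonormal frame `e₁, e₂` that
diagonalizes `H` turns the flow into `u' = -l₁ u`, `v' = -l₂ v` up to errors `o(|u| + |v|)`.

Tangents: along a trajectory tending to `c`, the function `w = (u² - v²)/(u² + v²)`, the cosine of
twice the polar angle, satisfies `w' = (l₂ - l₁)(1 - w²) + o(1)`. If `l₁ ≠ l₂` this forces `w → ±1`,
so the trajectory becomes tangent to a principal axis, and to one ray of it because the dominant
coordinate cannot change sign (`AsymptoticallyDiagonal.tendsto_direction`). Since `f` strictly
decreases along a trajectory, points of its image that converge to `c` have times tending to the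
end; hence the unit tangents of the image are those of the parametrized curve. Passing to `-f`
reverses time and covers the lines that start at `c`. This gives the statement on extrema.

Saddles: the eigenvalues have opposite signs, say `l₁ > 0 > l₂`. A shooting argument produces a
trajectory that ends at `c` along `e₁` (`LinearizedAt.exists_stable_solution`), and the growth of
`v² - u²` for the difference of two solutions makes it unique (`LinearizedAt.exists_eq_of_saddle`).
With `-e₁`, and with `-f` and `±e₂`, this yields exactly four lines.

Nodal lines: at a critical zero of an eigenfunction the Laplacian `l₁ + l₂` vanishes, so the point
is a saddle and the null directions of `H`, to which nodal tangents belong by the second order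
expansion, bisect the principal axes. At a regular point the nodal tangents lie in the kernel of
`df`, while the trajectory is tangent to the gradient. -/

theorem le_of_hasDerivAt_pos_of_eq {w w' : ℝ → ℝ} {m a : ℝ}
    (hw : ∀ t, a ≤ t → HasDerivAt w (w' t) t) (ha : m ≤ w a)
    (hpos : ∀ t, a ≤ t → w t = m → 0 < w' t) : ∀ t, a ≤ t → m ≤ w t := by
  intro t ht
  have h := image_le_of_deriv_right_lt_deriv_boundary (f := fun t => -w t) (f' := fun t => -w' t)
    (a := a) (b := t) (B := fun _ => -m) (B' := fun _ => 0)
    (fun s hs => (hw s hs.1).neg.continuousAt.continuousWithinAt)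
    (fun s hs => (hw s hs.1).neg.hasDerivWithinAt) (by simpa using ha)
    (fun s => hasDerivAt_const s (-m))
    (fun s hs h => by
      have := hpos s hs.1 (by simpa using h)
      simpa using this)
  simpa using h ⟨ht, le_refl t⟩

theorem mono_of_hasDerivAt_nonneg {w w' : ℝ → ℝ} {a : ℝ}
    (hw : ∀ t, a ≤ t → HasDerivAt w (w' t) t) (hpos : ∀ t, a ≤ t → 0 ≤ w' t) :
    MonotoneOn w (Ici a) := by
  refine monotoneOn_of_deriv_nonneg (convex_Ici a)
    (fun t ht => (hw t ht).continuousAt.continuousWithinAt) (fun t ht => ?_) (fun t ht => ?_)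
  · rw [interior_Ici] at ht
    exact (hw t (le_of_lt ht)).differentiableAt.differentiableWithinAt
  · rw [interior_Ici] at ht
    rw [(hw t (le_of_lt ht)).deriv]
    exact hpos t (le_of_lt ht)

/-- The equation `w' = k(1 - w²)` has the repelling equilibrium `-1` and the attracting one `1`. If
`w` does not tend to `-1`, it is at arbitrarily late times a fixed distance away from it; from such
a time on it cannot come back, and the uniformly positive derivative carries it close to `1`, where
it is trapped. -/
theorem tendsto_one_or_neg_one_of_asymptotic_logistic {w w' : ℝ → ℝ} {k : ℝ} (hk : 0 < k)
    (hbd : ∀ t, |w t| ≤ 1) (hw : ∀ᶠ t in atTop, HasDerivAt w (w' t) t)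
    (herr : ∀ δ > 0, ∀ᶠ t in atTop, |w' t - k * (1 - w t ^ 2)| ≤ δ) :
    Tendsto w atTop (𝓝 1) ∨ Tendsto w atTop (𝓝 (-1)) := by
  by_cases h : Tendsto w atTop (𝓝 (-1))
  · exact Or.inr h
  left
  rw [Metric.tendsto_atTop] at h
  push Not at h
  obtain ⟨η₀, hη₀, hfreq⟩ := h
  rw [Metric.tendsto_atTop]
  intro ε hε
  obtain ⟨η, hη, hη1, hη2, hη3⟩ : ∃ η > 0, η ≤ η₀ ∧ η < ε ∧ η ≤ 1 / 2 :=
    ⟨min η₀ (min (ε / 2) (1 / 2)), by positivity, min_le_left _ _,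
      by have := min_le_left (ε / 2) (1 / 2); have := min_le_right η₀ (min (ε / 2) (1 / 2))
         linarith,
      by have := min_le_right (ε / 2) (1 / 2); have := min_le_right η₀ (min (ε / 2) (1 / 2))
         linarith⟩
  have hκ : 0 < k * η / 2 := by positivity
  obtain ⟨T, hT⟩ := eventually_atTop.1 (hw.and (herr (k * η / 2) hκ))
  -- On this band `1 - w² ≥ η` because `η ≤ 1/2`; the error, at most `kη/2`, consumes only half of
  -- the drift `kη`.
  have hgrow : ∀ t, T ≤ t → -1 + η ≤ w t → w t ≤ 1 - η → k * η / 2 ≤ w' t := by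
    intro t ht h1 h2
    have h3 := (abs_le.1 (hT t ht).2).1
    have h4 : η ≤ 1 - w t ^ 2 := by nlinarith
    nlinarith
  obtain ⟨t₁, ht₁, hd⟩ := hfreq T
  have hw1 : -1 + η ≤ w t₁ := by
    have := (abs_le.1 (hbd t₁)).1
    rw [Real.dist_eq, abs_of_nonneg (by linarith)] at hd
    linarith
  have hlow : ∀ t, t₁ ≤ t → -1 + η ≤ w t :=
    le_of_hasDerivAt_pos_of_eq (fun t ht => (hT t (ht₁.trans ht)).1) hw1 (fun t ht h => by
      have := hgrow t (ht₁.trans ht) h.ge (by linarith)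
      linarith)
  obtain ⟨t₂, ht₂, hw2⟩ : ∃ t₂, t₁ ≤ t₂ ∧ 1 - η ≤ w t₂ := by
    by_contra hcon
    push Not at hcon
    have hmono := mono_of_hasDerivAt_nonneg (a := t₁) (w := fun t => w t - k * η / 2 * t)
      (w' := fun t => w' t - k * η / 2)
      (fun t ht => by
        exact ((hT t (ht₁.trans ht)).1.sub
          ((hasDerivAt_id t).const_mul (k * η / 2))).congr_deriv (by simp))
      (fun t ht => by
        have := hgrow t (ht₁.trans ht) (hlow t ht) (hcon t ht).le
        linarith)
    -- By time `s` the function would have risen by at least `3`, more than the length of `[-1, 1]`.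
    set s := t₁ + 3 / (k * η / 2)
    have hs : t₁ ≤ s := by
      have : 0 < 3 / (k * η / 2) := by positivity
      simp only [s]; linarith
    have h1 := hmono (mem_Ici.2 le_rfl) (mem_Ici.2 hs) hs
    simp only at h1
    have h2 : k * η / 2 * s = k * η / 2 * t₁ + 3 := by
      simp only [s]; field_simp
    have := (abs_le.1 (hbd t₁)).1
    have := (abs_le.1 (hbd s)).2
    linarith
  refine ⟨t₂, fun t ht => ?_⟩
  have h1 : 1 - η ≤ w t :=
    le_of_hasDerivAt_pos_of_eq (fun t ht => (hT t (ht₁.trans (ht₂.trans ht))).1) hw2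
      (fun t ht h => by
        have := hgrow t (ht₁.trans (ht₂.trans ht)) (hlow t (ht₂.trans ht)) h.le
        linarith) t ht
  have h2 := (abs_le.1 (hbd t)).2
  rw [Real.dist_eq, abs_lt]
  constructor <;> linarith

/-- A continuous function without zeros near `+∞` has constant sign there. -/
theorem eventually_pos_or_neg {u : ℝ → ℝ} {T : ℝ} (hc : ContinuousOn u (Ici T))
    (h0 : ∀ t, T ≤ t → u t ≠ 0) : (∀ t, T ≤ t → 0 < u t) ∨ (∀ t, T ≤ t → u t < 0) := by
  by_contra hcon
  push Not at hcon
  obtain ⟨⟨s, hs, hs'⟩, ⟨t, ht, ht'⟩⟩ := hcon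
  obtain ⟨r, hr, hr'⟩ := (isPreconnected_Ici (a := T)).intermediate_value₂ hs ht hc
    (continuousOn_const (c := (0 : ℝ))) hs' ht'
  exact h0 r hr hr'

/-- The squares of the normalized coordinates are `(1 ± w)/2` for the given ratio `w`. So `|u|` is
eventually positive relative to the norm, and continuity fixes the sign of `u`. That sign is kept in
the conclusion because the uniqueness at a saddle needs it. -/
theorem tendsto_direction_of_quadratic_ratio {u v : ℝ → ℝ}
    (hc : ∀ᶠ t in atTop, ContinuousAt u t) (h0 : ∀ᶠ t in atTop, 0 < u t ^ 2 + v t ^ 2)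
    (h : Tendsto (fun t => (u t ^ 2 - v t ^ 2) / (u t ^ 2 + v t ^ 2)) atTop (𝓝 1)) :
    ∃ σ : ℝ, (σ = 1 ∧ (∀ᶠ t in atTop, 0 < u t) ∨ σ = -1 ∧ (∀ᶠ t in atTop, u t < 0)) ∧
      Tendsto (fun t => u t / √(u t ^ 2 + v t ^ 2)) atTop (𝓝 σ) ∧
      Tendsto (fun t => v t / √(u t ^ 2 + v t ^ 2)) atTop (𝓝 0) := by
  have hv2 : Tendsto (fun t => |v t / √(u t ^ 2 + v t ^ 2)|) atTop (𝓝 0) := by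
    have h1 : Tendsto (fun t => √((1 - (u t ^ 2 - v t ^ 2) / (u t ^ 2 + v t ^ 2)) / 2)) atTop
        (𝓝 (√((1 - 1) / 2))) :=
      (Real.continuous_sqrt.tendsto _).comp ((h.const_sub 1).div_const 2)
    simp only [sub_self, zero_div, Real.sqrt_zero] at h1
    refine h1.congr' ?_
    filter_upwards [h0] with t ht
    rw [← Real.sqrt_sq_eq_abs, div_pow, Real.sq_sqrt ht.le]
    congr 1
    field_simp
    ring
  have hu2 : Tendsto (fun t => |u t| / √(u t ^ 2 + v t ^ 2)) atTop (𝓝 1) := by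
    have h1 : Tendsto (fun t => √((1 + (u t ^ 2 - v t ^ 2) / (u t ^ 2 + v t ^ 2)) / 2)) atTop
        (𝓝 (√((1 + 1) / 2))) :=
      (Real.continuous_sqrt.tendsto _).comp ((h.const_add 1).div_const 2)
    rw [show √((1 + 1) / 2 : ℝ) = 1 by norm_num] at h1
    refine h1.congr' ?_
    filter_upwards [h0] with t ht
    rw [← Real.sqrt_sq_eq_abs, ← Real.sqrt_div (sq_nonneg _)]
    congr 1
    field_simp
    ring
  have hne : ∀ᶠ t in atTop, u t ≠ 0 := by
    filter_upwards [hu2.eventually (lt_mem_nhds (show (0 : ℝ) < 1 by norm_num))] with t ht h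
    simp [h] at ht
  obtain ⟨T, hT⟩ := eventually_atTop.1 (hc.and hne)
  have hv : Tendsto (fun t => v t / √(u t ^ 2 + v t ^ 2)) atTop (𝓝 0) :=
    (tendsto_zero_iff_abs_tendsto_zero _).2 hv2
  rcases eventually_pos_or_neg (u := u) (T := T)
    (fun t ht => (hT t ht).1.continuousWithinAt) (fun t ht => (hT t ht).2) with hs | hs
  · refine ⟨1, Or.inl ⟨rfl, eventually_atTop.2 ⟨T, hs⟩⟩, hu2.congr' ?_, hv⟩
    filter_upwards [eventually_ge_atTop T] with t ht
    rw [abs_of_pos (hs t ht)]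
  · refine ⟨-1, Or.inr ⟨rfl, eventually_atTop.2 ⟨T, hs⟩⟩, hu2.neg.congr' ?_, hv⟩
    filter_upwards [eventually_ge_atTop T] with t ht
    rw [abs_of_neg (hs t ht)]
    ring

/-- Approximate solutions of the diagonal linear system `u' = -l₁ u`, `v' = -l₂ v`. -/
structure AsymptoticallyDiagonal (l₁ l₂ : ℝ) (u v u' v' : ℝ → ℝ) : Prop where
  deriv_fst : ∀ᶠ t in atTop, HasDerivAt u (u' t) t
  deriv_snd : ∀ᶠ t in atTop, HasDerivAt v (v' t) t
  ne_zero : ∀ᶠ t in atTop, 0 < u t ^ 2 + v t ^ 2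
  err_fst : ∀ δ > 0, ∀ᶠ t in atTop, |u' t + l₁ * u t| ≤ δ * (|u t| + |v t|)
  err_snd : ∀ δ > 0, ∀ᶠ t in atTop, |v' t + l₂ * v t| ≤ δ * (|u t| + |v t|)

theorem AsymptoticallyDiagonal.swap {l₁ l₂ : ℝ} {u v u' v' : ℝ → ℝ}
    (h : AsymptoticallyDiagonal l₁ l₂ u v u' v') : AsymptoticallyDiagonal l₂ l₁ v u v' u' where
  deriv_fst := h.deriv_snd
  deriv_snd := h.deriv_fst
  ne_zero := h.ne_zero.mono fun t ht => by linarith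
  err_fst δ hδ := (h.err_snd δ hδ).mono fun t ht => by rwa [add_comm |v t|]
  err_snd δ hδ := (h.err_fst δ hδ).mono fun t ht => by rwa [add_comm |v t|]

/-- For the exact diagonal system the ratio solves the logistic equation with `k = l₂ - l₁`. The
errors `a`, `b` of the two equations perturb it by exactly `4uv(av - bu)/(u² + v²)²`, which is
homogeneous of degree `0` once `a, b` are bounded by multiples of `|u| + |v|`. -/
theorem AsymptoticallyDiagonal.tendsto_quadratic_ratio {l₁ l₂ : ℝ} {u v u' v' : ℝ → ℝ}
    (h : AsymptoticallyDiagonal l₁ l₂ u v u' v') (hl : l₁ < l₂) :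
    Tendsto (fun t => (u t ^ 2 - v t ^ 2) / (u t ^ 2 + v t ^ 2)) atTop (𝓝 1) ∨
    Tendsto (fun t => (u t ^ 2 - v t ^ 2) / (u t ^ 2 + v t ^ 2)) atTop (𝓝 (-1)) := by
  refine tendsto_one_or_neg_one_of_asymptotic_logistic (k := l₂ - l₁) (by linarith)
    (w' := fun t => ((2 * u t * u' t - 2 * v t * v' t) * (u t ^ 2 + v t ^ 2) -
      (u t ^ 2 - v t ^ 2) * (2 * u t * u' t + 2 * v t * v' t)) / (u t ^ 2 + v t ^ 2) ^ 2)
    (fun t => ?_) ?_ (fun δ hδ => ?_)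
  · rw [abs_div, abs_of_nonneg (show 0 ≤ u t ^ 2 + v t ^ 2 by positivity)]
    refine div_le_one_of_le₀ (abs_le.2 ⟨?_, ?_⟩) (by positivity) <;>
    nlinarith [sq_nonneg (u t), sq_nonneg (v t)]
  · filter_upwards [h.deriv_fst, h.deriv_snd, h.ne_zero] with t h1 h2 h3
    have h4 := h1.pow 2
    have h5 := h2.pow 2
    refine ((h4.sub h5).div (h4.add h5) h3.ne').congr_deriv ?_
    simp
  · filter_upwards [h.ne_zero, h.err_fst (δ / 4) (by positivity),
      h.err_snd (δ / 4) (by positivity)] with t h3 h1 h2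
    set a := u' t + l₁ * u t with ha
    set b := v' t + l₂ * v t with hb
    have e1 : u' t = a - l₁ * u t := by rw [ha]; ring
    have e2 : v' t = b - l₂ * v t := by rw [hb]; ring
    have key : ((2 * u t * u' t - 2 * v t * v' t) * (u t ^ 2 + v t ^ 2) -
      (u t ^ 2 - v t ^ 2) * (2 * u t * u' t + 2 * v t * v' t)) / (u t ^ 2 + v t ^ 2) ^ 2 -
      (l₂ - l₁) * (1 - ((u t ^ 2 - v t ^ 2) / (u t ^ 2 + v t ^ 2)) ^ 2) =
      4 * (u t * v t) * (a * v t - b * u t) / (u t ^ 2 + v t ^ 2) ^ 2 := by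
      rw [e1, e2]
      field_simp
      ring
    rw [key, abs_div, abs_of_nonneg (show 0 ≤ (u t ^ 2 + v t ^ 2) ^ 2 by positivity),
      div_le_iff₀ (by positivity), abs_mul, abs_mul, abs_mul]
    have k1 : |a * v t - b * u t| ≤ δ / 4 * (|u t| + |v t|) * (|u t| + |v t|) := by
      calc |a * v t - b * u t| ≤ |a * v t| + |b * u t| := abs_sub _ _
        _ = |a| * |v t| + |b| * |u t| := by rw [abs_mul, abs_mul]
        _ ≤ δ / 4 * (|u t| + |v t|) * |v t| + δ / 4 * (|u t| + |v t|) * |u t| := by gcongr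
        _ = _ := by ring
    have q1 := sq_abs (u t)
    have q2 := sq_abs (v t)
    rw [← q1, ← q2]
    have p1 := abs_nonneg (u t)
    have p2 := abs_nonneg (v t)
    generalize |u t| = x at *
    generalize |v t| = y at *
    have k2 : 4 * (x * y) ≤ 2 * (x ^ 2 + y ^ 2) := by nlinarith [sq_nonneg (x - y)]
    have k3 : δ / 4 * (x + y) * (x + y) ≤ δ / 2 * (x ^ 2 + y ^ 2) := by
      nlinarith [mul_nonneg hδ.le (sq_nonneg (x - y))]
    calc |4| * (x * y) * |a * v t - b * u t| = 4 * (x * y) * |a * v t - b * u t| := by norm_num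
      _ ≤ (2 * (x ^ 2 + y ^ 2)) * (δ / 2 * (x ^ 2 + y ^ 2)) := by
        gcongr
        exact k1.trans k3
      _ = _ := by ring

/-- Solutions that are asymptotic to those of a diagonal system with two different eigenvalues
become tangent to one of the two coordinate axes. -/
theorem AsymptoticallyDiagonal.tendsto_direction {l₁ l₂ : ℝ} {u v u' v' : ℝ → ℝ}
    (h : AsymptoticallyDiagonal l₁ l₂ u v u' v') (hl : l₁ ≠ l₂) :
    (∃ σ : ℝ, (σ = 1 ∧ (∀ᶠ t in atTop, 0 < u t) ∨ σ = -1 ∧ (∀ᶠ t in atTop, u t < 0)) ∧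
      Tendsto (fun t => u t / √(u t ^ 2 + v t ^ 2)) atTop (𝓝 σ) ∧
      Tendsto (fun t => v t / √(u t ^ 2 + v t ^ 2)) atTop (𝓝 0)) ∨
    (∃ σ : ℝ, (σ = 1 ∧ (∀ᶠ t in atTop, 0 < v t) ∨ σ = -1 ∧ (∀ᶠ t in atTop, v t < 0)) ∧
      Tendsto (fun t => u t / √(u t ^ 2 + v t ^ 2)) atTop (𝓝 0) ∧
      Tendsto (fun t => v t / √(u t ^ 2 + v t ^ 2)) atTop (𝓝 σ)) := by
  wlog hlt : l₁ < l₂ generalizing l₁ l₂ u v u' v'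
  · rcases this h.swap hl.symm (lt_of_le_of_ne (not_lt.1 hlt) hl.symm) with ⟨σ, h1, h2, h3⟩ | ⟨σ, h1, h2, h3⟩
    · refine Or.inr ⟨σ, h1, ?_, ?_⟩
      · simpa only [add_comm] using h3
      · simpa only [add_comm] using h2
    · refine Or.inl ⟨σ, h1, ?_, ?_⟩
      · simpa only [add_comm] using h3
      · simpa only [add_comm] using h2
  rcases h.tendsto_quadratic_ratio hlt with hr | hr
  · exact Or.inl (tendsto_direction_of_quadratic_ratio
      (h.deriv_fst.mono fun t ht => ht.continuousAt) h.ne_zero hr)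
  · obtain ⟨σ, h1, h2, h3⟩ := tendsto_direction_of_quadratic_ratio (u := v) (v := u)
      (h.deriv_snd.mono fun t ht => ht.continuousAt) h.swap.ne_zero (by
        refine (hr.neg.congr fun t => ?_).trans (by simp)
        rw [add_comm (v t ^ 2), ← neg_div, neg_sub])
    refine Or.inr ⟨σ, h1, ?_, ?_⟩
    · simpa only [add_comm] using h3
    · simpa only [add_comm] using h2

/-- A solution that tends to a saddle is not tangent to the unstable direction. -/
theorem AsymptoticallyDiagonal.not_tendsto_snd {l₁ l₂ : ℝ} {u v u' v' : ℝ → ℝ}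
    (h : AsymptoticallyDiagonal l₁ l₂ u v u' v') (hl : l₂ < 0)
    (hv : Tendsto v atTop (𝓝 0)) {σ : ℝ} (hσ : σ ^ 2 = 1) :
    ¬ (Tendsto (fun t => u t / √(u t ^ 2 + v t ^ 2)) atTop (𝓝 0) ∧
      Tendsto (fun t => v t / √(u t ^ 2 + v t ^ 2)) atTop (𝓝 σ)) := by
  rintro ⟨h1, h2⟩
  have h3 : ∀ᶠ t in atTop, (u t / √(u t ^ 2 + v t ^ 2)) ^ 2 < (v t / √(u t ^ 2 + v t ^ 2)) ^ 2 :=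
    (h1.pow 2).eventually_lt (h2.pow 2) (by rw [hσ]; norm_num)
  obtain ⟨T, hT⟩ := eventually_atTop.1 (h3.and (h.ne_zero.and (h.deriv_snd.and
    (h.err_snd (-l₂ / 2) (by linarith)))))
  have hlt : ∀ t, T ≤ t → |u t| < |v t| := fun t ht => by
    obtain ⟨a, b, -⟩ := hT t ht
    rw [div_pow, div_pow, Real.sq_sqrt b.le, div_lt_div_iff_of_pos_right b] at a
    exact sq_lt_sq.1 a
  -- Where `|u| < |v|` the error in the second equation is at most `-l₂|v|`, so it cannot outweigh
  -- the repulsion; `v²` does not decrease and cannot tend to `0` from a positive value.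
  have hmono := mono_of_hasDerivAt_nonneg (a := T) (w := fun t => v t ^ 2)
    (w' := fun t => 2 * v t * v' t) (fun t ht => by
      exact ((hT t ht).2.2.1.pow 2).congr_deriv (by simp)) (fun t ht => by
      have e := (hT t ht).2.2.2
      have hlt := hlt t ht
      have e2 : |v' t + l₂ * v t| ≤ -l₂ * |v t| := e.trans (by nlinarith)
      have e3 : |v t * (v' t + l₂ * v t)| ≤ -l₂ * v t ^ 2 := by
        rw [abs_mul, ← sq_abs (v t)]
        nlinarith [abs_nonneg (v t)]
      have := (abs_le.1 e3).1
      nlinarith)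
  have hlim : Tendsto (fun t => v t ^ 2) atTop (𝓝 0) := by simpa using hv.pow 2
  have hle : v T ^ 2 ≤ 0 := ge_of_tendsto hlim
    (by filter_upwards [eventually_ge_atTop T] with t ht using hmono (mem_Ici.2 le_rfl) ht ht)
  have h5 := hlt T le_rfl
  have : v T = 0 := by nlinarith [sq_nonneg (v T)]
  rw [this, abs_zero] at h5
  exact absurd h5 (not_lt.2 (abs_nonneg _))

/-! ### Global solutions of Lipschitz differential equations -/

/-- A Lipschitz field grows at most linearly: on the ball of radius `‖y‖ + 1` about `y` its norm is
at most `C(‖y‖ + 1)`. The Picard–Lindelöf time `1/C` therefore does not depend on `y`, and local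
solutions with a uniform lifespan extend to all times. -/
theorem exists_forall_hasDerivAt_of_lipschitzWith {E : Type*} [NormedAddCommGroup E]
    [NormedSpace ℝ E] [CompleteSpace E] {F : E → E} {K : NNReal} (hF : ContDiff ℝ 1 F)
    (hK : LipschitzWith K F) (x : E) :
    ∃ γ : ℝ → E, γ 0 = x ∧ ∀ t, HasDerivAt γ (F (γ t)) t := by
  set C : NNReal := 2 * K + ‖F 0‖₊ + 1 with hC
  have hCpos : 0 < C := by positivity
  have hv : ContMDiff 𝓘(ℝ, E) 𝓘(ℝ, E).tangent 1
      (fun x => (⟨x, F x⟩ : TangentBundle 𝓘(ℝ, E) E)) :=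
    contMDiff_vectorSpace_iff_contDiff.2 hF
  have hε : (0 : ℝ) < 1 / C := by positivity
  have key := exists_isMIntegralCurve_of_isMIntegralCurveOn (I := 𝓘(ℝ, E)) (M := E)
    (v := fun x => F x) hv hε (fun y => ?_) x
  · obtain ⟨γ, h0, h⟩ := key
    exact ⟨γ, h0, fun t => hasDerivAt_iff_hasFDerivAt.2 (hasMFDerivAt_iff_hasFDerivAt.1 (h t))⟩
  have hpl : IsPicardLindelof (fun _ => F) (tmin := -(1 / C : ℝ)) (tmax := 1 / C)
      ⟨0, by constructor <;> linarith⟩ y (‖y‖₊ + 1) 0 (C * (‖y‖₊ + 1)) K := by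
    refine .of_time_independent (fun z hz => ?_) hK.lipschitzOnWith ?_
    · have h1 : ‖F z - F 0‖ ≤ K * ‖z - 0‖ := hK.norm_sub_le z 0
      have h2 : ‖z‖ ≤ 2 * ‖y‖ + 1 := by
        have := norm_le_norm_add_norm_sub' z y
        rw [Metric.mem_closedBall, dist_eq_norm] at hz
        push_cast at hz
        linarith
      have h3 : ‖F z‖ ≤ ‖F z - F 0‖ + ‖F 0‖ := by
        simpa using norm_add_le (F z - F 0) (F 0)
      rw [sub_zero] at h1
      push_cast [hC]
      have hK0 : (0 : ℝ) ≤ K := K.2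
      nlinarith [norm_nonneg y, norm_nonneg (F 0), mul_nonneg hK0 (norm_nonneg y),
        mul_le_mul_of_nonneg_left h2 hK0, mul_nonneg (norm_nonneg (F 0)) (norm_nonneg y)]
    · simp only [sub_zero, zero_sub, neg_neg, max_self]
      push_cast
      have : (C : ℝ) ≠ 0 := by exact_mod_cast hCpos.ne'
      field_simp
      simp
  obtain ⟨α, hα0, hα⟩ := hpl.exists_eq_forall_mem_Icc_hasDerivWithinAt₀
  refine ⟨α, hα0, fun t ht => ?_⟩
  have h1 : HasDerivAt α (F (α t)) t :=
    (hα t (Ioo_subset_Icc_self ht)).hasDerivAt (Icc_mem_nhds ht.1 ht.2)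
  exact h1.hasFDerivAt.hasMFDerivAt.hasMFDerivWithinAt

/-! ### Solutions near a saddle: uniqueness and existence of the stable curve -/

section Planar

variable {E : Type*} [NormedAddCommGroup E] [NormedSpace ℝ E]

/-- In the coordinates `α, β`, the vector field `F` is strictly differentiable at `z₀`, with
derivative `-diag(l₁, l₂)`. -/
def LinearizedAt (F : E → E) (z₀ : E) (α β : E →L[ℝ] ℝ) (l₁ l₂ : ℝ) : Prop :=
  ∀ δ > 0, ∀ᶠ p in 𝓝 z₀ ×ˢ 𝓝 z₀,
    |α (F p.1 - F p.2) + l₁ * α (p.1 - p.2)| ≤ δ * (|α (p.1 - p.2)| + |β (p.1 - p.2)|) ∧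
    |β (F p.1 - F p.2) + l₂ * β (p.1 - p.2)| ≤ δ * (|α (p.1 - p.2)| + |β (p.1 - p.2)|)

/-- This is the derivative of `q² - p²`, with `p` contracting and `q` expanding. The two errors
together contribute at most `2δ(|p| + |q|)² ≤ 4δ(p² + q²)`, which the main part `2(ap² + bq²)`
absorbs. -/
theorem hyperbolic_growth {a b δ p q p' q' : ℝ} (hδa : 2 * δ ≤ a) (hδb : 2 * δ ≤ b)
    (hδ : 0 ≤ δ) (hp : |p' + a * p| ≤ δ * (|p| + |q|)) (hq : |q' + -b * q| ≤ δ * (|p| + |q|)) :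
    0 ≤ 2 * q * q' - 2 * p * p' := by
  have e1 : |p * (p' + a * p)| ≤ |p| * (δ * (|p| + |q|)) := by
    rw [abs_mul]; gcongr
  have e2 : |q * (q' + -b * q)| ≤ |q| * (δ * (|p| + |q|)) := by
    rw [abs_mul]; gcongr
  have f1 := (abs_le.1 e1).2
  have f2 := (abs_le.1 e2).1
  have g1 := sq_abs p
  have g2 := sq_abs q
  have k : (|p| + |q|) ^ 2 ≤ 2 * (p ^ 2 + q ^ 2) := by
    rw [← g1, ← g2]; nlinarith [sq_nonneg (|p| - |q|)]
  have k1 := mul_le_mul_of_nonneg_left k hδ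
  have k2 := mul_le_mul_of_nonneg_right hδa (sq_nonneg p)
  have k3 := mul_le_mul_of_nonneg_right hδb (sq_nonneg q)
  nlinarith

/-- Near a saddle, two solutions that approach it on the same side have a common point. -/
theorem LinearizedAt.exists_eq_of_saddle {F : E → E} {z₀ : E} {α β : E →L[ℝ] ℝ} {l₁ l₂ : ℝ}
    (h : LinearizedAt F z₀ α β l₁ l₂) (h1 : 0 < l₁) (h2 : l₂ < 0)
    (hinj : ∀ w, α w = 0 → β w = 0 → w = 0) {z y : ℝ → E}
    (hz : ∀ᶠ t in atTop, HasDerivAt z (F (z t)) t) (hy : ∀ᶠ t in atTop, HasDerivAt y (F (y t)) t)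
    (hz0 : Tendsto z atTop (𝓝 z₀)) (hy0 : Tendsto y atTop (𝓝 z₀))
    (hzpos : ∀ᶠ t in atTop, 0 < α (z t - z₀)) (hypos : ∀ᶠ t in atTop, 0 < α (y t - z₀))
    (T₀ : ℝ) : ∃ s t, T₀ ≤ s ∧ T₀ ≤ t ∧ z s = y t := by
  obtain ⟨δ, hδ, hδ1, hδ2⟩ : ∃ δ > 0, 2 * δ ≤ l₁ ∧ 2 * δ ≤ -l₂ :=
    ⟨min l₁ (-l₂) / 2, by have : 0 < min l₁ (-l₂) := lt_min h1 (by linarith)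
                          positivity,
      by have := min_le_left l₁ (-l₂); linarith, by have := min_le_right l₁ (-l₂); linarith⟩
  obtain ⟨U, hU, V, hV, hUV⟩ := Filter.mem_prod_iff.1 (h δ hδ)
  obtain ⟨T₁, hT₁⟩ := eventually_atTop.1 ((hz.and hzpos).and ((hy.and hypos).and
    ((hz0.eventually_mem hU).and (hy0.eventually_mem hV))))
  obtain ⟨T, hT₁T, hT₀T⟩ : ∃ T, T₁ ≤ T ∧ T₀ ≤ T := ⟨max T₁ T₀, le_max_left _ _, le_max_right _ _⟩
  have hT := fun t (ht : T ≤ t) => hT₁ t (hT₁T.trans ht)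
  have hzl : Tendsto (fun t => α (z t - z₀)) atTop (𝓝 0) := by
    have := (α.continuous.tendsto _).comp (hz0.sub_const z₀)
    simpa [Function.comp_def] using this
  have hyl : Tendsto (fun t => α (y t - z₀)) atTop (𝓝 0) := by
    have := (α.continuous.tendsto _).comp (hy0.sub_const z₀)
    simpa [Function.comp_def] using this
  have reach : ∀ x : ℝ → E, (∀ t, T ≤ t → HasDerivAt x (F (x t)) t) →
      Tendsto (fun t => α (x t - z₀)) atTop (𝓝 0) → ∀ m, 0 < m → m ≤ α (x T - z₀) →
      ∃ t, T ≤ t ∧ α (x t - z₀) = m := by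
    intro x hx hlim m hm hmT
    obtain ⟨S, hS, hTS⟩ := ((hlim.eventually (gt_mem_nhds hm)).and (eventually_ge_atTop T)).exists
    obtain ⟨t, ht, hte⟩ := (isPreconnected_Ici (a := T)).intermediate_value₂
      (f := fun t => α (x t - z₀)) (g := fun _ => m)
      (mem_Ici.2 hTS) (mem_Ici.2 le_rfl) (fun t ht =>
        ((α.continuous.continuousAt.comp
          ((hx t ht).continuousAt.sub continuousAt_const))).continuousWithinAt)
      continuousOn_const hS.le hmT
    exact ⟨t, ht, hte⟩
  -- Both stable coordinates take the value `m` at some time after `T`. Starting the two solutions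
  -- at those times makes their difference have vanishing `α`-coordinate.
  set m := min (α (z T - z₀)) (α (y T - z₀)) with hm
  have hmpos : 0 < m := lt_min (hT T le_rfl).1.2 (hT T le_rfl).2.1.2
  obtain ⟨s, hs, hsm⟩ := reach z (fun t ht => (hT t ht).1.1) hzl m hmpos (min_le_left _ _)
  obtain ⟨t, ht, htm⟩ := reach y (fun t ht => (hT t ht).2.1.1) hyl m hmpos (min_le_right _ _)
  refine ⟨s, t, hT₀T.trans hs, hT₀T.trans ht, ?_⟩
  have hD : ∀ τ, 0 ≤ τ → HasDerivAt (fun τ => z (s + τ) - y (t + τ))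
      (F (z (s + τ)) - F (y (t + τ))) τ := fun τ hτ =>
    ((hT (s + τ) (by linarith)).1.1.comp_const_add s τ).sub
      ((hT (t + τ) (by linarith)).2.1.1.comp_const_add t τ)
  have hα : ∀ τ, 0 ≤ τ → HasDerivAt (fun τ => α (z (s + τ) - y (t + τ)))
      (α (F (z (s + τ)) - F (y (t + τ)))) τ := fun τ hτ => α.hasFDerivAt.comp_hasDerivAt τ (hD τ hτ)
  have hβ : ∀ τ, 0 ≤ τ → HasDerivAt (fun τ => β (z (s + τ) - y (t + τ)))
      (β (F (z (s + τ)) - F (y (t + τ)))) τ := fun τ hτ => β.hasFDerivAt.comp_hasDerivAt τ (hD τ hτ)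
  -- Strict differentiability gives the hyperbolic estimate for the difference of two solutions.
  -- There `β² - α²` is nondecreasing with limit `0`, so it is at most `0` initially; as `α = 0`
  -- there, also `β = 0`.
  have hmono := mono_of_hasDerivAt_nonneg (a := 0)
    (w := fun τ => β (z (s + τ) - y (t + τ)) ^ 2 - α (z (s + τ) - y (t + τ)) ^ 2)
    (w' := fun τ => 2 * β (z (s + τ) - y (t + τ)) * β (F (z (s + τ)) - F (y (t + τ))) -
      2 * α (z (s + τ) - y (t + τ)) * α (F (z (s + τ)) - F (y (t + τ))))
    (fun τ hτ => (((hβ τ hτ).pow 2).sub ((hα τ hτ).pow 2)).congr_deriv (by simp))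
    (fun τ hτ => by
      have := hUV (show (z (s + τ), y (t + τ)) ∈ U ×ˢ V from
        ⟨(hT (s + τ) (by linarith)).2.2.1, (hT (t + τ) (by linarith)).2.2.2⟩)
      exact hyperbolic_growth (b := -l₂) hδ1 hδ2 hδ.le this.1 (by simpa using this.2))
  have hlimD : Tendsto (fun τ => z (s + τ) - y (t + τ)) atTop (𝓝 0) := by
    have a1 := hz0.comp (tendsto_atTop_add_const_left atTop s tendsto_id)
    have a2 := hy0.comp (tendsto_atTop_add_const_left atTop t tendsto_id)
    simpa using a1.sub a2
  have hlim : Tendsto (fun τ => β (z (s + τ) - y (t + τ)) ^ 2 - α (z (s + τ) - y (t + τ)) ^ 2)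
      atTop (𝓝 0) := by
    have a1 := ((β.continuous.tendsto _).comp hlimD).pow 2
    have a2 := ((α.continuous.tendsto _).comp hlimD).pow 2
    simpa using a1.sub a2
  have hle := ge_of_tendsto hlim
    (by filter_upwards [eventually_ge_atTop 0] with τ hτ using hmono (mem_Ici.2 le_rfl) hτ hτ)
  simp only [add_zero] at hle
  have hα0 : α (z s - y t) = 0 := by
    have : z s - y t = (z s - z₀) - (y t - z₀) := by abel
    rw [this, map_sub, hsm, htm, sub_self]
  rw [hα0] at hle
  have hβ0 : β (z s - y t) = 0 := by nlinarith [sq_nonneg (β (z s - y t))]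
  exact sub_eq_zero.1 (hinj _ hα0 hβ0)

/-- The stable curve of a saddle at the origin, for a globally Lipschitz vector field. -/
theorem exists_solution_in_cone [CompleteSpace E] {F : E → E} {K : NNReal} {α β : E →L[ℝ] ℝ}
    {e₁ e₂ : E} {a b δ : ℝ}
    (hF : ContDiff ℝ 1 F) (hK : LipschitzWith K F) (hF0 : F 0 = 0)
    (hinj : ∀ w, α w = 0 → β w = 0 → w = 0)
    (h11 : α e₁ = 1) (h12 : α e₂ = 0) (h21 : β e₁ = 0) (h22 : β e₂ = 1)
    (hδ : 0 < δ) (hδa : 4 * δ ≤ a) (hδb : 4 * δ ≤ b)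
    (hα : ∀ w, |α (F w) + a * α w| ≤ δ * (|α w| + |β w|))
    (hβ : ∀ w, |β (F w) + -b * β w| ≤ δ * (|α w| + |β w|)) {u₀ : ℝ} (hu₀ : 0 < u₀) :
    ∃ γ : ℝ → E, (∀ t, HasDerivAt γ (F (γ t)) t) ∧ ∀ t, 0 ≤ t →
      0 < α (γ t) ∧ |β (γ t)| ≤ α (γ t) ∧ α (γ t) ^ 2 ≤ u₀ ^ 2 * Real.exp (-a * t) := by
  choose γ hγ0 hγ using fun s : ℝ =>
    exists_forall_hasDerivAt_of_lipschitzWith hF hK (u₀ • e₁ + s • e₂)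
  have hcont : ∀ t, 0 ≤ t → Continuous (fun s => γ s t) := by
    intro t ht
    have hL : LipschitzWith (Real.toNNReal (‖e₂‖ * Real.exp (K * t))) (fun s => γ s t) := by
      refine LipschitzWith.of_dist_le_mul fun s s' => ?_
      have := dist_le_of_trajectories_ODE (v := fun _ => F) (K := K) (f := γ s) (g := γ s')
        (a := 0) (b := t) (δ := dist s s' * ‖e₂‖) (fun _ => hK)
        (fun τ _ => (hγ s τ).continuousAt.continuousWithinAt)
        (fun τ _ => (hγ s τ).hasDerivWithinAt)
        (fun τ _ => (hγ s' τ).continuousAt.continuousWithinAt)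
        (fun τ _ => (hγ s' τ).hasDerivWithinAt)
        (by rw [hγ0, hγ0, dist_eq_norm, add_sub_add_left_eq_sub, ← sub_smul, norm_smul,
              Real.dist_eq, Real.norm_eq_abs]) t ⟨ht, le_rfl⟩
      rw [Real.coe_toNNReal _ (by positivity)]
      simp only [sub_zero] at this
      linarith
    exact hL.continuous
  have hdα : ∀ s t, HasDerivAt (fun t => α (γ s t)) (α (F (γ s t))) t := fun s t =>
    α.hasFDerivAt.comp_hasDerivAt t (hγ s t)
  have hdβ : ∀ s t, HasDerivAt (fun t => β (γ s t)) (β (F (γ s t))) t := fun s t =>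
    β.hasFDerivAt.comp_hasDerivAt t (hγ s t)
  have hmono : ∀ s t₀, MonotoneOn (fun t => β (γ s t) ^ 2 - α (γ s t) ^ 2) (Ici t₀) := fun s t₀ =>
    mono_of_hasDerivAt_nonneg
      (w' := fun t => 2 * β (γ s t) * β (F (γ s t)) - 2 * α (γ s t) * α (F (γ s t)))
      (fun t _ => (((hdβ s t).pow 2).sub ((hdα s t).pow 2)).congr_deriv (by simp))
      (fun t _ => hyperbolic_growth (by linarith) (by linarith) hδ.le (hα _) (hβ _))
  -- Shooting from the segment `u₀ e₁ + s e₂`: `A` and `B` collect the parameters whose solution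
  -- leaves the cone `|β| ≤ |α|` through the upper or the lower side. If these open nonempty sets
  -- covered the line, connectedness would give a common parameter.
  set A : Set ℝ := ⋃ t ∈ Ici (0 : ℝ), {s | |α (γ s t)| < β (γ s t)} with hA
  set B : Set ℝ := ⋃ t ∈ Ici (0 : ℝ), {s | |α (γ s t)| < -β (γ s t)} with hB
  have hAo : IsOpen A := isOpen_biUnion fun t ht =>
    isOpen_lt (α.continuous.comp (hcont t ht)).abs (β.continuous.comp (hcont t ht))
  have hBo : IsOpen B := isOpen_biUnion fun t ht =>
    isOpen_lt (α.continuous.comp (hcont t ht)).abs (β.continuous.comp (hcont t ht)).neg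
  obtain ⟨s, hsA, hsB⟩ : ∃ s, s ∉ A ∧ s ∉ B := by
    by_contra hcon
    push Not at hcon
    obtain ⟨s, -, hsA, hsB⟩ := isPreconnected_univ (α := ℝ) A B hAo hBo
      (fun s _ => by
        by_cases hs : s ∈ A
        · exact Or.inl hs
        · exact Or.inr (hcon s hs))
      ⟨2 * u₀, mem_univ _, mem_biUnion (mem_Ici.2 le_rfl) (by
        simp only [mem_ofPred_eq, hγ0, map_add, map_smul, h11, h12, h21, h22, smul_eq_mul]
        rw [abs_lt]; constructor <;> linarith)⟩
      ⟨-(2 * u₀), mem_univ _, mem_biUnion (mem_Ici.2 le_rfl) (by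
        simp only [mem_ofPred_eq, hγ0, map_add, map_smul, h11, h12, h21, h22, smul_eq_mul]
        rw [abs_lt]; constructor <;> linarith)⟩
    simp only [hA, hB, mem_iUnion, mem_ofPred_eq, exists_prop] at hsA hsB
    obtain ⟨t, ht, h1⟩ := hsA
    obtain ⟨t', ht', h2⟩ := hsB
    -- From the earlier of the two exit times on, `β² - α²` stays positive. So `β` never vanishes
    -- and keeps its sign, which contradicts leaving through both sides.
    have hΦ : 0 < β (γ s (min t t')) ^ 2 - α (γ s (min t t')) ^ 2 := by
      rcases min_choice t t' with h | h <;> rw [h]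
      · have := sq_lt_sq' (by linarith [abs_nonneg (α (γ s t))]) h1
        rw [sq_abs] at this
        linarith
      · have := sq_lt_sq' (by linarith [abs_nonneg (α (γ s t'))]) h2
        rw [sq_abs, neg_sq] at this
        linarith
    have hne : ∀ τ, min t t' ≤ τ → β (γ s τ) ≠ 0 := by
      intro τ hτ h0
      have := hmono s (min t t') (mem_Ici.2 le_rfl) (mem_Ici.2 hτ) hτ
      simp only [h0] at this
      nlinarith [sq_nonneg (α (γ s τ))]
    rcases eventually_pos_or_neg (u := fun τ => β (γ s τ))
      (fun τ _ => (hdβ s τ).continuousAt.continuousWithinAt) hne with h | h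
    · have := h t' (min_le_right _ _)
      linarith [abs_nonneg (α (γ s t'))]
    · have := h t (min_le_left _ _)
      linarith [abs_nonneg (α (γ s t))]
  have hcone : ∀ t, 0 ≤ t → |β (γ s t)| ≤ |α (γ s t)| := by
    intro t ht
    simp only [hA, hB, mem_iUnion, mem_ofPred_eq, exists_prop, not_exists, not_and, not_lt]
      at hsA hsB
    exact abs_le.2 ⟨by linarith [hsB t ht], hsA t ht⟩
  have hstart : α (γ s 0) = u₀ := by simp [hγ0, h11, h12]
  have hne : ∀ t, 0 ≤ t → α (γ s t) ≠ 0 := by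
    intro t ht h0
    have h1 : β (γ s t) = 0 := by
      have := hcone t ht
      rw [h0, abs_zero] at this
      exact abs_nonpos_iff.1 this
    -- Inside the cone `α = 0` means being at the equilibrium, and uniqueness would then make the
    -- whole solution constant.
    have h2 := hinj _ h0 h1
    have h3 : γ s = fun _ => 0 := ODE_solution_unique_univ (v := fun _ => F) (s := fun _ => univ)
      (K := K) (t₀ := t) (fun _ => hK.lipschitzOnWith) (fun τ => ⟨hγ s τ, mem_univ _⟩)
      (fun τ => ⟨(hasDerivAt_const τ (0 : E)).congr_deriv hF0.symm, mem_univ _⟩) h2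
    rw [h3] at hstart
    simp at hstart
    linarith
  have hpos : ∀ t, 0 ≤ t → 0 < α (γ s t) := by
    rcases eventually_pos_or_neg (u := fun τ => α (γ s τ))
      (fun τ _ => (hdα s τ).continuousAt.continuousWithinAt) hne with h | h
    · exact h
    · have := h 0 le_rfl
      rw [hstart] at this
      linarith
  refine ⟨γ s, hγ s, fun t ht => ⟨hpos t ht, ?_, ?_⟩⟩
  · have := hcone t ht
    rwa [abs_of_pos (hpos t ht)] at this
  · have hexp : ∀ t, HasDerivAt (fun t => Real.exp (a * t)) (Real.exp (a * t) * a) t := fun t => by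
      simpa using ((hasDerivAt_id t).const_mul a).exp
    have hm := mono_of_hasDerivAt_nonneg (a := 0)
      (w := fun t => -(α (γ s t) ^ 2 * Real.exp (a * t)))
      (w' := fun t => -(2 * α (γ s t) * α (F (γ s t)) * Real.exp (a * t) +
        α (γ s t) ^ 2 * (Real.exp (a * t) * a)))
      (fun t _ => ((((hdα s t).pow 2).mul (hexp t)).neg).congr_deriv (by simp))
      (fun t ht => by
        have e1 := (abs_le.1 (hα (γ s t))).2
        have e2 := hcone t ht
        have e3 := hpos t ht
        rw [abs_of_pos e3] at e1 e2
        -- In the cone the error is at most `2δα ≤ (a/2)α`, so half of the contraction rate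
        -- survives; hence `α²` decays at rate `a`.
        have e4 : α (F (γ s t)) ≤ - (a / 2) * α (γ s t) := by nlinarith
        have e5 := mul_le_mul_of_nonneg_left e4 e3.le
        have e6 := (Real.exp_pos (a * t)).le
        have e7 : 2 * α (γ s t) * α (F (γ s t)) + α (γ s t) ^ 2 * a ≤ 0 := by nlinarith
        nlinarith [mul_le_mul_of_nonneg_right e7 e6])
    have h1 := hm (mem_Ici.2 le_rfl) (mem_Ici.2 ht) ht
    simp only [hstart, mul_zero, Real.exp_zero, mul_one, neg_le_neg_iff] at h1
    rw [neg_mul, Real.exp_neg, ← div_eq_mul_inv, le_div_iff₀ (Real.exp_pos _)]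
    exact h1

end Planar

/-- Existence of the stable curve of a saddle. -/
theorem LinearizedAt.exists_stable_solution {E : Type*} [NormedAddCommGroup E] [NormedSpace ℝ E]
    [FiniteDimensional ℝ E] {F : E → E} {z₀ : E} {α β : E →L[ℝ] ℝ} {l₁ l₂ : ℝ} {e₁ e₂ : E}
    (h : LinearizedAt F z₀ α β l₁ l₂) (hF0 : F z₀ = 0) (hF : ContDiffAt ℝ 1 F z₀)
    (h1 : 0 < l₁) (h2 : l₂ < 0)
    (h11 : α e₁ = 1) (h12 : α e₂ = 0) (h21 : β e₁ = 0) (h22 : β e₂ = 1)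
    (hrep : ∀ w, w = α w • e₁ + β w • e₂) {U : Set E} (hU : U ∈ 𝓝 z₀) :
    ∃ z : ℝ → E, (∀ t, 0 ≤ t → HasDerivAt z (F (z t)) t ∧ z t ∈ U ∧ 0 < α (z t - z₀)) ∧
      Tendsto z atTop (𝓝 z₀) := by
  have : CompleteSpace E := FiniteDimensional.complete ℝ E
  obtain ⟨δ, hδ, hδ1, hδ2⟩ : ∃ δ > 0, 4 * δ ≤ l₁ ∧ 4 * δ ≤ -l₂ :=
    ⟨min l₁ (-l₂) / 4, by have : 0 < min l₁ (-l₂) := lt_min h1 (by linarith)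
                          positivity,
      by have := min_le_left l₁ (-l₂); linarith, by have := min_le_right l₁ (-l₂); linarith⟩
  -- Specializes the estimate on pairs of points to pairs whose second point is `z₀`.
  have hest := (h δ hδ).curry.mono fun x hx => hx.self_of_nhds
  have hC1 := hF.eventually (by simp)
  obtain ⟨r', hr', hball⟩ := Metric.eventually_nhds_iff_ball.1 (hest.and (hC1.and hU))
  obtain ⟨r, hr, rfl⟩ : ∃ r > 0, r' = 3 * r := ⟨r' / 3, by positivity, by ring⟩
  set χ : ContDiffBump (0 : E) := ⟨r, 2 * r, hr, by linarith⟩ with hχ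
  -- The field is replaced by its linear part plus the cut-off remainder. The new field is globally
  -- Lipschitz, satisfies the same error bounds, and agrees with the original on the ball of radius
  -- `r`.
  set A : E →L[ℝ] E := -(l₁ • α.smulRight e₁) - l₂ • β.smulRight e₂ with hA
  have hAα : ∀ w, α (A w) = -l₁ * α w := fun w => by simp [hA, h11, h12]
  have hAβ : ∀ w, β (A w) = -l₂ * β w := fun w => by simp [hA, h21, h22]
  set R : E → E := fun w => F (z₀ + w) - A w with hR
  set G : E → E := fun w => χ w • R w with hG
  have hout : ∀ w, w ∉ Metric.closedBall (0 : E) (2 * r) → χ w = 0 := fun w hw => by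
    refine χ.zero_of_le_dist ?_
    simp only [Metric.mem_closedBall, not_le] at hw
    exact hw.le
  have hRC : ∀ w ∈ Metric.ball (0 : E) (3 * r), ContDiffAt ℝ 1 R w := fun w hw => by
    have : ContDiffAt ℝ 1 F (z₀ + w) := (hball (z₀ + w) (by simpa using hw)).2.1
    exact (this.comp w (contDiffAt_const.add contDiffAt_id)).sub A.contDiff.contDiffAt
  have hGC : ContDiff ℝ 1 G := contDiff_iff_contDiffAt.2 fun w => by
    by_cases hw : w ∈ Metric.ball (0 : E) (3 * r)
    · exact χ.contDiff.contDiffAt.smul (hRC w hw)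
    · have hw' : w ∉ Metric.closedBall (0 : E) (2 * r) := fun hc => hw
        (Metric.closedBall_subset_ball (by linarith) hc)
      have : G =ᶠ[𝓝 w] fun _ => 0 := by
        filter_upwards [Metric.isClosed_closedBall.isOpen_compl.mem_nhds hw'] with y hy
        simp [hG, hout y hy]
      exact contDiffAt_const.congr_of_eventuallyEq this
  obtain ⟨K, hK⟩ := hGC.lipschitzWith_of_hasCompactSupport
    (χ.hasCompactSupport.smul_right) (by simp)
  have hRest : ∀ w ∈ Metric.ball (0 : E) (3 * r),
      |α (R w)| ≤ δ * (|α w| + |β w|) ∧ |β (R w)| ≤ δ * (|α w| + |β w|) := fun w hw => by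
    have := (hball (z₀ + w) (by simpa using hw)).1
    simp only [hF0, sub_zero, add_sub_cancel_left] at this
    simpa only [hR, map_sub, hAα, hAβ, neg_mul, sub_neg_eq_add] using this
  have hGest : ∀ w, |α (G w)| ≤ δ * (|α w| + |β w|) ∧ |β (G w)| ≤ δ * (|α w| + |β w|) := by
    intro w
    by_cases hw : w ∈ Metric.ball (0 : E) (3 * r)
    · have := hRest w hw
      simp only [hG, map_smul, smul_eq_mul, abs_mul, abs_of_nonneg (χ.nonneg' w)]
      exact ⟨(mul_le_of_le_one_left (abs_nonneg _) χ.le_one).trans this.1,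
        (mul_le_of_le_one_left (abs_nonneg _) χ.le_one).trans this.2⟩
    · have hw' : w ∉ Metric.closedBall (0 : E) (2 * r) := fun hc => hw
        (Metric.closedBall_subset_ball (by linarith) hc)
      have : 0 ≤ δ * (|α w| + |β w|) := by positivity
      simp [hG, hout w hw', this]
  -- With this initial height a solution in the cone, whose `α` never exceeds `u₀`, stays where the
  -- cut-off equals `1`.
  obtain ⟨u₀, hu₀, hu₀r⟩ : ∃ u₀ > 0, u₀ * (‖e₁‖ + ‖e₂‖) ≤ r :=
    ⟨r / (‖e₁‖ + ‖e₂‖ + 1), by positivity, by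
      rw [div_mul_eq_mul_div, div_le_iff₀ (by positivity)]
      nlinarith [norm_nonneg e₁, norm_nonneg e₂]⟩
  obtain ⟨γ, hγ, hγc⟩ := exists_solution_in_cone (F := fun w => A w + G w) (α := α) (β := β)
    (e₁ := e₁) (e₂ := e₂) (a := l₁) (b := -l₂) (δ := δ) (A.contDiff.add hGC)
    (A.lipschitz.add hK) (by simp [hG, hR, hF0])
    (fun w ha hb => by rw [hrep w, ha, hb]; simp) h11 h12 h21 h22 hδ hδ1 hδ2
    (fun w => by simpa [hAα] using (hGest w).1) (fun w => by simpa [hAβ] using (hGest w).2) hu₀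
  have hnorm : ∀ t, 0 ≤ t → ‖γ t‖ ≤ α (γ t) * (‖e₁‖ + ‖e₂‖) := fun t ht => by
    obtain ⟨c1, c2, -⟩ := hγc t ht
    calc ‖γ t‖ = ‖α (γ t) • e₁ + β (γ t) • e₂‖ := by rw [← hrep]
      _ ≤ |α (γ t)| * ‖e₁‖ + |β (γ t)| * ‖e₂‖ := by
        simpa [norm_smul] using norm_add_le (α (γ t) • e₁) (β (γ t) • e₂)
      _ ≤ α (γ t) * ‖e₁‖ + α (γ t) * ‖e₂‖ := by rw [abs_of_pos c1]; gcongr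
      _ = _ := by ring
  have hsmall : ∀ t, 0 ≤ t → ‖γ t‖ ≤ r := fun t ht => by
    obtain ⟨c1, -, c3⟩ := hγc t ht
    have : α (γ t) ^ 2 ≤ u₀ ^ 2 := c3.trans (mul_le_of_le_one_right (sq_nonneg _)
      (Real.exp_le_one_iff.2 (by nlinarith)))
    have := abs_le_of_sq_le_sq this hu₀.le
    exact (hnorm t ht).trans ((mul_le_mul_of_nonneg_right ((le_abs_self _).trans this)
      (by positivity)).trans hu₀r)
  refine ⟨fun t => z₀ + γ t, fun t ht => ⟨?_, ?_, ?_⟩, ?_⟩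
  · refine ((hγ t).const_add z₀).congr_deriv ?_
    have : χ (γ t) = 1 := χ.one_of_mem_closedBall (by simpa using hsmall t ht)
    simp [hG, hR, this]
  · exact (hball (z₀ + γ t) (by
      rw [Metric.mem_ball, dist_eq_norm, add_sub_cancel_left]
      linarith [hsmall t ht])).2.2
  · simpa using (hγc t ht).1
  · have hα2 : Tendsto (fun t => α (γ t) ^ 2) atTop (𝓝 0) := by
      have hexp : Tendsto (fun t : ℝ => u₀ ^ 2 * Real.exp (-l₁ * t)) atTop (𝓝 0) := by
        have : Tendsto (fun t : ℝ => -l₁ * t) atTop atBot :=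
          tendsto_id.const_mul_atTop_of_neg (by linarith)
        simpa using (Real.tendsto_exp_atBot.comp this).const_mul (u₀ ^ 2)
      exact squeeze_zero' (Eventually.of_forall fun t => sq_nonneg _)
        (by filter_upwards [eventually_ge_atTop 0] with t ht using (hγc t ht).2.2) hexp
    have hα : Tendsto (fun t => α (γ t)) atTop (𝓝 0) := by
      have := (Real.continuous_sqrt.tendsto 0).comp hα2
      rw [Real.sqrt_zero] at this
      refine this.congr' ?_
      filter_upwards [eventually_ge_atTop 0] with t ht
      exact Real.sqrt_sq (hγc t ht).1.le
    have : Tendsto γ atTop (𝓝 0) := squeeze_zero_norm'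
      (by filter_upwards [eventually_ge_atTop 0] with t ht using hnorm t ht)
      (by simpa using hα.mul_const (‖e₁‖ + ‖e₂‖))
    simpa using this.const_add z₀

variable {M : Type*} [TopologicalSpace M] [ChartedSpace Plane M] [IsManifold (𝓡 2) ∞ M]

/-! ### The gradient field in a chart -/

/-- The metric in the chart at `c`. -/
def coordMetric (g : SurfaceMetric M) (c : M) (z : Plane) : Plane →L[ℝ] Plane →L[ℝ] ℝ :=
  let B : Plane →L[ℝ] Plane →L[ℝ] ℝ := g.inner ((extChartAt (𝓡 2) c).symm z)
  let T : Plane →L[ℝ] Plane := mfderiv 𝓘(ℝ, Plane) (𝓡 2) (extChartAt (𝓡 2) c).symm z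
  B.bilinearComp T T

/-- The field `-∇f` in the chart at `c`. -/
def chartField (g : SurfaceMetric M) (f : M → ℝ) (c : M) (z : Plane) : Plane :=
  mfderiv (𝓡 2) 𝓘(ℝ, Plane) (extChartAt (𝓡 2) c) ((extChartAt (𝓡 2) c).symm z)
    (-grad g f ((extChartAt (𝓡 2) c).symm z))

theorem coordMetric_apply (g : SurfaceMetric M) (c : M) (z v w : Plane) :
    coordMetric g c z v w = g.inner ((extChartAt (𝓡 2) c).symm z)
      (mfderiv 𝓘(ℝ, Plane) (𝓡 2) (extChartAt (𝓡 2) c).symm z v)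
      (mfderiv 𝓘(ℝ, Plane) (𝓡 2) (extChartAt (𝓡 2) c).symm z w) := rfl

theorem metricMatrix_apply (g : SurfaceMetric M) (c : M) (z : Plane) (i j : Fin 2) :
    metricMatrix g c z i j = coordMetric g c z (basisVec i) (basisVec j) := rfl

theorem mfderiv_chart_symm_self (c : M) :
    mfderiv 𝓘(ℝ, Plane) (𝓡 2) (extChartAt (𝓡 2) c).symm (extChartAt (𝓡 2) c c) =
      ContinuousLinearMap.id ℝ Plane := by
  have := mfderivWithin_range_extChartAt_symm (I := 𝓡 2) (x := c)
  rw [ModelWithCorners.range_eq_univ, mfderivWithin_univ] at this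
  exact this

theorem mfderiv_chart_symm_comp {c : M} {z : Plane} (hz : z ∈ (extChartAt (𝓡 2) c).target)
    (v : TangentSpace (𝓡 2) ((extChartAt (𝓡 2) c).symm z)) :
    mfderiv 𝓘(ℝ, Plane) (𝓡 2) (extChartAt (𝓡 2) c).symm z
      (mfderiv (𝓡 2) 𝓘(ℝ, Plane) (extChartAt (𝓡 2) c) ((extChartAt (𝓡 2) c).symm z) v) = v := by
  have := mfderivWithin_extChartAt_symm_comp_mfderiv_extChartAt (I := 𝓡 2) hz
  rw [ModelWithCorners.range_eq_univ, mfderivWithin_univ] at this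
  exact congrArg (fun l => l v) this

theorem mdifferentiableAt_chart_symm {c : M} {z : Plane} (hz : z ∈ (extChartAt (𝓡 2) c).target) :
    MDifferentiableAt 𝓘(ℝ, Plane) (𝓡 2) (extChartAt (𝓡 2) c).symm z := by
  have := mdifferentiableWithinAt_extChartAt_symm (I := 𝓡 2) hz
  rwa [ModelWithCorners.range_eq_univ, mdifferentiableWithinAt_univ] at this

theorem coordMetric_self (g : SurfaceMetric M) (c : M) (v w : Plane) :
    coordMetric g c (extChartAt (𝓡 2) c c) v w =
      g.inner c (v : TangentSpace (𝓡 2) c) (w : TangentSpace (𝓡 2) c) := by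
  rw [coordMetric_apply, mfderiv_chart_symm_self]
  have h : (extChartAt (𝓡 2) c).symm (extChartAt (𝓡 2) c c) = c := extChartAt_to_inv c
  generalize (extChartAt (𝓡 2) c).symm (extChartAt (𝓡 2) c c) = y at h
  subst h
  rfl

theorem coordMetric_symm (g : SurfaceMetric M) (c : M) (z v w : Plane) :
    coordMetric g c z v w = coordMetric g c z w v := g.symm _ _ _

theorem fderiv_comp_chart_symm {f : M → ℝ} (hf : ContMDiff (𝓡 2) 𝓘(ℝ, ℝ) ∞ f) {c : M} {z : Plane}
    (hz : z ∈ (extChartAt (𝓡 2) c).target) (w : Plane) :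
    fderiv ℝ (f ∘ (extChartAt (𝓡 2) c).symm) z w =
      mfderiv (𝓡 2) 𝓘(ℝ, ℝ) f ((extChartAt (𝓡 2) c).symm z)
        (mfderiv 𝓘(ℝ, Plane) (𝓡 2) (extChartAt (𝓡 2) c).symm z w) := by
  rw [← mfderiv_eq_fderiv, mfderiv_comp z ((hf _).mdifferentiableAt (by simp))
    (mdifferentiableAt_chart_symm hz)]
  rfl

theorem coordMetric_chartField (g : SurfaceMetric M) {f : M → ℝ}
    (hf : ContMDiff (𝓡 2) 𝓘(ℝ, ℝ) ∞ f) {c : M} {z : Plane}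
    (hz : z ∈ (extChartAt (𝓡 2) c).target) (w : Plane) :
    coordMetric g c z (chartField g f c z) w = -fderiv ℝ (f ∘ (extChartAt (𝓡 2) c).symm) z w := by
  rw [coordMetric_apply, chartField, mfderiv_chart_symm_comp hz, fderiv_comp_chart_symm hf hz,
    map_neg, ← inner_grad g f]
  rfl

theorem coordMetric_pos (g : SurfaceMetric M) {c : M} {z : Plane}
    (hz : z ∈ (extChartAt (𝓡 2) c).target) {v : Plane} (hv : v ≠ 0) :
    0 < coordMetric g c z v v := by
  rw [coordMetric_apply]
  refine g.pos _ _ fun h => hv ?_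
  have := mfderiv_extChartAt_comp_mfderivWithin_extChartAt_symm (I := 𝓡 2) hz
  rw [ModelWithCorners.range_eq_univ, mfderivWithin_univ] at this
  have h2 : mfderiv (𝓡 2) 𝓘(ℝ, Plane) (extChartAt (𝓡 2) c) ((extChartAt (𝓡 2) c).symm z)
      (mfderiv 𝓘(ℝ, Plane) (𝓡 2) (extChartAt (𝓡 2) c).symm z v) = v := congrArg (fun l => l v) this
  rw [h, map_zero] at h2
  exact h2.symm

theorem contDiffAt_comp_chart_symm {f : M → ℝ} (hf : ContMDiff (𝓡 2) 𝓘(ℝ, ℝ) ∞ f) {c : M}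
    {z : Plane} (hz : z ∈ (extChartAt (𝓡 2) c).target) :
    ContDiffAt ℝ ∞ (f ∘ (extChartAt (𝓡 2) c).symm) z := by
  have h := (contMDiffOn_extChartAt_symm (I := 𝓡 2) (n := ∞) c).contMDiffAt
    ((isOpen_extChartAt_target c).mem_nhds hz)
  exact ((hf _).comp z h).contDiffAt

/-- The metric is a smooth section, so it may be evaluated on the local vector fields that are
constant in the tangent trivialization at `c`; in the chart these are the images of the constant
vectors `v` and `w`. -/
theorem contDiffAt_coordMetric_apply (g : SurfaceMetric M) (c : M) (v w : Plane) :
    ContDiffAt ℝ ∞ (fun z => coordMetric g c z v w) (extChartAt (𝓡 2) c c) := by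
  set e := trivializationAt Plane (TangentSpace (𝓡 2) : M → Type _) c with he
  have hsec : ∀ v : Plane, ContMDiffAt (𝓡 2) (𝓡 2).tangent ∞
      (fun x => (⟨x, e.symm x v⟩ : TangentBundle (𝓡 2) M)) c := fun v => by
    have h1 := (e.contMDiffOn_symm (IB := 𝓡 2) (n := ∞)).contMDiffAt (x := (c, v))
      (e.open_target.mem_nhds (by
        rw [e.mem_target]; exact FiberBundle.mem_baseSet_trivializationAt' c))
    have h2 : ContMDiffAt (𝓡 2) ((𝓡 2).prod 𝓘(ℝ, Plane)) ∞ (fun x : M => (x, v)) c :=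
      contMDiffAt_id.prodMk contMDiffAt_const
    refine (ContMDiffAt.comp c h1 h2).congr_of_eventuallyEq ?_
    filter_upwards [e.open_baseSet.mem_nhds (FiberBundle.mem_baseSet_trivializationAt' c)] with x hx
    exact e.mk_symm hx v
  have hfun : ContMDiffAt (𝓡 2) 𝓘(ℝ, ℝ) ∞
      (fun x => g.inner x (e.symm x v) (e.symm x w)) c := by
    have := ContMDiffAt.clm_bundle_apply₂ (IB := 𝓡 2) (F₁ := Plane) (F₂ := Plane) (F₃ := ℝ)
      (E₃ := Bundle.Trivial M ℝ) (b := fun x : M => x)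
      (ψ := g.inner) (g.contMDiff c) (hsec v) (hsec w)
    rw [Bundle.contMDiffAt_totalSpace] at this
    exact this.2
  have hz0 := mem_extChartAt_target (I := 𝓡 2) c
  have hsymm := (contMDiffOn_extChartAt_symm (I := 𝓡 2) (n := ∞) c).contMDiffAt
    ((isOpen_extChartAt_target c).mem_nhds hz0)
  have hcomp := ContMDiffAt.comp (extChartAt (𝓡 2) c c)
    (by rw [extChartAt_to_inv]; exact hfun) hsymm
  refine hcomp.contDiffAt.congr_of_eventuallyEq ?_
  filter_upwards [(isOpen_extChartAt_target c).mem_nhds hz0] with z hz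
  have hx : (extChartAt (𝓡 2) c).symm z ∈ (chartAt Plane c).source := by
    rw [← extChartAt_source (𝓡 2)]
    exact (extChartAt (𝓡 2) c).map_target hz
  have hT : ∀ v : Plane, e.symm ((extChartAt (𝓡 2) c).symm z) v =
      mfderiv 𝓘(ℝ, Plane) (𝓡 2) (extChartAt (𝓡 2) c).symm z v := fun v => by
    have := TangentBundle.symmL_trivializationAt (I := 𝓡 2) (𝕜 := ℝ) hx
    rw [ModelWithCorners.range_eq_univ, mfderivWithin_univ,
      (extChartAt (𝓡 2) c).right_inv hz] at this
    rw [← e.symmL_apply (R := ℝ) hx]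
    exact congrArg (fun l => l v) this
  rw [coordMetric_apply, ← hT, ← hT]
  rfl

theorem contDiffAt_clm_of_apply {E F G : Type*} [NormedAddCommGroup E] [NormedSpace ℝ E]
    [NormedAddCommGroup F] [NormedSpace ℝ F] [FiniteDimensional ℝ F]
    [NormedAddCommGroup G] [NormedSpace ℝ G] {n : WithTop ℕ∞} {L : E → F →L[ℝ] G} {z : E}
    (h : ∀ v, ContDiffAt ℝ n (fun y => L y v) z) : ContDiffAt ℝ n L z := by
  let e₁ := ContinuousLinearEquiv.ofFinrankEq
    (Module.finrank_fin_fun (R := ℝ) (n := Module.finrank ℝ F)).symm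
  let e₂ := (e₁.arrowCongr (1 : G ≃L[ℝ] G)).trans
    (ContinuousLinearEquiv.piRing (Fin (Module.finrank ℝ F)))
  rw [← Function.id_comp L, ← e₂.symm_comp_self]
  exact e₂.symm.contDiff.contDiffAt.comp z (contDiffAt_pi.2 fun i => h _)

theorem contDiffAt_coordMetric (g : SurfaceMetric M) (c : M) :
    ContDiffAt ℝ ∞ (coordMetric g c) (extChartAt (𝓡 2) c c) :=
  contDiffAt_clm_of_apply fun v => contDiffAt_clm_of_apply fun w =>
    contDiffAt_coordMetric_apply g c v w

/-- The field solves the linear equation `G(z) X = -dh(z)`, where `h` is `f` in the chart.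
Positivity makes `G(z)` invertible, and inversion of linear maps is smooth. -/
theorem contDiffAt_chartField (g : SurfaceMetric M) {f : M → ℝ}
    (hf : ContMDiff (𝓡 2) 𝓘(ℝ, ℝ) ∞ f) (c : M) :
    ContDiffAt ℝ ∞ (chartField g f c) (extChartAt (𝓡 2) c c) := by
  have hz0 := mem_extChartAt_target (I := 𝓡 2) c
  have hinj : ∀ z ∈ (extChartAt (𝓡 2) c).target, Function.Injective (coordMetric g c z) := by
    intro z hz
    refine (injective_iff_map_eq_zero _).2 fun v hv => ?_
    by_contra hne
    have := coordMetric_pos g hz hne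
    rw [hv] at this
    simp at this
  have hfin : Module.finrank ℝ Plane = Module.finrank ℝ (Plane →L[ℝ] ℝ) := by
    rw [← (LinearMap.toContinuousLinearMap (𝕜 := ℝ) (E := Plane) (F' := ℝ)).finrank_eq]
    exact (Subspace.dual_finrank_eq (K := ℝ) (V := Plane)).symm
  have hinv : ∀ z ∈ (extChartAt (𝓡 2) c).target, ∃ e : Plane ≃L[ℝ] (Plane →L[ℝ] ℝ),
      (e : Plane →L[ℝ] (Plane →L[ℝ] ℝ)) = coordMetric g c z := fun z hz =>
    ⟨(LinearEquiv.ofInjectiveOfFinrankEq (coordMetric g c z).toLinearMap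
      (hinj z hz) hfin).toContinuousLinearEquiv, by ext v w; rfl⟩
  obtain ⟨e, he⟩ := hinv _ hz0
  have h1 : ContDiffAt ℝ ∞ (fun z => (coordMetric g c z).inverse) (extChartAt (𝓡 2) c c) := by
    have := contDiffAt_map_inverse (n := ∞) e
    rw [he] at this
    exact this.comp _ (contDiffAt_coordMetric g c)
  have h2 : ContDiffAt ℝ ∞ (fun z => -fderiv ℝ (f ∘ (extChartAt (𝓡 2) c).symm) z)
      (extChartAt (𝓡 2) c c) :=
    ((contDiffAt_comp_chart_symm hf hz0).fderiv_right (m := ∞) (by simp)).neg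
  refine (h1.clm_apply h2).congr_of_eventuallyEq ?_
  filter_upwards [(isOpen_extChartAt_target c).mem_nhds hz0] with z hz
  obtain ⟨e, he⟩ := hinv z hz
  have : coordMetric g c z (chartField g f c z) = -fderiv ℝ (f ∘ (extChartAt (𝓡 2) c).symm) z := by
    ext1 w
    exact coordMetric_chartField g hf hz w
  rw [← this, ← he]
  simp

/-- In the trivialization at `c` the section is `chartField` after the chart. Smoothness of
`chartField` at the centre is enough, since every point is the centre of its own chart. -/
theorem contMDiff_neg_grad (g : SurfaceMetric M) {f : M → ℝ}
    (hf : ContMDiff (𝓡 2) 𝓘(ℝ, ℝ) ∞ f) :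
    ContMDiff (𝓡 2) (𝓡 2).tangent 1 (fun x => (⟨x, -grad g f x⟩ : TangentBundle (𝓡 2) M)) := by
  intro c
  rw [Bundle.contMDiffAt_section]
  have h1 := ContMDiffAt.comp c (contDiffAt_chartField g hf c).contMDiffAt
    (contMDiffAt_extChartAt (I := 𝓡 2) (n := ∞) (x := c))
  refine (h1.of_le (by simp)).congr_of_eventuallyEq ?_
  filter_upwards [extChartAt_source_mem_nhds (I := 𝓡 2) c] with x hx
  have hx' : x ∈ (chartAt Plane c).source := by rwa [← extChartAt_source (𝓡 2)]
  have h2 := TangentBundle.continuousLinearMapAt_trivializationAt (I := 𝓡 2) (𝕜 := ℝ) hx'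
  have h3 := congrArg (fun l => l (-grad g f x)) h2
  simp only [Function.comp_apply, chartField]
  rw [(extChartAt (𝓡 2) c).left_inv hx]
  refine Eq.trans ?_ h3
  rw [Bundle.Trivialization.continuousLinearMapAt_apply,
    Bundle.Trivialization.coe_linearMapAt_of_mem]
  exact hx'

/-- In the chart at `c`, trajectories are solutions of the ODE given by `chartField`. -/
theorem IsTrajectory.hasDerivAt {g : SurfaceMetric M} {f : M → ℝ} {γ : ℝ → M}
    (hγ : IsTrajectory g f γ) {c : M} {t : ℝ} (ht : γ t ∈ (extChartAt (𝓡 2) c).source) :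
    HasDerivAt (fun s => extChartAt (𝓡 2) c (γ s)) (chartField g f c (extChartAt (𝓡 2) c (γ t)))
      t := by
  have ht' : γ t ∈ (chartAt Plane c).source := by rwa [← extChartAt_source (𝓡 2)]
  have h := HasMFDerivAt.comp t (mdifferentiableAt_extChartAt (I := 𝓡 2) ht').hasMFDerivAt (hγ t)
  have h2 : HasMFDerivAt 𝓘(ℝ, ℝ) 𝓘(ℝ, Plane) (fun s => extChartAt (𝓡 2) c (γ s)) t
      (ContinuousLinearMap.toSpanSingleton ℝ (chartField g f c (extChartAt (𝓡 2) c (γ t)))) := by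
    refine h.congr_mfderiv (ContinuousLinearMap.ext fun a => ?_)
    rw [chartField, (extChartAt (𝓡 2) c).left_inv ht]
    exact (mfderiv (𝓡 2) 𝓘(ℝ, Plane) (extChartAt (𝓡 2) c) (γ t)).map_smul a (-grad g f (γ t))
  exact hasDerivAt_iff_hasFDerivAt.2 (hasMFDerivAt_iff_hasFDerivAt.1 h2)

theorem hasMFDerivAt_of_chart {g : SurfaceMetric M} {f : M → ℝ} {c : M} {z : ℝ → Plane} {t : ℝ}
    (ht : z t ∈ (extChartAt (𝓡 2) c).target) (hz : HasDerivAt z (chartField g f c (z t)) t) :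
    HasMFDerivAt 𝓘(ℝ, ℝ) (𝓡 2) (fun s => (extChartAt (𝓡 2) c).symm (z s)) t
      ((1 : ℝ →L[ℝ] ℝ).smulRight (-grad g f ((extChartAt (𝓡 2) c).symm (z t)))) := by
  have h := HasMFDerivAt.comp t (mdifferentiableAt_chart_symm ht).hasMFDerivAt
    hz.hasFDerivAt.hasMFDerivAt
  refine h.congr_mfderiv (ContinuousLinearMap.ext fun a => ?_)
  refine ((mfderiv 𝓘(ℝ, Plane) (𝓡 2) (extChartAt (𝓡 2) c).symm (z t)).map_smul a
    (chartField g f c (z t))).trans ?_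
  rw [chartField, mfderiv_chart_symm_comp ht]
  rfl

/-! ### Trajectories -/

theorem isCritical_iff_grad (g : SurfaceMetric M) (f : M → ℝ) (p : M) :
    IsCritical f p ↔ grad g f p = 0 := by
  constructor
  · intro h
    by_contra hne
    have h1 := g.pos p _ hne
    rw [inner_grad, show mfderiv (𝓡 2) 𝓘(ℝ, ℝ) f p = 0 from h] at h1
    exact lt_irrefl _ h1
  · intro h
    refine ContinuousLinearMap.ext fun w => ?_
    rw [← inner_grad g f p w, h, map_zero]
    rfl

theorem isCritical_chart_symm_iff {f : M → ℝ} (hf : ContMDiff (𝓡 2) 𝓘(ℝ, ℝ) ∞ f) {c : M}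
    {z : Plane} (hz : z ∈ (extChartAt (𝓡 2) c).target) :
    IsCritical f ((extChartAt (𝓡 2) c).symm z) ↔
      fderiv ℝ (f ∘ (extChartAt (𝓡 2) c).symm) z = 0 := by
  constructor
  · intro h
    ext1 w
    rw [fderiv_comp_chart_symm hf hz, show mfderiv (𝓡 2) 𝓘(ℝ, ℝ) f _ = 0 from h]
    rfl
  · intro h
    refine ContinuousLinearMap.ext fun v => ?_
    have h1 := fderiv_comp_chart_symm hf hz
      (mfderiv (𝓡 2) 𝓘(ℝ, Plane) (extChartAt (𝓡 2) c) ((extChartAt (𝓡 2) c).symm z) v)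
    rw [h] at h1
    have h2 := congrArg (mfderiv (𝓡 2) 𝓘(ℝ, ℝ) f ((extChartAt (𝓡 2) c).symm z))
      (mfderiv_chart_symm_comp hz v)
    exact h2.symm.trans h1.symm

theorem chartField_eq_zero_iff (g : SurfaceMetric M) {f : M → ℝ}
    (hf : ContMDiff (𝓡 2) 𝓘(ℝ, ℝ) ∞ f) {c : M} {z : Plane}
    (hz : z ∈ (extChartAt (𝓡 2) c).target) :
    chartField g f c z = 0 ↔ fderiv ℝ (f ∘ (extChartAt (𝓡 2) c).symm) z = 0 := by
  have h := coordMetric_chartField g hf hz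
  constructor
  · intro h0
    ext1 w
    have := h w
    rw [h0] at this
    simpa using this.symm
  · intro h0
    by_contra hne
    have h1 := coordMetric_pos g hz hne
    rw [h, h0] at h1
    simp at h1

theorem isCritical_iff_chartField (g : SurfaceMetric M) {f : M → ℝ}
    (hf : ContMDiff (𝓡 2) 𝓘(ℝ, ℝ) ∞ f) (c : M) :
    IsCritical f c ↔ chartField g f c (extChartAt (𝓡 2) c c) = 0 := by
  have hz := mem_extChartAt_target (I := 𝓡 2) c
  rw [chartField_eq_zero_iff g hf hz, ← isCritical_chart_symm_iff hf hz, extChartAt_to_inv]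

theorem IsLocalExtr.isCritical {f : M → ℝ} (hf : ContMDiff (𝓡 2) 𝓘(ℝ, ℝ) ∞ f) {c : M}
    (h : IsLocalExtr f c) : IsCritical f c := by
  have hz := mem_extChartAt_target (I := 𝓡 2) c
  have h1 := isCritical_chart_symm_iff hf hz
  rw [extChartAt_to_inv] at h1
  refine h1.2 (IsLocalExtr.fderiv_eq_zero ?_)
  have hc : ContinuousAt (extChartAt (𝓡 2) c).symm (extChartAt (𝓡 2) c c) :=
    continuousAt_extChartAt_symm c
  rw [← extChartAt_to_inv (I := 𝓡 2) c] at h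
  exact IsExtrFilter.comp_tendsto h hc

/-- The point is that `ε` serves a whole neighbourhood of `p`: the local flow in the chart is
jointly continuous in the initial value and the time, so on a smaller product neighbourhood it stays
in the chart's target. -/
theorem exists_local_trajectories (g : SurfaceMetric M) {f : M → ℝ}
    (hf : ContMDiff (𝓡 2) 𝓘(ℝ, ℝ) ∞ f) (p : M) : ∃ U ∈ 𝓝 p, ∃ ε > 0, ∀ x ∈ U,
      ∃ γ : ℝ → M, γ 0 = x ∧
        IsMIntegralCurveOn (I := 𝓡 2) γ (fun x => -grad g f x) (Ioo (-ε) ε) := by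
  obtain ⟨ε, hε, a, r, L, K, hr, hpl⟩ := IsPicardLindelof.of_contDiffAt_one
    ((contDiffAt_chartField g hf p).of_le (by simp))
  obtain ⟨α, hα, hαc⟩ := (hpl 0).exists_forall_mem_closedBall_eq_hasDerivWithinAt_continuousOn
  set z₀ := extChartAt (𝓡 2) p p with hz₀
  simp only [zero_sub, zero_add] at hα hαc
  have hr' : (0 : ℝ) < r := hr
  have hnhds : Metric.closedBall z₀ (r : ℝ) ×ˢ Icc (-ε) ε ∈ 𝓝 (z₀, (0 : ℝ)) :=
    prod_mem_nhds (Metric.closedBall_mem_nhds _ hr') (Icc_mem_nhds (by linarith) hε)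
  have hcont := hαc.continuousAt hnhds
  have hα0 : α (z₀, 0) = z₀ := (hα z₀ (Metric.mem_closedBall_self r.2)).1
  have htar : α ⁻¹' (extChartAt (𝓡 2) p).target ∈ 𝓝 (z₀, (0 : ℝ)) :=
    hcont.preimage_mem_nhds (by
      rw [hα0]; exact (isOpen_extChartAt_target p).mem_nhds (mem_extChartAt_target p))
  obtain ⟨V, hV, W, hW, hVW⟩ := mem_nhds_prod_iff.1 (inter_mem hnhds htar)
  obtain ⟨δ, hδ, hδW⟩ := Metric.mem_nhds_iff.1 hW
  rw [Real.ball_eq_Ioo, zero_sub, zero_add] at hδW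
  refine ⟨(extChartAt (𝓡 2) p).source ∩ extChartAt (𝓡 2) p ⁻¹' V,
    inter_mem (extChartAt_source_mem_nhds p) ((continuousAt_extChartAt p).preimage_mem_nhds hV),
    δ, hδ, fun x hx => ⟨fun t => (extChartAt (𝓡 2) p).symm (α (extChartAt (𝓡 2) p x, t)), ?_, ?_⟩⟩
  · have := (hVW (show (extChartAt (𝓡 2) p x, (0 : ℝ)) ∈ V ×ˢ W from
      ⟨hx.2, mem_of_mem_nhds hW⟩)).1
    have h0 := (hα (extChartAt (𝓡 2) p x) this.1).1
    simp only [h0]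
    exact (extChartAt (𝓡 2) p).left_inv hx.1
  · intro t ht
    have hmem : ∀ s ∈ Ioo (-δ) δ, _ := fun s hs =>
      hVW (show (extChartAt (𝓡 2) p x, s) ∈ V ×ˢ W from ⟨hx.2, hδW hs⟩)
    have h1 := (hα _ (hmem t ht).1.1).2 t (hmem t ht).1.2
    have h2 : Icc (-ε) ε ∈ 𝓝 t :=
      mem_of_superset (Ioo_mem_nhds ht.1 ht.2) fun s hs => (hmem s hs).1.2
    exact (hasMFDerivAt_of_chart (hmem t ht).2 (h1.hasDerivAt h2)).hasMFDerivWithinAt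

theorem IsTrajectory.eq_of_eq [T2Space M] {g : SurfaceMetric M} {f : M → ℝ}
    (hf : ContMDiff (𝓡 2) 𝓘(ℝ, ℝ) ∞ f) {γ η : ℝ → M} (hγ : IsTrajectory g f γ)
    (hη : IsTrajectory g f η) {t : ℝ} (h : γ t = η t) : γ = η :=
  isMIntegralCurve_Ioo_eq_of_contMDiff_boundaryless (I := 𝓡 2) (contMDiff_neg_grad g hf) hγ hη h

/-- Compactness makes the local existence time uniform, and a uniform time allows indefinite
continuation. -/
theorem exists_trajectory [T2Space M] [CompactSpace M] (g : SurfaceMetric M) {f : M → ℝ}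
    (hf : ContMDiff (𝓡 2) 𝓘(ℝ, ℝ) ∞ f) (x : M) : ∃ γ : ℝ → M, γ 0 = x ∧ IsTrajectory g f γ := by
  obtain ⟨ε, hε, h⟩ : ∃ ε > 0, ∀ x ∈ (univ : Set M), ∃ γ : ℝ → M, γ 0 = x ∧
      IsMIntegralCurveOn (I := 𝓡 2) γ (fun x => -grad g f x) (Ioo (-ε) ε) := by
    refine isCompact_univ.induction_on (p := fun s => ∃ ε > 0, ∀ x ∈ s, ∃ γ : ℝ → M, γ 0 = x ∧
      IsMIntegralCurveOn (I := 𝓡 2) γ (fun x => -grad g f x) (Ioo (-ε) ε))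
      ⟨1, one_pos, by simp⟩ ?_ ?_ ?_
    · rintro s t hst ⟨ε, hε, h⟩
      exact ⟨ε, hε, fun x hx => h x (hst hx)⟩
    · rintro s t ⟨ε, hε, h⟩ ⟨δ, hδ, h'⟩
      refine ⟨min ε δ, lt_min hε hδ, fun x hx => ?_⟩
      rcases hx with hx | hx
      · obtain ⟨γ, h0, h1⟩ := h x hx
        exact ⟨γ, h0, h1.mono (Ioo_subset_Ioo (neg_le_neg (min_le_left _ _)) (min_le_left _ _))⟩
      · obtain ⟨γ, h0, h1⟩ := h' x hx
        exact ⟨γ, h0, h1.mono (Ioo_subset_Ioo (neg_le_neg (min_le_right _ _)) (min_le_right _ _))⟩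
    · intro p _
      obtain ⟨U, hU, ε, hε, h⟩ := exists_local_trajectories g hf p
      exact ⟨U, mem_nhdsWithin_of_mem_nhds hU, ε, hε, h⟩
  exact exists_isMIntegralCurve_of_isMIntegralCurveOn (I := 𝓡 2) (contMDiff_neg_grad g hf) hε
    (fun x => h x (mem_univ x)) x

theorem IsTrajectory.not_isCritical [T2Space M] {g : SurfaceMetric M} {f : M → ℝ}
    (hf : ContMDiff (𝓡 2) 𝓘(ℝ, ℝ) ∞ f) {γ : ℝ → M} (hγ : IsTrajectory g f γ)
    (hne : ∃ s t, γ s ≠ γ t) (t : ℝ) : ¬ IsCritical f (γ t) := by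
  intro hc
  have h0 : IsTrajectory g f (fun _ => γ t) :=
    isMIntegralCurve_const (I := 𝓡 2) (by
      rw [(isCritical_iff_grad g f _).1 hc, neg_zero])
  have h := hγ.eq_of_eq hf h0 (t := t) rfl
  obtain ⟨r, s, hrs⟩ := hne
  rw [h] at hrs
  exact hrs rfl

theorem IsTrajectory.hasDerivAt_comp {g : SurfaceMetric M} {f : M → ℝ}
    (hf : ContMDiff (𝓡 2) 𝓘(ℝ, ℝ) ∞ f) {γ : ℝ → M} (hγ : IsTrajectory g f γ) (t : ℝ) :
    HasDerivAt (fun s => f (γ s)) (-g.inner (γ t) (grad g f (γ t)) (grad g f (γ t))) t := by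
  have h := HasMFDerivAt.comp t ((hf (γ t)).mdifferentiableAt (by simp)).hasMFDerivAt (hγ t)
  have h2 : HasMFDerivAt 𝓘(ℝ, ℝ) 𝓘(ℝ, ℝ) (fun s => f (γ s)) t (ContinuousLinearMap.toSpanSingleton ℝ
      (-g.inner (γ t) (grad g f (γ t)) (grad g f (γ t)))) := by
    refine h.congr_mfderiv (ContinuousLinearMap.ext fun a => ?_)
    rw [inner_grad]
    refine ((mfderiv (𝓡 2) 𝓘(ℝ, ℝ) f (γ t)).map_smul a (-grad g f (γ t))).trans ?_
    rw [map_neg]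
    rfl
  exact hasDerivAt_iff_hasFDerivAt.2 (hasMFDerivAt_iff_hasFDerivAt.1 h2)

theorem IsTrajectory.strictAnti [T2Space M] {g : SurfaceMetric M} {f : M → ℝ}
    (hf : ContMDiff (𝓡 2) 𝓘(ℝ, ℝ) ∞ f) {γ : ℝ → M} (hγ : IsTrajectory g f γ)
    (hne : ∃ s t, γ s ≠ γ t) : StrictAnti (fun t => f (γ t)) := by
  refine strictAnti_of_deriv_neg fun t => ?_
  rw [(hγ.hasDerivAt_comp hf t).deriv, neg_lt_zero]
  refine g.pos _ _ fun h => hγ.not_isCritical hf hne t ((isCritical_iff_grad g f _).2 h)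

theorem not_tendsto_of_deriv_tendsto_pos {l l' : ℝ → ℝ} {κ m : ℝ} (hκ : 0 < κ)
    (hl : ∀ᶠ t in atTop, HasDerivAt l (l' t) t) (hl' : Tendsto l' atTop (𝓝 κ)) :
    ¬ Tendsto l atTop (𝓝 m) := by
  intro hm
  obtain ⟨T, hT⟩ := eventually_atTop.1 (hl.and (hl'.eventually (lt_mem_nhds (half_lt_self hκ))))
  have hmono := mono_of_hasDerivAt_nonneg (a := T) (w := fun t => l t - κ / 2 * t)
    (w' := fun t => l' t - κ / 2)
    (fun t ht => ((hT t ht).1.sub ((hasDerivAt_id t).const_mul (κ / 2))).congr_deriv (by simp))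
    (fun t ht => by linarith [(hT t ht).2])
  have hinf : Tendsto (fun t => (l T - κ / 2 * T) + κ / 2 * t) atTop atTop :=
    tendsto_atTop_add_const_left _ _ (tendsto_id.const_mul_atTop (by linarith))
  refine not_tendsto_nhds_of_tendsto_atTop (tendsto_atTop_mono' atTop ?_ hinf) m hm
  filter_upwards [eventually_ge_atTop T] with t ht
  have := hmono (mem_Ici.2 le_rfl) (mem_Ici.2 ht) ht
  simp only at this
  linarith

/-- If the field had the value `w ≠ 0` at the limit, the linear function `⟨w, ·⟩` along the curve
would have derivative tending to `‖w‖² > 0` and could not converge. -/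
theorem IsTrajectory.isCritical_of_tendsto {g : SurfaceMetric M} {f : M → ℝ}
    (hf : ContMDiff (𝓡 2) 𝓘(ℝ, ℝ) ∞ f) {γ : ℝ → M} (hγ : IsTrajectory g f γ) {c : M}
    (hc : Tendsto γ atTop (𝓝 c)) : IsCritical f c := by
  rw [isCritical_iff_chartField g hf]
  by_contra hne
  set z₀ := extChartAt (𝓡 2) c c
  set w := chartField g f c z₀
  have hz : Tendsto (fun t => extChartAt (𝓡 2) c (γ t)) atTop (𝓝 z₀) :=
    (continuousAt_extChartAt c).tendsto.comp hc
  have hF := (contDiffAt_chartField g hf c).continuousAt.tendsto.comp hz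
  have hL := (innerSL ℝ w).continuous
  refine not_tendsto_of_deriv_tendsto_pos (κ := innerSL ℝ w w)
    (l := fun t => innerSL ℝ w (extChartAt (𝓡 2) c (γ t)))
    (l' := fun t => innerSL ℝ w (chartField g f c (extChartAt (𝓡 2) c (γ t))))
    (by simpa using pow_pos (norm_pos_iff.2 hne) 2) ?_ ((hL.tendsto _).comp hF) ((hL.tendsto _).comp hz)
  filter_upwards [hc.eventually_mem (extChartAt_source_mem_nhds (I := 𝓡 2) c)] with t ht
  exact (innerSL ℝ w).hasFDerivAt.comp_hasDerivAt t (hγ.hasDerivAt ht)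

theorem grad_neg (g : SurfaceMetric M) (f : M → ℝ) (p : M) : grad g (-f) p = -grad g f p := by
  have h : ∀ w, g.inner p (grad g (-f) p + grad g f p) w = 0 := fun w => by
    rw [map_add, _root_.add_apply, inner_grad, inner_grad, mfderiv_neg]
    exact neg_add_cancel _
  by_contra hne
  have h1 := g.pos p (grad g (-f) p + grad g f p) fun h0 => hne (eq_neg_of_add_eq_zero_left h0)
  rw [h] at h1
  exact lt_irrefl _ h1

/-- Time reversal lets every statement about lines that start at a point be read off from the one
about lines that end there. -/
theorem IsTrajectory.reverse {g : SurfaceMetric M} {f : M → ℝ} {γ : ℝ → M}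
    (hγ : IsTrajectory g f γ) : IsTrajectory g (-f) (fun t => γ (-t)) := by
  have h := IsMIntegralCurve.comp_mul (I := 𝓡 2) hγ (-1)
  have e1 : (γ ∘ fun x => x * (-1)) = fun t => γ (-t) := by ext t; simp
  have e2 : ((-1 : ℝ) • fun x => -grad g f x) = fun x => -grad g (-f) x := by
    ext1 x
    rw [grad_neg]
    simp
  rw [e1, e2] at h
  exact h

theorem isCritical_neg {f : M → ℝ} {p : M} : IsCritical (-f) p ↔ IsCritical f p := by
  rw [IsCritical, IsCritical, mfderiv_neg]
  exact neg_eq_zero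

theorem hessian_neg (f : M → ℝ) (p : M) (u v : TangentSpace (𝓡 2) p) :
    hessian (-f) p u v = -hessian f p u v := by
  have h : fderiv ℝ ((-f) ∘ (extChartAt (𝓡 2) p).symm) =
      -fderiv ℝ (f ∘ (extChartAt (𝓡 2) p).symm) := by
    ext1 z
    exact fderiv_neg
  rw [hessian, h, fderiv_neg]
  rfl

theorem IsMorse.neg {f : M → ℝ} (hf : IsMorse f) : IsMorse (-f) := by
  refine ⟨hf.1.neg, fun p hp u hu => hf.2 p (isCritical_neg.1 hp) u fun v => ?_⟩
  have := hu v
  rw [hessian_neg] at this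
  linarith

theorem IsSaddle.neg {f : M → ℝ} {p : M} (h : IsSaddle f p) : IsSaddle (-f) p :=
  ⟨isCritical_neg.2 h.1, fun he => h.2 (by
    have := he.neg
    simpa using this)⟩

/-! ### Linear algebra in the plane -/

theorem plane_eq_sum (w : Plane) : w = w 0 • basisVec 0 + w 1 • basisVec 1 := by
  ext i
  fin_cases i <;> simp [basisVec]

/-- The remainder of the expansion is `G`-orthogonal to a spanning pair, hence to itself. -/
theorem eq_orthonormal_expansion {G : Plane →L[ℝ] Plane →L[ℝ] ℝ} (hs : ∀ v w, G v w = G w v)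
    (hp : ∀ v, v ≠ 0 → 0 < G v v) {e₁ e₂ : Plane} (h11 : G e₁ e₁ = 1) (h22 : G e₂ e₂ = 1)
    (h12 : G e₁ e₂ = 0) (w : Plane) : w = G e₁ w • e₁ + G e₂ w • e₂ := by
  have hli : LinearIndependent ℝ ![e₁, e₂] := by
    refine LinearIndependent.pair_iff.2 fun a b hab => ?_
    have h1 := congrArg (G e₁) hab
    have h2 := congrArg (G e₂) hab
    simp only [map_add, map_smul, h11, h22, h12, hs e₂ e₁, map_zero, smul_eq_mul] at h1 h2
    constructor <;> linarith
  have hspan := hli.span_eq_top_of_card_eq_finrank' (by simp)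
  set r := w - (G e₁ w • e₁ + G e₂ w • e₂) with hr
  have hr1 : G r e₁ = 0 := by
    rw [hs, hr]; simp [h11, h12]
  have hr2 : G r e₂ = 0 := by
    rw [hs, hr]; simp [h22, hs e₂ e₁, h12]
  have hmem : r ∈ Submodule.span ℝ (range ![e₁, e₂]) := by rw [hspan]; trivial
  rw [Matrix.range_cons, Matrix.range_cons, Matrix.range_empty, union_empty, singleton_union,
    Submodule.mem_span_pair] at hmem
  obtain ⟨a, b, hab⟩ := hmem
  have h0 : G r r = 0 := by
    conv_lhs => rw [← hab]
    rw [hab, hs, ← hab, map_add, map_smul, map_smul, hab, hr1, hr2]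
    simp
  have : r = 0 := by
    by_contra hne
    exact (hp r hne).ne' h0
  exact sub_eq_zero.1 this

theorem exists_orthonormal_pair {G : Plane →L[ℝ] Plane →L[ℝ] ℝ}
    (hp : ∀ v, v ≠ 0 → 0 < G v v) :
    ∃ a₁ a₂ : Plane, G a₁ a₁ = 1 ∧ G a₂ a₂ = 1 ∧ G a₁ a₂ = 0 := by
  have hnorm : ∀ v : Plane, v ≠ 0 → G ((√(G v v))⁻¹ • v) ((√(G v v))⁻¹ • v) = 1 := fun v hv => by
    have h := hp v hv
    have h2 := Real.mul_self_sqrt h.le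
    have h3 : √(G v v) ≠ 0 := (Real.sqrt_pos.2 h).ne'
    simp only [map_smul, _root_.smul_apply, smul_eq_mul]
    field_simp
    nlinarith
  have hb : (basisVec 0 : Plane) ≠ 0 := fun h => by
    have := congrArg (fun v : Plane => v 0) h
    simp [basisVec] at this
  set a₁ := (√(G (basisVec 0) (basisVec 0)))⁻¹ • basisVec 0 with ha₁
  have h11 : G a₁ a₁ = 1 := hnorm _ hb
  set w := basisVec 1 - G a₁ (basisVec 1) • a₁ with hw
  have hw0 : w ≠ 0 := fun h => by
    have := congrArg (fun v : Plane => v 1) h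
    simp [basisVec, hw, ha₁] at this
  refine ⟨a₁, (√(G w w))⁻¹ • w, h11, hnorm w hw0, ?_⟩
  simp [hw, h11]

/-- Rotating an orthonormal frame by a right angle changes the sign of the off-diagonal entry of
`H`, so that entry vanishes for some angle in between. -/
theorem exists_orthonormal_diagonalizing {G H : Plane →L[ℝ] Plane →L[ℝ] ℝ}
    (hs : ∀ v w, G v w = G w v) (hp : ∀ v, v ≠ 0 → 0 < G v v) (hH : ∀ v w, H v w = H w v) :
    ∃ e₁ e₂ : Plane, G e₁ e₁ = 1 ∧ G e₂ e₂ = 1 ∧ G e₁ e₂ = 0 ∧ H e₁ e₂ = 0 := by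
  obtain ⟨a, b, haa, hbb, hab⟩ := exists_orthonormal_pair hp
  set k : ℝ → ℝ := fun θ => H (Real.cos θ • a + Real.sin θ • b)
    (-Real.sin θ • a + Real.cos θ • b) with hk
  have hkc : Continuous k := by
    simp only [hk, map_add, map_smul, _root_.add_apply, _root_.smul_apply, smul_eq_mul]
    fun_prop
  have hk2 : k (Real.pi / 2) = -k 0 := by
    simp [hk, hH b a]
  obtain ⟨θ, hθ⟩ : ∃ θ, k θ = 0 := by
    rcases le_total (k 0) 0 with h | h
    · obtain ⟨θ, -, hθ⟩ := isPreconnected_univ.intermediate_value₂ (mem_univ 0)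
        (mem_univ (Real.pi / 2)) hkc.continuousOn (continuousOn_const (c := (0 : ℝ))) h
        (by rw [hk2]; linarith)
      exact ⟨θ, hθ⟩
    · obtain ⟨θ, -, hθ⟩ := isPreconnected_univ.intermediate_value₂ (mem_univ (Real.pi / 2))
        (mem_univ 0) hkc.continuousOn (continuousOn_const (c := (0 : ℝ))) (by rw [hk2]; linarith) h
      exact ⟨θ, hθ⟩
  have hcs := Real.sin_sq_add_cos_sq θ
  refine ⟨Real.cos θ • a + Real.sin θ • b, -Real.sin θ • a + Real.cos θ • b, ?_, ?_, ?_, hθ⟩ <;>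
  · simp only [map_add, map_smul, _root_.add_apply, _root_.smul_apply, smul_eq_mul, haa, hbb, hab,
      hs b a]
    linarith

theorem two_le_infty : (2 : WithTop ℕ∞) ≤ ∞ :=
  ENat.LEInfty.out

/-! ### Second order expansion at a critical point -/

/-- After subtracting half the Hessian form, the derivative is at most `ε‖z - z₀‖` on the ball
through `z`; the mean value inequality on that ball gives the bound. -/
theorem eventually_abs_sub_second_order_le {E : Type*} [NormedAddCommGroup E] [NormedSpace ℝ E]
    {h : E → ℝ} {z₀ : E} (hh : ContDiffAt ℝ 2 h z₀) (h0 : fderiv ℝ h z₀ = 0) {ε : ℝ} (hε : 0 < ε) :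
    ∀ᶠ z in 𝓝 z₀, |h z - h z₀ - fderiv ℝ (fderiv ℝ h) z₀ (z - z₀) (z - z₀) / 2| ≤
      ε * ‖z - z₀‖ ^ 2 := by
  set H := fderiv ℝ (fderiv ℝ h) z₀ with hHdef
  have hsymm : ∀ v w, H v w = H w v := fun v w =>
    (hh.isSymmSndFDerivAt (by simp)).eq v w
  have hd : HasFDerivAt (fderiv ℝ h) H z₀ :=
    ((hh.fderiv_right (m := 1) (by norm_num)).differentiableAt (by simp)).hasFDerivAt
  have h1 := hd.isLittleO.def hε
  have h2 : ∀ᶠ z in 𝓝 z₀, DifferentiableAt ℝ h z :=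
    (hh.eventually (by simp)).mono fun z hz => hz.differentiableAt (by simp)
  obtain ⟨ρ, hρ, hball⟩ := Metric.eventually_nhds_iff_ball.1 (h1.and h2)
  filter_upwards [Metric.ball_mem_nhds z₀ hρ] with z hz
  set P : E → ℝ := fun y => h y - H (y - z₀) (y - z₀) / 2 with hP
  have hsub : Metric.closedBall z₀ ‖z - z₀‖ ⊆ Metric.ball z₀ ρ :=
    Metric.closedBall_subset_ball (by rwa [← dist_eq_norm])
  have hPd : ∀ y ∈ Metric.closedBall z₀ ‖z - z₀‖,
      HasFDerivWithinAt P (fderiv ℝ h y - H (y - z₀)) (Metric.closedBall z₀ ‖z - z₀‖) y := by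
    intro y hy
    have d1 : HasFDerivAt (fun y : E => y - z₀) (ContinuousLinearMap.id ℝ E) y :=
      (hasFDerivAt_id y).sub_const z₀
    have d2 := (H.hasFDerivAt.comp y d1).clm_apply d1
    have d3 := (hball y (hsub hy)).2.hasFDerivAt.sub (d2.mul_const (1 / 2 : ℝ))
    refine (d3.congr_fderiv ?_).hasFDerivWithinAt.congr (fun x _ => ?_) ?_
    · ext v
      simp [hsymm v]
      ring
    · simp [hP]
      ring
    · simp [hP]
      ring
  have hbd : ∀ y ∈ Metric.closedBall z₀ ‖z - z₀‖, ‖fderiv ℝ h y - H (y - z₀)‖ ≤ ε * ‖z - z₀‖ := by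
    intro y hy
    have := (hball y (hsub hy)).1
    rw [h0, sub_zero] at this
    refine this.trans ?_
    gcongr
    rwa [Metric.mem_closedBall, dist_eq_norm] at hy
  have := Convex.norm_image_sub_le_of_norm_hasFDerivWithin_le hPd hbd
    (convex_closedBall z₀ ‖z - z₀‖) (Metric.mem_closedBall_self (norm_nonneg _))
    (show z ∈ Metric.closedBall z₀ ‖z - z₀‖ by simp [dist_eq_norm])
  rw [Real.norm_eq_abs] at this
  convert this using 1
  · simp only [hP, sub_self, map_zero]
    congr 1
    simp
    ring
  · ring

/-! ### Principal frames -/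

/-- The Hessian in the chart at `c`. -/
def chartHessian (f : M → ℝ) (c : M) : Plane →L[ℝ] Plane →L[ℝ] ℝ :=
  fderiv ℝ (fderiv ℝ (f ∘ (extChartAt (𝓡 2) c).symm)) (extChartAt (𝓡 2) c c)

/-- The metric at `c`, in the chart at `c`. -/
def chartMetric (g : SurfaceMetric M) (c : M) : Plane →L[ℝ] Plane →L[ℝ] ℝ :=
  coordMetric g c (extChartAt (𝓡 2) c c)

theorem chartMetric_apply (g : SurfaceMetric M) (c : M) (u v : TangentSpace (𝓡 2) c) :
    chartMetric g c u v = g.inner c u v := coordMetric_self g c u v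

theorem chartMetric_symm (g : SurfaceMetric M) (c : M) (v w : Plane) :
    chartMetric g c v w = chartMetric g c w v := coordMetric_symm _ _ _ _ _

theorem chartMetric_pos (g : SurfaceMetric M) (c : M) (v : Plane) (hv : v ≠ 0) :
    0 < chartMetric g c v v := coordMetric_pos g (mem_extChartAt_target c) hv

/-- `e₁, e₂` is an orthonormal basis of `T_c M` in which the Hessian is `diag(l₁, l₂)`. -/
structure IsPrincipalFrame (g : SurfaceMetric M) (f : M → ℝ) (c : M) (e₁ e₂ : Plane)
    (l₁ l₂ : ℝ) : Prop where
  g11 : chartMetric g c e₁ e₁ = 1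
  g22 : chartMetric g c e₂ e₂ = 1
  g12 : chartMetric g c e₁ e₂ = 0
  h11 : chartHessian f c e₁ e₁ = l₁
  h22 : chartHessian f c e₂ e₂ = l₂
  h12 : chartHessian f c e₁ e₂ = 0
  h_symm : ∀ v w, chartHessian f c v w = chartHessian f c w v

theorem exists_isPrincipalFrame (g : SurfaceMetric M) {f : M → ℝ}
    (hf : ContMDiff (𝓡 2) 𝓘(ℝ, ℝ) ∞ f) (c : M) :
    ∃ e₁ e₂ l₁ l₂, IsPrincipalFrame g f c e₁ e₂ l₁ l₂ := by
  have hsymm : ∀ v w, chartHessian f c v w = chartHessian f c w v := fun v w =>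
    ((contDiffAt_comp_chart_symm hf (mem_extChartAt_target c)).isSymmSndFDerivAt
      (by simpa using two_le_infty)).eq v w
  obtain ⟨e₁, e₂, h1, h2, h3, h4⟩ := exists_orthonormal_diagonalizing (chartMetric_symm g c)
    (chartMetric_pos g c) hsymm
  exact ⟨e₁, e₂, _, _, h1, h2, h3, rfl, rfl, h4, hsymm⟩

namespace IsPrincipalFrame

variable {g : SurfaceMetric M} {f : M → ℝ} {c : M} {e₁ e₂ : Plane} {l₁ l₂ : ℝ}

theorem swap (h : IsPrincipalFrame g f c e₁ e₂ l₁ l₂) : IsPrincipalFrame g f c e₂ e₁ l₂ l₁ :=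
  ⟨h.g22, h.g11, by rw [chartMetric_symm, h.g12], h.h22, h.h11, by rw [h.h_symm, h.h12], h.h_symm⟩

theorem neg_fst (h : IsPrincipalFrame g f c e₁ e₂ l₁ l₂) :
    IsPrincipalFrame g f c (-e₁) e₂ l₁ l₂ :=
  ⟨by simp [h.g11], h.g22, by simp [h.g12], by simp [h.h11], h.h22, by simp [h.h12], h.h_symm⟩

theorem neg (h : IsPrincipalFrame g f c e₁ e₂ l₁ l₂) :
    IsPrincipalFrame g (-f) c e₁ e₂ (-l₁) (-l₂) := by
  have e : ∀ v w, chartHessian (-f) c v w = -chartHessian f c v w := hessian_neg f c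
  exact ⟨h.g11, h.g22, h.g12, by rw [e, h.h11], by rw [e, h.h22], by rw [e, h.h12, neg_zero],
    fun v w => by rw [e, e, h.h_symm]⟩

theorem expand (h : IsPrincipalFrame g f c e₁ e₂ l₁ l₂) (w : Plane) :
    w = chartMetric g c e₁ w • e₁ + chartMetric g c e₂ w • e₂ :=
  eq_orthonormal_expansion (chartMetric_symm g c) (chartMetric_pos g c) h.g11 h.g22 h.g12 w

theorem metric_eq (h : IsPrincipalFrame g f c e₁ e₂ l₁ l₂) (v w : Plane) :
    chartMetric g c v w = chartMetric g c e₁ v * chartMetric g c e₁ w +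
      chartMetric g c e₂ v * chartMetric g c e₂ w := by
  conv_lhs => rw [h.expand v]
  simp

theorem hessian_fst (h : IsPrincipalFrame g f c e₁ e₂ l₁ l₂) (v : Plane) :
    chartHessian f c v e₁ = l₁ * chartMetric g c e₁ v := by
  conv_lhs => rw [h.expand v]
  simp [h.h11, h.swap.h12, mul_comm]

theorem hessian_eq (h : IsPrincipalFrame g f c e₁ e₂ l₁ l₂) (v w : Plane) :
    chartHessian f c v w = l₁ * (chartMetric g c e₁ v * chartMetric g c e₁ w) +
      l₂ * (chartMetric g c e₂ v * chartMetric g c e₂ w) := by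
  conv_lhs => rw [h.expand w]
  simp only [map_add, map_smul, smul_eq_mul, h.hessian_fst, h.swap.hessian_fst]
  ring

theorem fst_ne_zero (h : IsPrincipalFrame g f c e₁ e₂ l₁ l₂) (hf : IsMorse f)
    (hc : IsCritical f c) : l₁ ≠ 0 := by
  intro h0
  have hz : ∀ v : Plane, chartHessian f c e₁ v = 0 := fun v => by
    rw [h.h_symm, h.hessian_fst, h0, zero_mul]
  have : e₁ = 0 := hf.2 c hc e₁ hz
  have h1 := h.g11
  rw [this] at h1
  simp at h1

theorem snd_ne_zero (h : IsPrincipalFrame g f c e₁ e₂ l₁ l₂) (hf : IsMorse f)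
    (hc : IsCritical f c) : l₂ ≠ 0 := h.swap.fst_ne_zero hf hc

theorem ne_of_not_proportional (h : IsPrincipalFrame g f c e₁ e₂ l₁ l₂)
    (hn : ¬ HessianProportional g f c) : l₁ ≠ l₂ := by
  rintro rfl
  have key : ∀ u v : Plane, chartHessian f c u v = l₁ * chartMetric g c u v := fun u v => by
    rw [h.hessian_eq, h.metric_eq u v]
    ring
  exact hn ⟨l₁, fun u v => (key u v).trans (by rw [chartMetric_apply])⟩

theorem norm_le (h : IsPrincipalFrame g f c e₁ e₂ l₁ l₂) (w : Plane) :
    ‖w‖ ≤ (|chartMetric g c e₁ w| + |chartMetric g c e₂ w|) * (‖e₁‖ + ‖e₂‖) := by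
  calc ‖w‖ = ‖chartMetric g c e₁ w • e₁ + chartMetric g c e₂ w • e₂‖ := by rw [← h.expand w]
    _ ≤ |chartMetric g c e₁ w| * ‖e₁‖ + |chartMetric g c e₂ w| * ‖e₂‖ := by
      simpa [norm_smul] using norm_add_le (chartMetric g c e₁ w • e₁) (chartMetric g c e₂ w • e₂)
    _ ≤ _ := by
      nlinarith [mul_nonneg (abs_nonneg (chartMetric g c e₁ w)) (norm_nonneg e₂),
        mul_nonneg (abs_nonneg (chartMetric g c e₂ w)) (norm_nonneg e₁)]

theorem isLocalMin (h : IsPrincipalFrame g f c e₁ e₂ l₁ l₂) (hf : ContMDiff (𝓡 2) 𝓘(ℝ, ℝ) ∞ f)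
    (hc : IsCritical f c) (h1 : 0 < l₁) (h2 : 0 < l₂) : IsLocalMin f c := by
  set z₀ := extChartAt (𝓡 2) c c with hz₀
  set m := min l₁ l₂ with hm
  have hmpos : 0 < m := lt_min h1 h2
  set C := ‖e₁‖ + ‖e₂‖ + 1 with hC
  have hCpos : 0 < C := by positivity
  have hcrit : fderiv ℝ (f ∘ (extChartAt (𝓡 2) c).symm) z₀ = 0 := by
    rw [← isCritical_chart_symm_iff hf (mem_extChartAt_target c), extChartAt_to_inv]
    exact hc
  have hT := eventually_abs_sub_second_order_le
    ((contDiffAt_comp_chart_symm hf (mem_extChartAt_target c)).of_le two_le_infty)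
    -- Since `‖z - z₀‖² ≤ 2C²(p² + q²)` in frame coordinates, this `ε` keeps the error below `m(p² +
    -- q²)/2`, a lower bound of the quadratic part.
    hcrit (ε := m / (4 * C ^ 2)) (by positivity)
  have hev : ∀ᶠ z in 𝓝 z₀, f c ≤ (f ∘ (extChartAt (𝓡 2) c).symm) z := by
    filter_upwards [hT] with z hz
    have e0 : (f ∘ (extChartAt (𝓡 2) c).symm) z₀ = f c := by
      rw [Function.comp_apply, hz₀, extChartAt_to_inv]
    rw [e0] at hz
    have e1 := (abs_le.1 hz).1
    have e2 := h.hessian_eq (z - z₀) (z - z₀)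
    rw [chartHessian] at e2
    rw [e2] at e1
    have e3 := h.norm_le (z - z₀)
    set p := chartMetric g c e₁ (z - z₀)
    set q := chartMetric g c e₂ (z - z₀)
    have e4 : ‖z - z₀‖ ≤ (|p| + |q|) * C := e3.trans (by gcongr; simp [hC])
    have e5 : ‖z - z₀‖ ^ 2 ≤ 2 * (p ^ 2 + q ^ 2) * C ^ 2 := by
      calc ‖z - z₀‖ ^ 2 ≤ ((|p| + |q|) * C) ^ 2 := by gcongr
        _ = (|p| + |q|) ^ 2 * C ^ 2 := by ring
        _ ≤ _ := by
          gcongr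
          rw [← sq_abs p, ← sq_abs q]
          nlinarith [sq_nonneg (|p| - |q|)]
    have e6 : m / (4 * C ^ 2) * ‖z - z₀‖ ^ 2 ≤ m / 2 * (p ^ 2 + q ^ 2) := by
      calc m / (4 * C ^ 2) * ‖z - z₀‖ ^ 2 ≤ m / (4 * C ^ 2) * (2 * (p ^ 2 + q ^ 2) * C ^ 2) := by
            gcongr
        _ = _ := by field_simp; ring
    have e7 : m * p ^ 2 ≤ l₁ * p ^ 2 := by gcongr; exact min_le_left _ _
    have e8 : m * q ^ 2 ≤ l₂ * q ^ 2 := by gcongr; exact min_le_right _ _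
    nlinarith
  have hpull := (continuousAt_extChartAt (I := 𝓡 2) c).eventually hev
  filter_upwards [hpull, extChartAt_source_mem_nhds (I := 𝓡 2) c] with x hx hxs
  rwa [Function.comp_apply, (extChartAt (𝓡 2) c).left_inv hxs] at hx

/-- Neither eigenvalue is zero, and two of the same sign would make `c` a local minimum of `f` or of
`-f`. -/
theorem mul_neg_of_isSaddle (h : IsPrincipalFrame g f c e₁ e₂ l₁ l₂) (hf : IsMorse f)
    (hc : IsSaddle f c) : l₁ * l₂ < 0 := by
  have n1 := h.fst_ne_zero hf hc.1
  have n2 := h.snd_ne_zero hf hc.1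
  rcases lt_or_gt_of_ne n1 with h1 | h1 <;> rcases lt_or_gt_of_ne n2 with h2 | h2
  · exfalso
    have := h.neg.isLocalMin hf.neg.1 (isCritical_neg.2 hc.1) (by linarith) (by linarith)
    have h3 := this.neg
    simp only [Pi.neg_apply, neg_neg] at h3
    exact hc.2 (Or.inr h3)
  · exact mul_neg_of_neg_of_pos h1 h2
  · exact mul_neg_of_pos_of_neg h1 h2
  · exact absurd (Or.inl (h.isLocalMin hf.1 hc.1 h1 h2)) hc.2

/-- Differentiate `G(z)(F(z), w) = -dh(z) w` at `z₀`. As `F(z₀) = 0`, the derivative of the metric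
drops out and `G(Av, w) = -H(v, w)`, so `A` is `-diag(l₁, l₂)` in the frame. Smoothness upgrades
this to strict differentiability. -/
theorem linearizedAt (h : IsPrincipalFrame g f c e₁ e₂ l₁ l₂)
    (hf : ContMDiff (𝓡 2) 𝓘(ℝ, ℝ) ∞ f) (hc : IsCritical f c) :
    LinearizedAt (chartField g f c) (extChartAt (𝓡 2) c c) (chartMetric g c e₁)
      (chartMetric g c e₂) l₁ l₂ := by
  set z₀ := extChartAt (𝓡 2) c c with hz₀
  have hF := contDiffAt_chartField g hf c
  have hF0 : chartField g f c z₀ = 0 := (isCritical_iff_chartField g hf c).1 hc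
  have hstrict := hF.hasStrictFDerivAt (by simp)
  set A := fderiv ℝ (chartField g f c) z₀ with hA
  have hGA : ∀ v w, chartMetric g c w (A v) = -chartHessian f c v w := by
    intro v w
    have d1 := (((contDiffAt_coordMetric g c).differentiableAt (by simp)).hasFDerivAt.clm_apply
      hstrict.hasFDerivAt).clm_apply (hasFDerivAt_const w z₀)
    have d2 : HasFDerivAt (fun z => -fderiv ℝ (f ∘ (extChartAt (𝓡 2) c).symm) z w)
        (-(chartHessian f c).flip w) z₀ := by
      have hd : HasFDerivAt (fderiv ℝ (f ∘ (extChartAt (𝓡 2) c).symm)) (chartHessian f c) z₀ :=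
        (((contDiffAt_comp_chart_symm hf (mem_extChartAt_target c)).fderiv_right (m := ∞)
          (by simp)).differentiableAt (by simp)).hasFDerivAt
      refine ((hd.clm_apply (hasFDerivAt_const w z₀)).neg).congr_fderiv ?_
      ext v
      simp
    have d3 := d2.congr_of_eventuallyEq (f₁ := fun z => coordMetric g c z (chartField g f c z) w)
      (by
        filter_upwards [(isOpen_extChartAt_target c).mem_nhds (mem_extChartAt_target c)] with z hz
        exact coordMetric_chartField g hf hz w)
    rw [← hz₀, hF0] at d1
    have := congrArg (fun l => l v) (d1.unique d3)
    rw [chartMetric_symm]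
    have h4 : coordMetric g c z₀ (A v) w = -chartHessian f c v w := by simpa using this
    exact h4
  intro δ hδ
  set C := (‖chartMetric g c e₁‖ + ‖chartMetric g c e₂‖ + 1) * (‖e₁‖ + ‖e₂‖ + 1) with hC
  have hCpos : 0 < C := by positivity
  have hlo := hstrict.isLittleO.def (show 0 < δ / C by positivity)
  rw [nhds_prod_eq] at hlo
  filter_upwards [hlo] with p hp
  have hw := h.norm_le (p.1 - p.2)
  set N := |chartMetric g c e₁ (p.1 - p.2)| + |chartMetric g c e₂ (p.1 - p.2)| with hN
  have key : ∀ α : Plane →L[ℝ] ℝ, ‖α‖ ≤ ‖chartMetric g c e₁‖ + ‖chartMetric g c e₂‖ →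
      |α (chartField g f c p.1 - chartField g f c p.2 - A (p.1 - p.2))| ≤ δ * N := by
    intro α hα
    calc |α (chartField g f c p.1 - chartField g f c p.2 - A (p.1 - p.2))|
        ≤ ‖α‖ * ‖chartField g f c p.1 - chartField g f c p.2 - A (p.1 - p.2)‖ := α.le_opNorm _
      _ ≤ (‖chartMetric g c e₁‖ + ‖chartMetric g c e₂‖ + 1) *
          (δ / C * (N * (‖e₁‖ + ‖e₂‖ + 1))) := by
        gcongr
        · linarith
        · refine hp.trans ?_
          gcongr
          exact hw.trans (mul_le_mul_of_nonneg_left (by linarith) (by positivity))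
      _ = δ * N := by
        rw [hC]
        field_simp
  have e1 := key (chartMetric g c e₁) (by linarith [norm_nonneg (chartMetric g c e₂)])
  have e2 := key (chartMetric g c e₂) (by linarith [norm_nonneg (chartMetric g c e₁)])
  rw [map_sub, hGA, h.hessian_fst, sub_neg_eq_add] at e1
  rw [map_sub, hGA, h.swap.hessian_fst, sub_neg_eq_add] at e2
  exact ⟨e1, e2⟩

end IsPrincipalFrame

/-! ### The Laplacian at a critical point -/

theorem hasFDerivAt_mul_of_eq_zero {a b : Plane → ℝ} {b' : Plane →L[ℝ] ℝ} {z : Plane}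
    (ha : DifferentiableAt ℝ a z) (hb : HasFDerivAt b b' z) (h0 : b z = 0) :
    HasFDerivAt (fun y => a y * b y) (a z • b') z := by
  refine (ha.hasFDerivAt.mul hb).congr_fderiv ?_
  simp [h0]

theorem differentiableAt_metricMatrix (g : SurfaceMetric M) (c : M) (i j : Fin 2) :
    DifferentiableAt ℝ (fun z => metricMatrix g c z i j) (extChartAt (𝓡 2) c c) :=
  (contDiffAt_coordMetric_apply g c (basisVec i) (basisVec j)).differentiableAt (by simp)

/-- The inverse Gram matrix is `e₁e₁ᵀ + e₂e₂ᵀ` for any orthonormal frame; this is the expansion of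
the standard basis vectors in that frame. -/
theorem IsPrincipalFrame.metricMatrix_mul {g : SurfaceMetric M} {f : M → ℝ} {c : M}
    {e₁ e₂ : Plane} {l₁ l₂ : ℝ} (h : IsPrincipalFrame g f c e₁ e₂ l₁ l₂) :
    metricMatrix g c (extChartAt (𝓡 2) c c) *
      Matrix.of (fun i j => e₁ i * e₁ j + e₂ i * e₂ j) = 1 := by
  ext i j
  have h1 : ∀ e : Plane, chartMetric g c (basisVec i) e =
      chartMetric g c (basisVec i) (basisVec 0) * e 0 +
      chartMetric g c (basisVec i) (basisVec 1) * e 1 := fun e => by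
    conv_lhs => rw [plane_eq_sum e]
    simp [mul_comm]
  have h2 := congrArg (fun v : Plane => v j) (h.expand (basisVec i))
  simp only [PiLp.add_apply, PiLp.smul_apply, smul_eq_mul] at h2
  rw [chartMetric_symm g c e₁, chartMetric_symm g c e₂, h1 e₁, h1 e₂] at h2
  have h3 : (1 : Matrix (Fin 2) (Fin 2) ℝ) i j = (basisVec i : Plane) j := by
    simp [basisVec, Matrix.one_apply, eq_comm]
  rw [Matrix.mul_apply, Fin.sum_univ_two, h3, h2]
  simp only [metricMatrix_apply, Matrix.of_apply]
  simp only [chartMetric]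
  ring

/-- Since `df` vanishes at `c`, every term in which a metric coefficient is differentiated
disappears. What remains is `gⁱʲ Hᵢⱼ`, the trace of the Hessian with respect to the metric. -/
theorem IsPrincipalFrame.laplaceBeltrami_eq {g : SurfaceMetric M} {f : M → ℝ} {c : M}
    {e₁ e₂ : Plane} {l₁ l₂ : ℝ} (h : IsPrincipalFrame g f c e₁ e₂ l₁ l₂)
    (hf : ContMDiff (𝓡 2) 𝓘(ℝ, ℝ) ∞ f) (hc : IsCritical f c) :
    laplaceBeltrami g f c = l₁ + l₂ := by
  set z₀ := extChartAt (𝓡 2) c c with hz₀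
  have hcrit : fderiv ℝ (f ∘ (extChartAt (𝓡 2) c).symm) z₀ = 0 := by
    rw [← isCritical_chart_symm_iff hf (mem_extChartAt_target c), extChartAt_to_inv]
    exact hc
  have hQ := h.metricMatrix_mul
  rw [← hz₀] at hQ
  have hinv := Matrix.inv_eq_right_inv hQ
  have hdet0 : (metricMatrix g c z₀).det ≠ 0 := by
    intro h0
    have := congrArg Matrix.det hQ
    rw [Matrix.det_mul, h0, zero_mul, Matrix.det_one] at this
    exact zero_ne_one this
  have hdetpos : 0 < (metricMatrix g c z₀).det := by
    have h1 := congrArg Matrix.det hQ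
    rw [Matrix.det_mul, Matrix.det_one] at h1
    have h2 : 0 ≤ (Matrix.of (fun i j => e₁ i * e₁ j + e₂ i * e₂ j) :
        Matrix (Fin 2) (Fin 2) ℝ).det := by
      rw [Matrix.det_fin_two]
      simp only [Matrix.of_apply]
      nlinarith [sq_nonneg (e₁ 0 * e₂ 1 - e₁ 1 * e₂ 0)]
    by_contra hneg
    nlinarith
  have hdetd : DifferentiableAt ℝ (fun z => (metricMatrix g c z).det) z₀ := by
    simp only [Matrix.det_fin_two]
    exact ((differentiableAt_metricMatrix g c 0 0).mul (differentiableAt_metricMatrix g c 1 1)).sub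
      ((differentiableAt_metricMatrix g c 0 1).mul (differentiableAt_metricMatrix g c 1 0))
  have hinvd : ∀ i j, DifferentiableAt ℝ (fun z => (metricMatrix g c z)⁻¹ i j) z₀ := by
    intro i j
    have hadj : DifferentiableAt ℝ (fun z => (metricMatrix g c z).adjugate i j) z₀ := by
      simp only [Matrix.adjugate_fin_two]
      fin_cases i <;> fin_cases j
      · exact differentiableAt_metricMatrix g c 1 1
      · exact (differentiableAt_metricMatrix g c 0 1).neg
      · exact (differentiableAt_metricMatrix g c 1 0).neg
      · exact differentiableAt_metricMatrix g c 0 0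
    simp only [Matrix.inv_def, Ring.inverse_eq_inv', Matrix.smul_apply, smul_eq_mul]
    exact (hdetd.inv hdet0).mul hadj
  have hd : HasFDerivAt (fderiv ℝ (f ∘ (extChartAt (𝓡 2) c).symm)) (chartHessian f c) z₀ :=
    (((contDiffAt_comp_chart_symm hf (mem_extChartAt_target c)).fderiv_right (m := ∞)
      (by simp)).differentiableAt (by simp)).hasFDerivAt
  have hterm : ∀ i, HasFDerivAt (fun z => √(metricMatrix g c z).det *
        ∑ j, (metricMatrix g c z)⁻¹ i j *
          fderiv ℝ (f ∘ (extChartAt (𝓡 2) c).symm) z (basisVec j))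
      (√(metricMatrix g c z₀).det • ∑ j, (metricMatrix g c z₀)⁻¹ i j •
        (chartHessian f c).flip (basisVec j)) z₀ := by
    intro i
    refine hasFDerivAt_mul_of_eq_zero (hdetd.sqrt hdet0) ?_
      (Finset.sum_eq_zero fun j _ => by rw [hcrit, _root_.zero_apply, mul_zero])
    refine HasFDerivAt.fun_sum fun j _ => ?_
    refine hasFDerivAt_mul_of_eq_zero (hinvd i j) ?_ (by rw [hcrit, _root_.zero_apply])
    refine (hd.clm_apply (hasFDerivAt_const (basisVec j) z₀)).congr_fderiv ?_
    ext v
    simp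
  have hsq : √(metricMatrix g c z₀).det ≠ 0 := (Real.sqrt_pos.2 hdetpos).ne'
  rw [laplaceBeltrami, ← hz₀, Fin.sum_univ_two, (hterm 0).fderiv, (hterm 1).fderiv, hinv]
  have hH : ∀ e : Plane, chartHessian f c e e =
      e 0 * e 0 * chartHessian f c (basisVec 0) (basisVec 0) +
      e 0 * e 1 * chartHessian f c (basisVec 0) (basisVec 1) +
      e 1 * e 0 * chartHessian f c (basisVec 1) (basisVec 0) +
      e 1 * e 1 * chartHessian f c (basisVec 1) (basisVec 1) := fun e => by
    conv_lhs => rw [plane_eq_sum e]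
    simp only [map_add, map_smul, _root_.add_apply, _root_.smul_apply, smul_eq_mul]
    ring
  rw [← h.h11, ← h.h22, hH e₁, hH e₂]
  simp only [Fin.sum_univ_two, _root_.add_apply, _root_.smul_apply, smul_eq_mul,
    ContinuousLinearMap.flip_apply, Matrix.of_apply]
  field_simp
  ring

/-! ### Unit tangent vectors -/

/-- The `g`-normalized direction from `c` to `x`. -/
def direction (g : SurfaceMetric M) (c x : M) : Plane :=
  (√(chartMetric g c (extChartAt (𝓡 2) c x - extChartAt (𝓡 2) c c)
    (extChartAt (𝓡 2) c x - extChartAt (𝓡 2) c c)))⁻¹ •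
    (extChartAt (𝓡 2) c x - extChartAt (𝓡 2) c c)

theorem mem_unitTangents_iff (g : SurfaceMetric M) (S : Set M) (c : M) (v : Plane) :
    (v : TangentSpace (𝓡 2) c) ∈ unitTangents g S c ↔
      ∃ x : ℕ → M, (∀ n, x n ∈ S ∧ x n ≠ c) ∧ Tendsto x atTop (𝓝 c) ∧
        Tendsto (fun n => direction g c (x n)) atTop (𝓝 v) := by
  have h : ∀ x : M, (√(g.inner c (secant c x) (secant c x)))⁻¹ • secant c x = direction g c x := by
    intro x
    rw [← chartMetric_apply]
    rfl
  constructor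
  · rintro ⟨x, h1, h2, h3⟩
    exact ⟨x, h1, h2, Tendsto.congr (fun n => h (x n)) h3⟩
  · rintro ⟨x, h1, h2, h3⟩
    exact ⟨x, h1, h2, Tendsto.congr (fun n => (h (x n)).symm) h3⟩

theorem exists_frame_bound (g : SurfaceMetric M) (c : M) :
    ∃ C, 0 < C ∧ ∀ w, ‖w‖ ≤ C * √(chartMetric g c w w) := by
  obtain ⟨e₁, e₂, h11, h22, h12⟩ := exists_orthonormal_pair (chartMetric_pos g c)
  refine ⟨‖e₁‖ + ‖e₂‖ + 1, by positivity, fun w => ?_⟩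
  have hw := eq_orthonormal_expansion (chartMetric_symm g c) (chartMetric_pos g c) h11 h22 h12 w
  have hG : chartMetric g c w w = chartMetric g c e₁ w ^ 2 + chartMetric g c e₂ w ^ 2 := by
    conv_lhs => rw [hw]
    simp only [map_add, map_smul, _root_.add_apply, _root_.smul_apply, smul_eq_mul, h11, h22, h12,
      chartMetric_symm g c e₂ e₁]
    ring
  have b1 : |chartMetric g c e₁ w| ≤ √(chartMetric g c w w) := by
    rw [hG]; exact Real.abs_le_sqrt (by nlinarith [sq_nonneg (chartMetric g c e₂ w)])
  have b2 : |chartMetric g c e₂ w| ≤ √(chartMetric g c w w) := by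
    rw [hG]; exact Real.abs_le_sqrt (by nlinarith [sq_nonneg (chartMetric g c e₁ w)])
  calc ‖w‖ = ‖chartMetric g c e₁ w • e₁ + chartMetric g c e₂ w • e₂‖ := by rw [← hw]
    _ ≤ |chartMetric g c e₁ w| * ‖e₁‖ + |chartMetric g c e₂ w| * ‖e₂‖ := by
      simpa [norm_smul] using norm_add_le (chartMetric g c e₁ w • e₁) (chartMetric g c e₂ w • e₂)
    _ ≤ √(chartMetric g c w w) * ‖e₁‖ + √(chartMetric g c w w) * ‖e₂‖ := by gcongr
    _ ≤ _ := by nlinarith [Real.sqrt_nonneg (chartMetric g c w w)]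

theorem chart_sub_ne_zero {c x : M} (hx : x ∈ (extChartAt (𝓡 2) c).source) (hne : x ≠ c) :
    extChartAt (𝓡 2) c x - extChartAt (𝓡 2) c c ≠ 0 := fun h =>
  hne ((extChartAt (𝓡 2) c).injOn hx (mem_extChartAt_source c) (sub_eq_zero.1 h))

theorem chartMetric_direction (g : SurfaceMetric M) {c x : M}
    (hx : x ∈ (extChartAt (𝓡 2) c).source) (hne : x ≠ c) :
    chartMetric g c (direction g c x) (direction g c x) = 1 := by
  have h := chartMetric_pos g c _ (chart_sub_ne_zero hx hne)
  have h2 := Real.mul_self_sqrt h.le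
  have h3 := (Real.sqrt_pos.2 h).ne'
  simp only [direction, map_smul, _root_.smul_apply, smul_eq_mul]
  field_simp
  nlinarith

theorem chartMetric_unitTangent {g : SurfaceMetric M} {S : Set M} {c : M} {v : Plane}
    (hv : (v : TangentSpace (𝓡 2) c) ∈ unitTangents g S c) : chartMetric g c v v = 1 := by
  obtain ⟨x, h1, h2, h3⟩ := (mem_unitTangents_iff g S c v).1 hv
  have hcont : Continuous fun v : Plane => chartMetric g c v v :=
    (chartMetric g c).continuous.clm_apply continuous_id
  refine tendsto_nhds_unique ((hcont.tendsto v).comp h3) (tendsto_const_nhds.congr' ?_)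
  filter_upwards [h2.eventually_mem (extChartAt_source_mem_nhds (I := 𝓡 2) c)] with n hn
  exact (chartMetric_direction g hn (h1 n).2).symm

/-- The directions are eventually `g`-unit vectors and lie in a compact ball, so a subsequence
converges. -/
theorem unitTangents_nonempty_of_seq (g : SurfaceMetric M) {S : Set M} {c : M} {x : ℕ → M}
    (hx : ∀ n, x n ∈ S ∧ x n ≠ c) (hlim : Tendsto x atTop (𝓝 c)) :
    (unitTangents g S c).Nonempty := by
  obtain ⟨C, hC, hbd⟩ := exists_frame_bound g c
  obtain ⟨N, hN⟩ := eventually_atTop.1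
    (hlim.eventually_mem (extChartAt_source_mem_nhds (I := 𝓡 2) c))
  have hmem : ∀ n, direction g c (x (n + N)) ∈ Metric.closedBall (0 : Plane) C := fun n => by
    have := hbd (direction g c (x (n + N)))
    rw [chartMetric_direction g (hN (n + N) (by omega)) (hx (n + N)).2] at this
    simpa using this
  obtain ⟨v, -, φ, hφ, hv⟩ := (isCompact_closedBall (0 : Plane) C).tendsto_subseq hmem
  refine ⟨v, (mem_unitTangents_iff g S c v).2 ⟨fun n => x (φ n + N), fun n => hx _, ?_, hv⟩⟩
  exact hlim.comp (tendsto_atTop_mono (fun n => Nat.le_add_right _ N) hφ.tendsto_atTop)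

theorem exists_seq_of_mem_closure {S : Set M} {c : M} (h : c ∈ closure S) :
    ∃ x : ℕ → M, (∀ n, x n ∈ S) ∧ Tendsto x atTop (𝓝 c) := by
  have hU : ∀ n : ℕ, (extChartAt (𝓡 2) c).source ∩ extChartAt (𝓡 2) c ⁻¹'
      Metric.ball (extChartAt (𝓡 2) c c) (1 / (n + 1)) ∈ 𝓝 c := fun n =>
    inter_mem (extChartAt_source_mem_nhds c)
      ((continuousAt_extChartAt c).preimage_mem_nhds (Metric.ball_mem_nhds _ (by positivity)))
  choose x hx using fun n => mem_closure_iff_nhds.1 h _ (hU n)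
  refine ⟨x, fun n => (hx n).2, ?_⟩
  have h1 : Tendsto (fun n => extChartAt (𝓡 2) c (x n)) atTop (𝓝 (extChartAt (𝓡 2) c c)) := by
    rw [tendsto_iff_dist_tendsto_zero]
    exact squeeze_zero (fun n => dist_nonneg) (fun n => (Metric.mem_ball.1 (hx n).1.2).le)
      tendsto_one_div_add_atTop_nhds_zero_nat
  have h2 := (continuousAt_extChartAt_symm (I := 𝓡 2) c).tendsto.comp h1
  rw [extChartAt_to_inv] at h2
  exact h2.congr fun n => (extChartAt (𝓡 2) c).left_inv (hx n).1.1

/-- First order condition on the unit tangents of a level set. -/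
theorem fderiv_unitTangent {f : M → ℝ} {g : SurfaceMetric M}
    (hf : ContMDiff (𝓡 2) 𝓘(ℝ, ℝ) ∞ f) {S : Set M} {c : M} (hS : ∀ x ∈ S, f x = f c) {v : Plane}
    (hv : (v : TangentSpace (𝓡 2) c) ∈ unitTangents g S c) :
    fderiv ℝ (f ∘ (extChartAt (𝓡 2) c).symm) (extChartAt (𝓡 2) c c) v = 0 := by
  obtain ⟨x, h1, h2, h3⟩ := (mem_unitTangents_iff g S c v).1 hv
  set z₀ := extChartAt (𝓡 2) c c with hz₀
  set L := fderiv ℝ (f ∘ (extChartAt (𝓡 2) c).symm) z₀ with hL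
  have hd := ((contDiffAt_comp_chart_symm hf (mem_extChartAt_target c)).differentiableAt
    (by simp)).hasFDerivAt
  have hx : Tendsto (fun n => extChartAt (𝓡 2) c (x n)) atTop (𝓝 z₀) :=
    (continuousAt_extChartAt c).tendsto.comp h2
  have hlim : Tendsto (fun n => L (direction g c (x n))) atTop (𝓝 0) := by
    have hbound : ∀ ε > 0, ∀ᶠ n in atTop, ‖L (direction g c (x n))‖ ≤
        ε * ‖direction g c (x n)‖ := by
      intro ε hε
      filter_upwards [hx.eventually (hd.isLittleO.def hε),
        h2.eventually_mem (extChartAt_source_mem_nhds (I := 𝓡 2) c)] with n hn hs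
      simp only [Function.comp_apply, (extChartAt (𝓡 2) c).left_inv hs, extChartAt_to_inv,
        hS _ (h1 n).1, sub_self, zero_sub, norm_neg] at hn
      rw [direction, map_smul, norm_smul, norm_smul]
      calc _ ≤ _ := mul_le_mul_of_nonneg_left hn (norm_nonneg _)
        _ = _ := by ring
    have hnorm := h3.norm
    rw [tendsto_zero_iff_norm_tendsto_zero]
    refine tendsto_order.2 ⟨fun a ha => Eventually.of_forall fun n => ha.trans_le (norm_nonneg _),
      fun a ha => ?_⟩
    have hpos : 0 < ‖v‖ + 1 := by positivity
    filter_upwards [hbound (a / (‖v‖ + 1) / 2) (by positivity),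
      hnorm.eventually (gt_mem_nhds (lt_add_one ‖v‖))] with n hn hn2
    calc _ ≤ _ := hn
      _ ≤ a / (‖v‖ + 1) / 2 * (‖v‖ + 1) := by gcongr
      _ = a / 2 := by field_simp
      _ < a := by linarith
  exact tendsto_nhds_unique ((L.continuous.tendsto v).comp h3) hlim

/-- Second order condition on the unit tangents of a critical level set. -/
theorem hessian_unitTangent {f : M → ℝ} {g : SurfaceMetric M}
    (hf : ContMDiff (𝓡 2) 𝓘(ℝ, ℝ) ∞ f) {S : Set M} {c : M} (hc : IsCritical f c)
    (hS : ∀ x ∈ S, f x = f c) {v : Plane}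
    (hv : (v : TangentSpace (𝓡 2) c) ∈ unitTangents g S c) : chartHessian f c v v = 0 := by
  obtain ⟨x, h1, h2, h3⟩ := (mem_unitTangents_iff g S c v).1 hv
  set z₀ := extChartAt (𝓡 2) c c with hz₀
  have hcrit : fderiv ℝ (f ∘ (extChartAt (𝓡 2) c).symm) z₀ = 0 := by
    rw [← isCritical_chart_symm_iff hf (mem_extChartAt_target c), extChartAt_to_inv]
    exact hc
  have hx : Tendsto (fun n => extChartAt (𝓡 2) c (x n)) atTop (𝓝 z₀) :=
    (continuousAt_extChartAt c).tendsto.comp h2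
  have hcont : Continuous fun v : Plane => chartHessian f c v v :=
    (chartHessian f c).continuous.clm_apply continuous_id
  have hlim : Tendsto (fun n => chartHessian f c (direction g c (x n)) (direction g c (x n)))
      atTop (𝓝 0) := by
    have hbound : ∀ ε > 0, ∀ᶠ n in atTop,
        ‖chartHessian f c (direction g c (x n)) (direction g c (x n))‖ ≤
        2 * ε * ‖direction g c (x n)‖ ^ 2 := by
      intro ε hε
      filter_upwards [hx.eventually (eventually_abs_sub_second_order_le
        ((contDiffAt_comp_chart_symm hf (mem_extChartAt_target c)).of_le two_le_infty) hcrit hε),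
        h2.eventually_mem (extChartAt_source_mem_nhds (I := 𝓡 2) c)] with n hn hs
      simp only [Function.comp_apply, (extChartAt (𝓡 2) c).left_inv hs, extChartAt_to_inv,
        hS _ (h1 n).1, sub_self, zero_sub, abs_neg] at hn
      rw [abs_div, abs_two, div_le_iff₀ two_pos] at hn
      simp only [direction, map_smul, _root_.smul_apply, norm_smul, smul_eq_mul, norm_mul, mul_pow]
      calc _ = ‖(√(chartMetric g c (extChartAt (𝓡 2) c (x n) - z₀)
            (extChartAt (𝓡 2) c (x n) - z₀)))⁻¹‖ ^ 2 * ‖chartHessian f c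
              (extChartAt (𝓡 2) c (x n) - z₀) (extChartAt (𝓡 2) c (x n) - z₀)‖ := by ring
        _ ≤ _ := mul_le_mul_of_nonneg_left hn (by positivity)
        _ = _ := by ring
    have hnorm := h3.norm.pow 2
    rw [tendsto_zero_iff_norm_tendsto_zero]
    refine tendsto_order.2 ⟨fun a ha => Eventually.of_forall fun n => ha.trans_le (norm_nonneg _),
      fun a ha => ?_⟩
    have hpos : 0 < ‖v‖ ^ 2 + 1 := by positivity
    filter_upwards [hbound (a / (‖v‖ ^ 2 + 1) / 4) (by positivity),
      hnorm.eventually (gt_mem_nhds (lt_add_one (‖v‖ ^ 2)))] with n hn hn2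
    calc _ ≤ _ := hn
      _ ≤ 2 * (a / (‖v‖ ^ 2 + 1) / 4) * (‖v‖ ^ 2 + 1) := by gcongr
      _ = a / 2 := by field_simp; ring
      _ < a := by linarith
  exact tendsto_nhds_unique ((hcont.tendsto v).comp h3) hlim

/-! ### Tangents of trajectories at their end points -/

/-- All values of `f` on the trajectory exceed `f c`, and they decrease strictly. Values converging
to `f c` therefore occur only at late times, so the curve approaches its end point from one end
only. -/
theorem IsTrajectory.tendsto_atTop_of_tendsto [T2Space M] {g : SurfaceMetric M} {f : M → ℝ}
    (hf : ContMDiff (𝓡 2) 𝓘(ℝ, ℝ) ∞ f) {γ : ℝ → M} (hγ : IsTrajectory g f γ)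
    (hne : ∃ s t, γ s ≠ γ t) {c : M} (hc : Tendsto γ atTop (𝓝 c)) {t : ℕ → ℝ}
    (ht : Tendsto (fun n => γ (t n)) atTop (𝓝 c)) : Tendsto t atTop atTop := by
  have hanti := hγ.strictAnti hf hne
  have hfc := hf.continuous.tendsto c
  have hlim := hfc.comp hc
  have hgt : ∀ T, f c < f (γ T) := fun T => by
    have h1 : f c ≤ f (γ (T + 1)) := le_of_tendsto hlim
      (by filter_upwards [eventually_ge_atTop (T + 1)] with s hs using hanti.antitone hs)
    exact h1.trans_lt (hanti (lt_add_one T))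
  refine tendsto_atTop.2 fun T => ?_
  filter_upwards [(hfc.comp ht).eventually (gt_mem_nhds (hgt T))] with n hn
  exact (hanti.lt_iff_gt.1 hn).le

theorem IsTrajectory.unitTangents_eq [T2Space M] {g : SurfaceMetric M} {f : M → ℝ}
    (hf : ContMDiff (𝓡 2) 𝓘(ℝ, ℝ) ∞ f) {γ : ℝ → M} (hγ : IsTrajectory g f γ)
    (hne : ∃ s t, γ s ≠ γ t) {c : M} (hc : Tendsto γ atTop (𝓝 c)) {v : Plane}
    (hv : Tendsto (fun t => direction g c (γ t)) atTop (𝓝 v)) :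
    unitTangents g (range γ) c = {(v : TangentSpace (𝓡 2) c)} := by
  have hcrit := hγ.isCritical_of_tendsto hf hc
  refine Subset.antisymm (fun w hw => ?_) (singleton_subset_iff.2 ?_)
  · obtain ⟨x, h1, h2, h3⟩ := (mem_unitTangents_iff g _ c w).1 hw
    choose t ht using fun n => (h1 n).1
    obtain rfl : x = fun n => γ (t n) := funext fun n => (ht n).symm
    exact mem_singleton_iff.2 (tendsto_nhds_unique (X := Plane) h3
      (hv.comp (hγ.tendsto_atTop_of_tendsto hf hne hc h2)))
  · refine (mem_unitTangents_iff g _ c v).2 ⟨fun n => γ n, fun n => ⟨mem_range_self _, fun h =>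
      hγ.not_isCritical hf hne n ((show γ n = c from h) ▸ hcrit)⟩, ?_, ?_⟩
    · exact hc.comp tendsto_natCast_atTop_atTop
    · exact hv.comp tendsto_natCast_atTop_atTop

theorem IsPrincipalFrame.asymptoticallyDiagonal [T2Space M] {g : SurfaceMetric M} {f : M → ℝ}
    {c : M} {e₁ e₂ : Plane} {l₁ l₂ : ℝ} (h : IsPrincipalFrame g f c e₁ e₂ l₁ l₂)
    (hf : ContMDiff (𝓡 2) 𝓘(ℝ, ℝ) ∞ f) {γ : ℝ → M} (hγ : IsTrajectory g f γ)
    (hne : ∃ s t, γ s ≠ γ t) (hc : Tendsto γ atTop (𝓝 c)) :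
    AsymptoticallyDiagonal l₁ l₂
      (fun t => chartMetric g c e₁ (extChartAt (𝓡 2) c (γ t) - extChartAt (𝓡 2) c c))
      (fun t => chartMetric g c e₂ (extChartAt (𝓡 2) c (γ t) - extChartAt (𝓡 2) c c))
      (fun t => chartMetric g c e₁ (chartField g f c (extChartAt (𝓡 2) c (γ t))))
      (fun t => chartMetric g c e₂ (chartField g f c (extChartAt (𝓡 2) c (γ t)))) := by
  have hcrit := hγ.isCritical_of_tendsto hf hc
  have hsrc := hc.eventually_mem (extChartAt_source_mem_nhds (I := 𝓡 2) c)
  have hF0 := (isCritical_iff_chartField g hf c).1 hcrit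
  have hz : Tendsto (fun t => extChartAt (𝓡 2) c (γ t)) atTop (𝓝 (extChartAt (𝓡 2) c c)) :=
    (continuousAt_extChartAt c).tendsto.comp hc
  have hderiv : ∀ e, ∀ᶠ t in atTop, HasDerivAt
      (fun t => chartMetric g c e (extChartAt (𝓡 2) c (γ t) - extChartAt (𝓡 2) c c))
      (chartMetric g c e (chartField g f c (extChartAt (𝓡 2) c (γ t)))) t := fun e => by
    filter_upwards [hsrc] with t ht
    exact (chartMetric g c e).hasFDerivAt.comp_hasDerivAt t ((hγ.hasDerivAt ht).sub_const _)
  have hlin := h.linearizedAt hf hcrit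
  have hpair := hz.prodMk (tendsto_const_nhds (x := extChartAt (𝓡 2) c c) (f := atTop (α := ℝ)))
  refine ⟨hderiv e₁, hderiv e₂, ?_, fun δ hδ => (hpair.eventually (hlin δ hδ)).mono fun t ht => ?_,
    fun δ hδ => (hpair.eventually (hlin δ hδ)).mono fun t ht => ?_⟩
  rotate_left
  · simpa only [hF0, sub_zero] using ht.1
  · simpa only [hF0, sub_zero] using ht.2
  filter_upwards [hsrc] with t ht
  have hpos := chartMetric_pos g c _ (chart_sub_ne_zero ht fun h0 =>
    hγ.not_isCritical hf hne t (h0 ▸ hcrit))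
  rw [h.metric_eq] at hpos
  nlinarith

theorem IsPrincipalFrame.direction_eq {g : SurfaceMetric M} {f : M → ℝ}
    {c : M} {e₁ e₂ : Plane} {l₁ l₂ : ℝ} (h : IsPrincipalFrame g f c e₁ e₂ l₁ l₂) (x : M) :
    direction g c x =
      (chartMetric g c e₁ (extChartAt (𝓡 2) c x - extChartAt (𝓡 2) c c) /
        √(chartMetric g c e₁ (extChartAt (𝓡 2) c x - extChartAt (𝓡 2) c c) ^ 2 +
          chartMetric g c e₂ (extChartAt (𝓡 2) c x - extChartAt (𝓡 2) c c) ^ 2)) • e₁ +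
      (chartMetric g c e₂ (extChartAt (𝓡 2) c x - extChartAt (𝓡 2) c c) /
        √(chartMetric g c e₁ (extChartAt (𝓡 2) c x - extChartAt (𝓡 2) c c) ^ 2 +
          chartMetric g c e₂ (extChartAt (𝓡 2) c x - extChartAt (𝓡 2) c c) ^ 2)) • e₂ := by
  rw [direction, h.metric_eq]
  set s := extChartAt (𝓡 2) c x - extChartAt (𝓡 2) c c
  conv_lhs => rw [h.expand s]
  simp only [map_add, map_smul, smul_eq_mul, h.g11, h.g22, h.g12, h.swap.g12, mul_one, mul_zero,
    add_zero, zero_add, smul_add, smul_smul, div_eq_inv_mul, ← sq]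

/-- A trajectory that ends at `c` has exactly one unit tangent there, which is a principal
direction. -/
theorem IsPrincipalFrame.unitTangents_trajectory [T2Space M] {g : SurfaceMetric M} {f : M → ℝ}
    {c : M} {e₁ e₂ : Plane} {l₁ l₂ : ℝ} (h : IsPrincipalFrame g f c e₁ e₂ l₁ l₂) (hl : l₁ ≠ l₂)
    (hf : ContMDiff (𝓡 2) 𝓘(ℝ, ℝ) ∞ f) {γ : ℝ → M} (hγ : IsTrajectory g f γ)
    (hne : ∃ s t, γ s ≠ γ t) (hc : Tendsto γ atTop (𝓝 c)) :
    ∃ σ : ℝ, (σ = 1 ∨ σ = -1) ∧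
      (unitTangents g (range γ) c = {((σ • e₁ : Plane) : TangentSpace (𝓡 2) c)} ∨
        unitTangents g (range γ) c = {((σ • e₂ : Plane) : TangentSpace (𝓡 2) c)}) := by
  rcases (h.asymptoticallyDiagonal hf hγ hne hc).tendsto_direction hl with
    ⟨σ, hσ, h1, h2⟩ | ⟨σ, hσ, h1, h2⟩
  · refine ⟨σ, hσ.imp And.left And.left, Or.inl (hγ.unitTangents_eq hf hne hc ?_)⟩
    simp only [h.direction_eq]
    simpa using (h1.smul_const e₁).add (h2.smul_const e₂)
  · refine ⟨σ, hσ.imp And.left And.left, Or.inr (hγ.unitTangents_eq hf hne hc ?_)⟩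
    simp only [h.direction_eq]
    simpa using (h1.smul_const e₁).add (h2.smul_const e₂)

/-- Of the two principal axes the expanding one is excluded by
`AsymptoticallyDiagonal.not_tendsto_snd`. The sign of the stable coordinate records the side of
approach. -/
theorem IsPrincipalFrame.unitTangents_stable [T2Space M] {g : SurfaceMetric M} {f : M → ℝ}
    {c : M} {e₁ e₂ : Plane} {l₁ l₂ : ℝ} (h : IsPrincipalFrame g f c e₁ e₂ l₁ l₂) (h1 : 0 < l₁)
    (h2 : l₂ < 0) (hf : ContMDiff (𝓡 2) 𝓘(ℝ, ℝ) ∞ f) {γ : ℝ → M} (hγ : IsTrajectory g f γ)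
    (hne : ∃ s t, γ s ≠ γ t) (hc : Tendsto γ atTop (𝓝 c)) :
    (unitTangents g (range γ) c = {(e₁ : TangentSpace (𝓡 2) c)} ∧ ∀ᶠ t in atTop,
      0 < chartMetric g c e₁ (extChartAt (𝓡 2) c (γ t) - extChartAt (𝓡 2) c c)) ∨
    (unitTangents g (range γ) c = {((-e₁ : Plane) : TangentSpace (𝓡 2) c)} ∧ ∀ᶠ t in atTop,
      chartMetric g c e₁ (extChartAt (𝓡 2) c (γ t) - extChartAt (𝓡 2) c c) < 0) := by
  have hA := h.asymptoticallyDiagonal hf hγ hne hc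
  have hlim : Tendsto (fun t => chartMetric g c e₂ (extChartAt (𝓡 2) c (γ t) -
      extChartAt (𝓡 2) c c)) atTop (𝓝 0) := by
    have hz : Tendsto (fun t => extChartAt (𝓡 2) c (γ t)) atTop (𝓝 (extChartAt (𝓡 2) c c)) :=
      (continuousAt_extChartAt c).tendsto.comp hc
    have := ((chartMetric g c e₂).continuous.tendsto _).comp (hz.sub_const (extChartAt (𝓡 2) c c))
    rw [sub_self, map_zero] at this
    exact this
  rcases hA.tendsto_direction (by linarith) with ⟨σ, hσ, d1, d2⟩ | ⟨σ, hσ, d1, d2⟩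
  · have hdir : Tendsto (fun t => direction g c (γ t)) atTop (𝓝 (σ • e₁)) := by
      simp only [h.direction_eq]
      simpa using (d1.smul_const e₁).add (d2.smul_const e₂)
    have hU := hγ.unitTangents_eq hf hne hc hdir
    rcases hσ with ⟨rfl, hpos⟩ | ⟨rfl, hneg⟩
    · rw [one_smul] at hU
      exact Or.inl ⟨hU, hpos⟩
    · rw [neg_one_smul] at hU
      exact Or.inr ⟨hU, hneg⟩
  · exact absurd ⟨d1, d2⟩ (hA.not_tendsto_snd h2 hlim (by
      rcases hσ with ⟨rfl, -⟩ | ⟨rfl, -⟩ <;> norm_num))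

/-! ### Gradient flow lines that end at a given point -/

/-- `K` is a nonconstant gradient flow line that ends at `c`. -/
def EndsAt (g : SurfaceMetric M) (f : M → ℝ) (K : Set M) (c : M) : Prop :=
  ∃ γ : ℝ → M, IsTrajectory g f γ ∧ (∃ s t, γ s ≠ γ t) ∧ range γ = K ∧ Tendsto γ atTop (𝓝 c)

theorem IsTrajectory.range_eq_of_eq [T2Space M] {g : SurfaceMetric M} {f : M → ℝ}
    (hf : ContMDiff (𝓡 2) 𝓘(ℝ, ℝ) ∞ f) {γ η : ℝ → M} (hγ : IsTrajectory g f γ)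
    (hη : IsTrajectory g f η) {s t : ℝ} (h : γ s = η t) : range γ = range η := by
  have h1 := IsMIntegralCurve.comp_add (I := 𝓡 2) hη (t - s)
  have h2 := hγ.eq_of_eq hf h1 (t := s) (by simpa using h)
  rw [h2]
  exact (add_right_surjective (t - s)).range_comp η

theorem endsAt_neg_iff {g : SurfaceMetric M} {f : M → ℝ} {K : Set M} {c : M} :
    EndsAt g (-f) K c ↔ ∃ γ : ℝ → M, IsTrajectory g f γ ∧ (∃ s t, γ s ≠ γ t) ∧ range γ = K ∧
      Tendsto γ atBot (𝓝 c) := by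
  constructor
  · rintro ⟨γ, h1, ⟨s, t, h2⟩, h3, h4⟩
    refine ⟨fun t => γ (-t), by simpa using h1.reverse, ⟨-s, -t, by simpa using h2⟩, ?_,
      h4.comp tendsto_neg_atBot_atTop⟩
    rw [← h3]
    exact neg_surjective.range_comp γ
  · rintro ⟨γ, h1, ⟨s, t, h2⟩, h3, h4⟩
    refine ⟨fun t => γ (-t), h1.reverse, ⟨-s, -t, by simpa using h2⟩, ?_,
      h4.comp tendsto_neg_atTop_atBot⟩
    rw [← h3]
    exact neg_surjective.range_comp γ

theorem EndsAt.isCritical {g : SurfaceMetric M} {f : M → ℝ} (hf : ContMDiff (𝓡 2) 𝓘(ℝ, ℝ) ∞ f)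
    {K : Set M} {c : M} (h : EndsAt g f K c) : IsCritical f c :=
  h.choose_spec.1.isCritical_of_tendsto hf h.choose_spec.2.2.2

theorem IsNeumannLine.endsAt [T2Space M] {g : SurfaceMetric M} {f : M → ℝ}
    {K : Set M} {c : M} (hK : IsNeumannLine g f K)
    (hKc : MeetsAt g f K c) : c ∈ K ∨ EndsAt g f K c ∨ EndsAt g (-f) K c := by
  obtain ⟨γ, hγ, ⟨s, t, hst⟩, rfl, -⟩ := hK
  rcases hKc with hcK | ⟨η, hη, hr, h⟩
  · exact Or.inl hcK
  · have hne : ∃ s t, η s ≠ η t := by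
      obtain ⟨s', hs'⟩ := hr.symm.subset (mem_range_self s)
      obtain ⟨t', ht'⟩ := hr.symm.subset (mem_range_self t)
      exact ⟨s', t', by rwa [hs', ht']⟩
    rcases h with h | h
    · exact Or.inr (Or.inr (endsAt_neg_iff.2 ⟨η, hη, hne, hr, h⟩))
    · exact Or.inr (Or.inl ⟨η, hη, hne, hr, h⟩)

theorem IsNeumannLine.not_isCritical [T2Space M] {g : SurfaceMetric M} {f : M → ℝ}
    (hf : ContMDiff (𝓡 2) 𝓘(ℝ, ℝ) ∞ f) {K : Set M} (hK : IsNeumannLine g f K) {x : M}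
    (hx : x ∈ K) : ¬ IsCritical f x := by
  obtain ⟨γ, hγ, hne, rfl, -⟩ := hK
  obtain ⟨t, rfl⟩ := hx
  exact hγ.not_isCritical hf hne t

theorem IsNeumannLine.endsAt_of_isCritical [T2Space M] {g : SurfaceMetric M} {f : M → ℝ}
    (hf : ContMDiff (𝓡 2) 𝓘(ℝ, ℝ) ∞ f) {K : Set M} {c : M} (hc : IsCritical f c)
    (hK : IsNeumannLine g f K) (hKc : MeetsAt g f K c) : EndsAt g f K c ∨ EndsAt g (-f) K c :=
  (hK.endsAt hKc).resolve_left fun h => hK.not_isCritical hf h hc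

theorem IsSaddle.neumannLine_of_endsAt {g : SurfaceMetric M} {f : M → ℝ} {K : Set M} {c : M}
    (hc : IsSaddle f c) (h : EndsAt g f K c ∨ EndsAt g (-f) K c) :
    IsNeumannLine g f K ∧ MeetsAt g f K c := by
  rcases h with ⟨γ, h1, h2, h3, h4⟩ | h
  · exact ⟨⟨γ, h1, h2, h3, c, hc, Or.inr h4⟩, Or.inr ⟨γ, h1, h3, Or.inr h4⟩⟩
  · obtain ⟨γ, h1, h2, h3, h4⟩ := endsAt_neg_iff.1 h
    exact ⟨⟨γ, h1, h2, h3, c, hc, Or.inl h4⟩, Or.inr ⟨γ, h1, h3, Or.inl h4⟩⟩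

namespace IsPrincipalFrame

variable {g : SurfaceMetric M} {f : M → ℝ} {c : M} {e₁ e₂ : Plane} {l₁ l₂ : ℝ}

/-- The stable curve exists only in the chart and for `t ≥ 0`. The global trajectory through its
point at time `1` coincides with it for `t > 0` by uniqueness, and the positive `e₁`-coordinate
selects the tangent. -/
theorem exists_endsAt [T2Space M] [CompactSpace M] (h : IsPrincipalFrame g f c e₁ e₂ l₁ l₂)
    (hf : ContMDiff (𝓡 2) 𝓘(ℝ, ℝ) ∞ f) (hc : IsCritical f c) (h1 : 0 < l₁) (h2 : l₂ < 0) :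
    ∃ K, EndsAt g f K c ∧ unitTangents g K c = {(e₁ : TangentSpace (𝓡 2) c)} := by
  obtain ⟨z, hz, hlim⟩ := (h.linearizedAt hf hc).exists_stable_solution
    ((isCritical_iff_chartField g hf c).1 hc) ((contDiffAt_chartField g hf c).of_le (by simp))
    h1 h2 h.g11 h.g12 h.swap.g12 h.g22 h.expand
    ((isOpen_extChartAt_target c).mem_nhds (mem_extChartAt_target (I := 𝓡 2) c))
  set y : ℝ → M := fun t => (extChartAt (𝓡 2) c).symm (z t) with hy
  have hylim : Tendsto y atTop (𝓝 c) := by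
    have := (continuousAt_extChartAt_symm (I := 𝓡 2) c).tendsto.comp hlim
    rwa [extChartAt_to_inv] at this
  obtain ⟨η, hη0, hη⟩ := exists_trajectory g hf (y 1)
  have hγ : IsTrajectory g f (η ∘ (· + -1)) := IsMIntegralCurve.comp_add (I := 𝓡 2) hη (-1)
  set γ := η ∘ (· + -1)
  have heq : ∀ t, 0 < t → γ t = y t := fun t ht =>
    isMIntegralCurveOn_Ioo_eqOn_of_contMDiff_boundaryless (I := 𝓡 2) (t₀ := 1) (a := 0)
      (b := t + 1) ⟨one_pos, by linarith⟩ (contMDiff_neg_grad g hf)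
      (IsMIntegralCurve.isMIntegralCurveOn (I := 𝓡 2) hγ _)
      (fun s hs => (hasMFDerivAt_of_chart (hz s hs.1.le).2.1 (hz s hs.1.le).1).hasMFDerivWithinAt)
      (show η (1 + -1) = y 1 by rw [add_neg_cancel, hη0]) ⟨ht, by linarith⟩
  have hγlim : Tendsto γ atTop (𝓝 c) := hylim.congr' (by
    filter_upwards [eventually_gt_atTop 0] with t ht using (heq t ht).symm)
  have hpos : ∀ t, 0 < t → 0 < chartMetric g c e₁ (extChartAt (𝓡 2) c (γ t) -
      extChartAt (𝓡 2) c c) := fun t ht => by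
    rw [heq t ht, hy, (extChartAt (𝓡 2) c).right_inv (hz t ht.le).2.1]
    exact (hz t ht.le).2.2
  have hne : ∃ s t, γ s ≠ γ t := by
    by_contra! hcon
    have h0 : γ 1 = c := tendsto_nhds_unique
      (tendsto_const_nhds.congr fun t => hcon 1 t) hγlim
    have := hpos 1 one_pos
    rw [h0, sub_self, map_zero] at this
    exact lt_irrefl _ this
  refine ⟨range γ, ⟨γ, hγ, hne, rfl, hγlim⟩, ?_⟩
  rcases h.unitTangents_stable h1 h2 hf hγ hne hγlim with ⟨hu, -⟩ | ⟨-, hneg⟩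
  · exact hu
  · obtain ⟨t, ht, ht0⟩ := (hneg.and (eventually_gt_atTop 0)).exists
    exact absurd (hpos t ht0) ht.not_gt

theorem endsAt_cases [T2Space M] (h : IsPrincipalFrame g f c e₁ e₂ l₁ l₂)
    (hf : ContMDiff (𝓡 2) 𝓘(ℝ, ℝ) ∞ f) (h1 : 0 < l₁) (h2 : l₂ < 0) {K : Set M}
    (hK : EndsAt g f K c) : unitTangents g K c = {(e₁ : TangentSpace (𝓡 2) c)} ∨
      unitTangents g K c = {((-e₁ : Plane) : TangentSpace (𝓡 2) c)} := by
  obtain ⟨γ, hγ, hne, rfl, hlim⟩ := hK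
  exact (h.unitTangents_stable h1 h2 hf hγ hne hlim).imp And.left And.left

/-- The common tangent places both curves on the same side, where they must share a point;
trajectories sharing a point differ only by a time shift. -/
theorem endsAt_unique [T2Space M] (h : IsPrincipalFrame g f c e₁ e₂ l₁ l₂)
    (hf : ContMDiff (𝓡 2) 𝓘(ℝ, ℝ) ∞ f) (h1 : 0 < l₁) (h2 : l₂ < 0) {K L : Set M}
    (hK : EndsAt g f K c) (hL : EndsAt g f L c)
    (hKu : unitTangents g K c = {(e₁ : TangentSpace (𝓡 2) c)})
    (hLu : unitTangents g L c = {(e₁ : TangentSpace (𝓡 2) c)}) : K = L := by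
  have hc := hK.isCritical hf
  have key : ∀ γ : ℝ → M, IsTrajectory g f γ → (∃ s t, γ s ≠ γ t) → Tendsto γ atTop (𝓝 c) →
      unitTangents g (range γ) c = {(e₁ : TangentSpace (𝓡 2) c)} →
      ∀ᶠ t in atTop, 0 < chartMetric g c e₁ (extChartAt (𝓡 2) c (γ t) - extChartAt (𝓡 2) c c) := by
    intro γ hγ hne hlim hu
    rcases h.unitTangents_stable h1 h2 hf hγ hne hlim with ⟨-, hp⟩ | ⟨hu', -⟩
    · exact hp
    · have h3 : e₁ = -e₁ := singleton_injective (hu.symm.trans hu')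
      have h4 := congrArg (chartMetric g c e₁) h3
      rw [map_neg, h.g11] at h4
      norm_num at h4
  obtain ⟨γ, hγ, hγne, rfl, hγlim⟩ := hK
  obtain ⟨η, hη, hηne, rfl, hηlim⟩ := hL
  have hs := extChartAt_source_mem_nhds (I := 𝓡 2) c
  obtain ⟨T, hT⟩ := eventually_atTop.1 ((hγlim.eventually_mem hs).and (hηlim.eventually_mem hs))
  obtain ⟨s, t, hTs, hTt, hst⟩ := (h.linearizedAt hf hc).exists_eq_of_saddle h1 h2
    (fun w hw1 hw2 => by rw [h.expand w, hw1, hw2]; simp)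
    (z := fun t => extChartAt (𝓡 2) c (γ t)) (y := fun t => extChartAt (𝓡 2) c (η t))
    (by filter_upwards [hγlim.eventually_mem hs] with t ht using hγ.hasDerivAt ht)
    (by filter_upwards [hηlim.eventually_mem hs] with t ht using hη.hasDerivAt ht)
    ((continuousAt_extChartAt c).tendsto.comp hγlim)
    ((continuousAt_extChartAt c).tendsto.comp hηlim)
    (key γ hγ hγne hγlim hKu) (key η hη hηne hηlim hLu) T
  exact hγ.range_eq_of_eq hf hη ((extChartAt (𝓡 2) c).injOn (hT s hTs).1 (hT t hTt).2 hst)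

end IsPrincipalFrame

theorem angle_eq_arccos {g : SurfaceMetric M} {c : M} {u v : Plane}
    (hu : chartMetric g c u u = 1) (hv : chartMetric g c v v = 1) :
    NeumannLines.angle g c u v = Real.arccos (chartMetric g c u v) := by
  have hu' : g.inner c u u = 1 := (chartMetric_apply g c u u).symm.trans hu
  have hv' : g.inner c v v = 1 := (chartMetric_apply g c v v).symm.trans hv
  change Real.arccos (g.inner c u v / (√(g.inner c u u) * √(g.inner c v v))) = _
  rw [hu', hv', Real.sqrt_one, mul_one, div_one]
  exact congrArg Real.arccos (chartMetric_apply g c u v).symm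

theorem IsPrincipalFrame.neumannLines_of_saddle [T2Space M] [CompactSpace M]
    {g : SurfaceMetric M} {f : M → ℝ} {c : M} {e₁ e₂ : Plane} {l₁ l₂ : ℝ}
    (h : IsPrincipalFrame g f c e₁ e₂ l₁ l₂) (hf : ContMDiff (𝓡 2) 𝓘(ℝ, ℝ) ∞ f)
    (hc : IsSaddle f c) (h1 : 0 < l₁) (h2 : l₂ < 0) :
    ∃ (L : Fin 4 → Set M) (v : Fin 4 → TangentSpace (𝓡 2) c),
      Function.Injective L ∧
      range L = {K | IsNeumannLine g f K ∧ MeetsAt g f K c} ∧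
      (∀ i, unitTangents g (L i) c = {v i}) ∧
      (∀ i, NeumannLines.angle g c (v i) (v (i + 1)) = Real.pi / 2) ∧
      (∀ i, NeumannLines.angle g c (v i) (v (i + 2)) = Real.pi) := by
  have h' := h.neg.swap
  have h1' : 0 < -l₂ := by linarith
  have h2' : -l₁ < 0 := by linarith
  have hf' : ContMDiff (𝓡 2) 𝓘(ℝ, ℝ) ∞ (-f) := hf.neg
  -- For `-f` the stable axis is `e₂`. Alternating between `f` and `-f` orders the four tangents
  -- cyclically as `e₁, e₂, -e₁, -e₂`.
  obtain ⟨K₀, hK₀, hu₀⟩ := h.exists_endsAt hf hc.1 h1 h2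
  obtain ⟨K₁, hK₁, hu₁⟩ := h'.exists_endsAt hf' hc.neg.1 h1' h2'
  obtain ⟨K₂, hK₂, hu₂⟩ := h.neg_fst.exists_endsAt hf hc.1 h1 h2
  obtain ⟨K₃, hK₃, hu₃⟩ := h'.neg_fst.exists_endsAt hf' hc.neg.1 h1' h2'
  set L : Fin 4 → Set M := ![K₀, K₁, K₂, K₃] with hL
  set v : Fin 4 → Plane := ![e₁, e₂, -e₁, -e₂] with hv
  have hu : ∀ i, unitTangents g (L i) c = {(v i : TangentSpace (𝓡 2) c)} := by
    intro i
    fin_cases i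
    exacts [hu₀, hu₁, hu₂, hu₃]
  have hvv : ∀ i, chartMetric g c (v i) (v i) = 1 := by
    intro i
    fin_cases i <;> simp [hv, h.g11, h.g22]
  refine ⟨L, v, fun i j hij => ?_, ?_, hu, fun i => ?_, fun i => ?_⟩
  · have hvij : v i = v j := singleton_injective
      ((hu i).symm.trans ((congrArg (fun K => unitTangents g K c) hij).trans (hu j)))
    have a := congrArg (chartMetric g c e₁) hvij
    have b := congrArg (chartMetric g c e₂) hvij
    fin_cases i <;> fin_cases j <;> simp [hv, h.g11, h.g22, h.g12, h.swap.g12] at a b ⊢ <;>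
      linarith
  · ext K
    constructor
    · rintro ⟨i, rfl⟩
      refine hc.neumannLine_of_endsAt ?_
      fin_cases i
      exacts [Or.inl hK₀, Or.inr hK₁, Or.inl hK₂, Or.inr hK₃]
    · rintro ⟨hK, hKc⟩
      rcases hK.endsAt_of_isCritical hf hc.1 hKc with hE | hE
      · rcases h.endsAt_cases hf h1 h2 hE with hK' | hK'
        · exact ⟨0, h.endsAt_unique hf h1 h2 hK₀ hE hu₀ hK'⟩
        · exact ⟨2, h.neg_fst.endsAt_unique hf h1 h2 hK₂ hE hu₂ hK'⟩
      · rcases h'.endsAt_cases hf' h1' h2' hE with hK' | hK'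
        · exact ⟨1, h'.endsAt_unique hf' h1' h2' hK₁ hE hu₁ hK'⟩
        · exact ⟨3, h'.neg_fst.endsAt_unique hf' h1' h2' hK₃ hE hu₃ hK'⟩
  · rw [angle_eq_arccos (hvv i) (hvv (i + 1)), ← Real.arccos_zero]
    congr 1
    fin_cases i <;> simp [hv, h.g12, h.swap.g12]
  · rw [angle_eq_arccos (hvv i) (hvv (i + 2)), ← Real.arccos_neg_one]
    congr 1
    fin_cases i <;> simp [hv, h.g11, h.g22]

/-- Exactly four Neumann lines meet at a saddle point, at right angles. -/
theorem IsSaddle.exists_neumannLines [T2Space M] [CompactSpace M]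
    (g : SurfaceMetric M) {f : M → ℝ} (hf : IsMorse f) {c : M} (hc : IsSaddle f c) :
    ∃ (L : Fin 4 → Set M) (v : Fin 4 → TangentSpace (𝓡 2) c),
      Function.Injective L ∧
      range L = {K | IsNeumannLine g f K ∧ MeetsAt g f K c} ∧
      (∀ i, unitTangents g (L i) c = {v i}) ∧
      (∀ i, NeumannLines.angle g c (v i) (v (i + 1)) = Real.pi / 2) ∧
      (∀ i, NeumannLines.angle g c (v i) (v (i + 2)) = Real.pi) := by
  obtain ⟨e₁, e₂, l₁, l₂, h⟩ := exists_isPrincipalFrame g hf.1 c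
  rcases mul_neg_iff.1 (h.mul_neg_of_isSaddle hf hc) with ⟨h1, h2⟩ | ⟨h1, h2⟩
  · exact h.neumannLines_of_saddle hf.1 hc h1 h2
  · exact h.swap.neumannLines_of_saddle hf.1 hc h2 h1

/-! ### Neumann lines at extremal points -/

theorem IsPrincipalFrame.unitTangents_endsAt [T2Space M] {g : SurfaceMetric M} {f : M → ℝ}
    {c : M} {e₁ e₂ : Plane} {l₁ l₂ : ℝ} (h : IsPrincipalFrame g f c e₁ e₂ l₁ l₂) (hl : l₁ ≠ l₂)
    (hf : ContMDiff (𝓡 2) 𝓘(ℝ, ℝ) ∞ f) {K : Set M}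
    (hK : EndsAt g f K c ∨ EndsAt g (-f) K c) :
    ∃ u : Plane, unitTangents g K c = {(u : TangentSpace (𝓡 2) c)} ∧
      (u = e₁ ∨ u = -e₁ ∨ u = e₂ ∨ u = -e₂) := by
  have key : ∃ σ : ℝ, (σ = 1 ∨ σ = -1) ∧
      (unitTangents g K c = {((σ • e₁ : Plane) : TangentSpace (𝓡 2) c)} ∨
        unitTangents g K c = {((σ • e₂ : Plane) : TangentSpace (𝓡 2) c)}) := by
    rcases hK with ⟨γ, hγ, hne, rfl, hlim⟩ | ⟨γ, hγ, hne, rfl, hlim⟩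
    · exact h.unitTangents_trajectory hl hf hγ hne hlim
    · exact h.neg.unitTangents_trajectory (neg_injective.ne hl) hf.neg hγ hne hlim
  obtain ⟨σ, rfl | rfl, hu | hu⟩ := key
  · exact ⟨_, hu, Or.inl (one_smul _ _)⟩
  · exact ⟨_, hu, Or.inr (Or.inr (Or.inl (one_smul _ _)))⟩
  · exact ⟨_, hu, Or.inr (Or.inl (neg_one_smul _ _))⟩
  · exact ⟨_, hu, Or.inr (Or.inr (Or.inr (neg_one_smul _ _)))⟩

theorem exists_unitTangents_of_isLocalExtr [T2Space M] {g : SurfaceMetric M} {f : M → ℝ}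
    (hf : ContMDiff (𝓡 2) 𝓘(ℝ, ℝ) ∞ f) {c : M} (hc : IsLocalExtr f c)
    (hH : ¬ HessianProportional g f c) {K L : Set M} (hK : IsNeumannLine g f K)
    (hKc : MeetsAt g f K c) (hL : IsNeumannLine g f L) (hLc : MeetsAt g f L c) :
    ∃ u v : TangentSpace (𝓡 2) c,
      unitTangents g K c = {u} ∧ unitTangents g L c = {v} ∧
      (NeumannLines.angle g c u v = 0 ∨ NeumannLines.angle g c u v = Real.pi ∨
        NeumannLines.angle g c u v = Real.pi / 2) := by
  obtain ⟨e₁, e₂, l₁, l₂, h⟩ := exists_isPrincipalFrame g hf c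
  have hl := h.ne_of_not_proportional hH
  have hcrit := NeumannLines.IsLocalExtr.isCritical hf hc
  obtain ⟨u, hu, hu'⟩ := h.unitTangents_endsAt hl hf (hK.endsAt_of_isCritical hf hcrit hKc)
  obtain ⟨v, hv, hv'⟩ := h.unitTangents_endsAt hl hf (hL.endsAt_of_isCritical hf hcrit hLc)
  refine ⟨u, v, hu, hv, ?_⟩
  have huu : chartMetric g c u u = 1 := by
    rcases hu' with rfl | rfl | rfl | rfl <;> simp [h.g11, h.g22]
  have hvv : chartMetric g c v v = 1 := by
    rcases hv' with rfl | rfl | rfl | rfl <;> simp [h.g11, h.g22]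
  have huv : chartMetric g c u v = 1 ∨ chartMetric g c u v = -1 ∨ chartMetric g c u v = 0 := by
    rcases hu' with rfl | rfl | rfl | rfl <;> rcases hv' with rfl | rfl | rfl | rfl <;>
      simp [h.g11, h.g22, h.g12, h.swap.g12]
  rw [angle_eq_arccos huu hvv]
  rcases huv with e | e | e <;> rw [e] <;> simp

/-! ### Level sets near a regular point -/

/-- The implicit function theorem straightens the level set to the kernel of `h'`. A small ball
there gives the connected piece `A`, and a nonzero kernel vector, available since the dimension
exceeds `1`, gives points of `A` other than `z₀` that converge to it. -/
theorem exists_preconnected_level_nhds {E : Type*} [NormedAddCommGroup E] [NormedSpace ℝ E]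
    [FiniteDimensional ℝ E] {h : E → ℝ} {h' : E →L[ℝ] ℝ} {z₀ : E}
    (hh : HasStrictFDerivAt h h' z₀) (h0 : h' ≠ 0) (hdim : 1 < Module.finrank ℝ E) {U : Set E}
    (hU : U ∈ 𝓝 z₀) : ∃ W ∈ 𝓝 z₀, ∃ A ⊆ U, IsPreconnected A ∧ (∀ z ∈ A, h z = h z₀) ∧
      (∀ z ∈ W, h z = h z₀ → z ∈ A) ∧
      ∃ y : ℕ → E, (∀ n, y n ∈ A ∧ y n ≠ z₀) ∧ Tendsto y atTop (𝓝 z₀) := by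
  have : CompleteSpace E := FiniteDimensional.complete ℝ E
  have hsurj : h'.range = ⊤ := LinearMap.range_eq_top.2
    (LinearMap.surjective fun hz => h0 (ContinuousLinearMap.coe_injective hz))
  obtain ⟨k₀, hk₀, hne⟩ := (Submodule.ne_bot_iff _).1
    (LinearMap.ker_ne_bot_of_finrank_lt (f := (h' : E →ₗ[ℝ] ℝ)) (by simpa using hdim))
  set k : h'.ker := ⟨k₀, hk₀⟩ with hk
  have hkne : k ≠ 0 := fun hz => hne (congrArg Subtype.val hz)
  set Φ := hh.implicitToOpenPartialHomeomorph h h' hsurj with hΦ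
  have hsrc : z₀ ∈ Φ.source := hh.mem_implicitToOpenPartialHomeomorph_source hsurj
  have hΦ0 : Φ z₀ = (h z₀, 0) := hh.implicitToOpenPartialHomeomorph_self hsurj
  have hfst : ∀ z, (Φ z).1 = h z := hh.implicitToOpenPartialHomeomorph_fst hsurj
  have htar : (h z₀, (0 : h'.ker)) ∈ Φ.target := hh.mem_implicitToOpenPartialHomeomorph_target hsurj
  have hsymm0 : Φ.symm (h z₀, 0) = z₀ := by rw [← hΦ0, Φ.left_inv hsrc]
  have hcont : ContinuousAt Φ.symm (h z₀, 0) := Φ.continuousAt_symm htar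
  obtain ⟨δ, hδ, hball⟩ := Metric.mem_nhds_iff.1
    (inter_mem (Φ.open_target.mem_nhds htar) (hcont.preimage_mem_nhds (by rwa [hsymm0])))
  have hmem : ∀ v ∈ Metric.ball (0 : h'.ker) δ, (h z₀, v) ∈ Φ.target ∩ Φ.symm ⁻¹' U :=
    fun v hv => hball (by
      rw [Metric.mem_ball, Prod.dist_eq, dist_self]
      exact max_lt hδ hv)
  set A := (fun v => Φ.symm (h z₀, v)) '' Metric.ball (0 : h'.ker) δ with hA
  have hlim : Tendsto (fun n : ℕ => (1 / ((n : ℝ) + 1)) • k) atTop (𝓝 0) := by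
    simpa using (tendsto_one_div_add_atTop_nhds_zero_nat (𝕜 := ℝ)).smul_const k
  obtain ⟨N, hN⟩ := eventually_atTop.1 (hlim.eventually_mem (Metric.ball_mem_nhds _ hδ))
  have hpair : Tendsto (fun v : h'.ker => Φ.symm (h z₀, v)) (𝓝 0) (𝓝 z₀) := by
    have := hcont.tendsto.comp ((continuous_const.prodMk continuous_id).tendsto (0 : h'.ker))
    rwa [hsymm0] at this
  refine ⟨Φ.source ∩ Φ ⁻¹' Metric.ball (h z₀, 0) δ, inter_mem (Φ.open_source.mem_nhds hsrc)
    ((Φ.continuousAt hsrc).preimage_mem_nhds (by rw [hΦ0]; exact Metric.ball_mem_nhds _ hδ)),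
    A, ?_, ?_, ?_, ?_, fun n => Φ.symm (h z₀, (1 / (((n + N : ℕ) : ℝ) + 1)) • k), fun n => ⟨?_, ?_⟩,
    ?_⟩
  · rintro _ ⟨v, hv, rfl⟩
    exact (hmem v hv).2
  · refine (convex_ball (0 : h'.ker) δ).isPreconnected.image _ fun v hv => ?_
    exact ((Φ.continuousAt_symm (hmem v hv).1).comp
      (continuous_const.prodMk continuous_id).continuousAt).continuousWithinAt
  · rintro _ ⟨v, hv, rfl⟩
    rw [← hfst, Φ.right_inv (hmem v hv).1]
  · rintro z ⟨hz1, hz2⟩ hz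
    refine ⟨(Φ z).2, ?_, ?_⟩
    · have hz2' : dist (Φ z) (h z₀, 0) < δ := hz2
      rw [Prod.dist_eq] at hz2'
      exact (le_max_right _ _).trans_lt hz2'
    · have : (h z₀, (Φ z).2) = Φ z := Prod.ext (by rw [hfst, hz]) rfl
      simp only [this, Φ.left_inv hz1]
  · exact ⟨_, hN (n + N) (by omega), rfl⟩
  · intro hcon
    have h1 := congrArg Φ hcon
    rw [Φ.right_inv (hmem _ (hN (n + N) (by omega))).1, hΦ0] at h1
    have h2 : (1 / (((n + N : ℕ) : ℝ) + 1)) • k = 0 := congrArg Prod.snd h1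
    rcases smul_eq_zero.1 h2 with h3 | h3
    · have : (0 : ℝ) < 1 / (((n + N : ℕ) : ℝ) + 1) := by positivity
      exact this.ne' h3
    · exact hkne h3
  · exact hpair.comp (hlim.comp (tendsto_add_atTop_nat N))

theorem IsNodalLine.subset {f : M → ℝ} {N : Set M} (hN : IsNodalLine f N) :
    N ⊆ {y | f y = 0 ∧ ¬ IsCritical f y} := by
  obtain ⟨x, -, -, rfl⟩ := hN
  exact connectedComponentIn_subset _ _

theorem IsNodalLine.eq_zero_of_mem_closure {f : M → ℝ} (hf : Continuous f) {N : Set M}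
    (hN : IsNodalLine f N) {c : M} (hc : c ∈ closure N) : f c = 0 :=
  closure_minimal (fun _ hx => (hN.subset hx).1) (isClosed_singleton.preimage hf) hc

theorem IsNodalLine.subset_of_isPreconnected {f : M → ℝ} {N A : Set M} (hN : IsNodalLine f N)
    (hA : IsPreconnected A) (hAs : A ⊆ {y | f y = 0 ∧ ¬ IsCritical f y}) {x : M} (hxA : x ∈ A)
    (hxN : x ∈ N) : A ⊆ N := by
  obtain ⟨y, -, -, rfl⟩ := hN
  rw [connectedComponentIn_eq hxN]
  exact hA.subset_connectedComponentIn hxA hAs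

/-- Near a regular zero the nodal set lies in a single connected piece of regular zeros. A nodal
line accumulating there meets this piece and, being a component, contains it, together with its
points near `c`. -/
theorem IsNodalLine.exists_seq_of_not_isCritical {f : M → ℝ} (hf : ContMDiff (𝓡 2) 𝓘(ℝ, ℝ) ∞ f)
    {N : Set M} (hN : IsNodalLine f N) {c : M} (hc : c ∈ closure N) (hcr : ¬ IsCritical f c) :
    ∃ x : ℕ → M, (∀ n, x n ∈ N ∧ x n ≠ c) ∧ Tendsto x atTop (𝓝 c) := by
  set z₀ := extChartAt (𝓡 2) c c with hz₀
  have hz₀t : z₀ ∈ (extChartAt (𝓡 2) c).target := mem_extChartAt_target c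
  have hfc := hN.eq_zero_of_mem_closure hf.continuous hc
  have hC := contDiffAt_comp_chart_symm hf hz₀t
  have h0 : (f ∘ (extChartAt (𝓡 2) c).symm) z₀ = 0 := by
    rw [Function.comp_apply, hz₀, extChartAt_to_inv, hfc]
  have hD : fderiv ℝ (f ∘ (extChartAt (𝓡 2) c).symm) z₀ ≠ 0 := fun hD => hcr (by
    rw [← extChartAt_to_inv (I := 𝓡 2) c]
    exact (isCritical_chart_symm_iff hf hz₀t).2 hD)
  have hDc : ContinuousAt (fderiv ℝ (f ∘ (extChartAt (𝓡 2) c).symm)) z₀ :=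
    (hC.fderiv_right (m := ∞) (by simp)).continuousAt
  obtain ⟨W, hW, A, hAU, hA, hAf, hWA, y, hy, hylim⟩ := exists_preconnected_level_nhds
    (hC.hasStrictFDerivAt (by simp)) hD (by simp)
    (inter_mem ((isOpen_extChartAt_target c).mem_nhds hz₀t)
      (hDc.preimage_mem_nhds (isOpen_ne.mem_nhds hD)))
  have hA' : IsPreconnected ((extChartAt (𝓡 2) c).symm '' A) :=
    hA.image _ ((continuousOn_extChartAt_symm c).mono fun z hz => (hAU hz).1)
  have hAs : (extChartAt (𝓡 2) c).symm '' A ⊆ {y | f y = 0 ∧ ¬ IsCritical f y} := by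
    rintro _ ⟨z, hz, rfl⟩
    exact ⟨(hAf z hz).trans h0, fun hcz => (hAU hz).2
      ((isCritical_chart_symm_iff hf (hAU hz).1).1 hcz)⟩
  obtain ⟨x, ⟨hxs, hxW⟩, hxN⟩ := mem_closure_iff_nhds.1 hc _ (inter_mem
    (extChartAt_source_mem_nhds (I := 𝓡 2) c) ((continuousAt_extChartAt c).preimage_mem_nhds hW))
  have hxA : x ∈ (extChartAt (𝓡 2) c).symm '' A := by
    refine ⟨extChartAt (𝓡 2) c x, hWA _ hxW ?_, (extChartAt (𝓡 2) c).left_inv hxs⟩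
    rw [h0, Function.comp_apply, (extChartAt (𝓡 2) c).left_inv hxs, (hN.subset hxN).1]
  have hsub := hN.subset_of_isPreconnected hA' hAs hxA hxN
  refine ⟨fun n => (extChartAt (𝓡 2) c).symm (y n), fun n =>
    ⟨hsub ⟨_, (hy n).1, rfl⟩, fun hcon => (hy n).2 ?_⟩, ?_⟩
  · rw [← (extChartAt (𝓡 2) c).right_inv (hAU (hy n).1).1, show (extChartAt (𝓡 2) c).symm (y n) = c from hcon]
  · have := (continuousAt_extChartAt_symm (I := 𝓡 2) c).tendsto.comp hylim
    rwa [extChartAt_to_inv] at this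

/-! ### Angles between nodal lines and Neumann lines -/

theorem min_arccos_of_sq_eq_half {x : ℝ} (hx : x ^ 2 = 1 / 2) :
    min (Real.arccos x) (Real.pi - Real.arccos x) = Real.pi / 4 := by
  have hpi := Real.pi_pos
  have key : Real.arccos (√2 / 2) = Real.pi / 4 := by
    rw [← Real.cos_pi_div_four, Real.arccos_cos (by linarith) (by linarith)]
  have hs : (√2 / 2) ^ 2 = 1 / 2 := by
    rw [div_pow, Real.sq_sqrt (by norm_num)]
    norm_num
  rcases sq_eq_sq_iff_eq_or_eq_neg.1 (hx.trans hs.symm) with rfl | rfl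
  · rw [key, min_eq_left (by linarith)]
  · rw [Real.arccos_neg, key, min_eq_right (by linarith)]
    ring

theorem lineAngle_eq {g : SurfaceMetric M} {c : M} {u v : Plane}
    (hu : chartMetric g c u u = 1) (hv : chartMetric g c v v = 1) :
    lineAngle g c u v = min (Real.arccos (chartMetric g c u v))
      (Real.pi - Real.arccos (chartMetric g c u v)) := by
  rw [← angle_eq_arccos hu hv]
  rfl

namespace IsPrincipalFrame

variable {g : SurfaceMetric M} {f : M → ℝ} {c : M} {e₁ e₂ : Plane} {l₁ l₂ : ℝ}

/-- Along the line in direction `e₁` the function changes by `l₁t²/2` up to a small multiple of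
`t²`; a negative `l₁` would make it smaller than at `c`. -/
theorem nonneg_of_isLocalMin (h : IsPrincipalFrame g f c e₁ e₂ l₁ l₂)
    (hf : ContMDiff (𝓡 2) 𝓘(ℝ, ℝ) ∞ f) (hc : IsLocalMin f c) : 0 ≤ l₁ := by
  set z₀ := extChartAt (𝓡 2) c c with hz₀
  have hz₀t : z₀ ∈ (extChartAt (𝓡 2) c).target := mem_extChartAt_target c
  have hcrit : fderiv ℝ (f ∘ (extChartAt (𝓡 2) c).symm) z₀ = 0 := by
    rw [← isCritical_chart_symm_iff hf hz₀t, extChartAt_to_inv]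
    exact NeumannLines.IsLocalExtr.isCritical hf (Or.inl hc)
  have h0 : (f ∘ (extChartAt (𝓡 2) c).symm) z₀ = f c := by
    rw [Function.comp_apply, hz₀, extChartAt_to_inv]
  have hmin : ∀ᶠ z in 𝓝 z₀, f c ≤ (f ∘ (extChartAt (𝓡 2) c).symm) z := by
    have := (continuousAt_extChartAt_symm (I := 𝓡 2) c).tendsto
    rw [extChartAt_to_inv] at this
    exact this.eventually hc
  by_contra! hneg
  set ε := -l₁ / (4 * (‖e₁‖ ^ 2 + 1)) with hε
  have hεpos : 0 < ε := div_pos (by linarith) (by positivity)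
  have hev := hmin.and (eventually_abs_sub_second_order_le
    ((contDiffAt_comp_chart_symm hf hz₀t).of_le two_le_infty) hcrit hεpos)
  have hpath : Tendsto (fun t : ℝ => z₀ + t • e₁) (𝓝[≠] 0) (𝓝 z₀) := by
    have : ContinuousAt (fun t : ℝ => z₀ + t • e₁) 0 := by fun_prop
    have h2 := this.tendsto
    rw [zero_smul, add_zero] at h2
    exact h2.mono_left nhdsWithin_le_nhds
  obtain ⟨t, ⟨ht1, ht2⟩, ht0⟩ := ((hpath.eventually hev).and self_mem_nhdsWithin).exists
  have ht : 0 < t ^ 2 := by have : t ≠ 0 := ht0; positivity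
  have hH : fderiv ℝ (fderiv ℝ (f ∘ (extChartAt (𝓡 2) c).symm)) z₀ (t • e₁) (t • e₁) =
      t ^ 2 * l₁ := by
    rw [← h.h11, chartHessian]
    simp only [map_smul, _root_.smul_apply, smul_eq_mul]
    ring
  rw [h0, add_sub_cancel_left, hH, norm_smul, mul_pow, Real.norm_eq_abs, sq_abs] at ht2
  have h3 := (abs_le.1 ht2).2
  have h4 : ε * ‖e₁‖ ^ 2 ≤ -l₁ / 4 := by
    rw [hε, div_mul_eq_mul_div, div_le_iff₀ (by positivity)]
    nlinarith [sq_nonneg ‖e₁‖]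
  nlinarith

theorem not_isLocalExtr (h : IsPrincipalFrame g f c e₁ e₂ l₁ l₂)
    (hf : ContMDiff (𝓡 2) 𝓘(ℝ, ℝ) ∞ f) (hl : l₁ * l₂ < 0) : ¬ IsLocalExtr f c := by
  rintro (hc | hc)
  · exact (mul_nonneg (h.nonneg_of_isLocalMin hf hc) (h.swap.nonneg_of_isLocalMin hf hc)).not_gt hl
  · have hc' : IsLocalMin (-f) c := hc.neg
    have h1 := h.neg.nonneg_of_isLocalMin hf.neg hc'
    have h2 := h.neg.swap.nonneg_of_isLocalMin hf.neg hc'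
    nlinarith

/-- The directions in which a trace free Hessian vanishes bisect the principal directions. -/
theorem lineAngle_of_hessian_eq_zero (h : IsPrincipalFrame g f c e₁ e₂ l₁ l₂) (hl : l₁ ≠ 0)
    (hl' : l₁ + l₂ = 0) {u v : Plane} (hu : chartMetric g c u u = 1)
    (huH : chartHessian f c u u = 0) (hv : v = e₁ ∨ v = -e₁ ∨ v = e₂ ∨ v = -e₂) :
    lineAngle g c u v = Real.pi / 4 := by
  have hvv : chartMetric g c v v = 1 := by
    rcases hv with rfl | rfl | rfl | rfl <;> simp [h.g11, h.g22]
  rw [lineAngle_eq hu hvv]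
  refine min_arccos_of_sq_eq_half ?_
  rw [h.metric_eq] at hu
  rw [h.hessian_eq, eq_neg_of_add_eq_zero_right hl'] at huH
  have h1 : l₁ * (chartMetric g c e₁ u ^ 2 - chartMetric g c e₂ u ^ 2) = 0 := by linarith
  -- The frame coordinates of `u` have equal squares with sum `1`, so each square is `1/2`.
  have h2 := (mul_eq_zero.1 h1).resolve_left hl
  rw [chartMetric_symm]
  rcases hv with rfl | rfl | rfl | rfl <;>
    (try simp only [map_neg, _root_.neg_apply, neg_sq]) <;> linarith

end IsPrincipalFrame

/-- Strict monotonicity of `f` along the trajectory prevents it from returning near an earlier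
point, so secants within the image are secants of the parametrized curve. -/
theorem IsTrajectory.tendsto_of_tendsto_comp [T2Space M] {g : SurfaceMetric M} {f : M → ℝ}
    (hf : ContMDiff (𝓡 2) 𝓘(ℝ, ℝ) ∞ f) {γ : ℝ → M} (hγ : IsTrajectory g f γ)
    (hne : ∃ s t, γ s ≠ γ t) {t₀ : ℝ} {t : ℕ → ℝ}
    (ht : Tendsto (fun n => γ (t n)) atTop (𝓝 (γ t₀))) : Tendsto t atTop (𝓝 t₀) := by
  have hanti := hγ.strictAnti hf hne
  have hlim := (hf.continuous.tendsto (γ t₀)).comp ht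
  refine tendsto_order.2 ⟨fun a ha => ?_, fun a ha => ?_⟩
  · filter_upwards [hlim.eventually (gt_mem_nhds (hanti ha))] with n hn
    exact hanti.lt_iff_gt.1 hn
  · filter_upwards [hlim.eventually (lt_mem_nhds (hanti ha))] with n hn
    exact hanti.lt_iff_gt.1 hn

/-- At a point of a trajectory its unit tangents are orthogonal to the kernel of `df`. -/
theorem IsTrajectory.chartMetric_unitTangent_eq_zero [T2Space M] {g : SurfaceMetric M} {f : M → ℝ}
    (hf : ContMDiff (𝓡 2) 𝓘(ℝ, ℝ) ∞ f) {γ : ℝ → M} (hγ : IsTrajectory g f γ)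
    (hne : ∃ s t, γ s ≠ γ t) (t₀ : ℝ) {u v : Plane}
    (hu : fderiv ℝ (f ∘ (extChartAt (𝓡 2) (γ t₀)).symm) (extChartAt (𝓡 2) (γ t₀) (γ t₀)) u = 0)
    (hv : (v : TangentSpace (𝓡 2) (γ t₀)) ∈ unitTangents g (range γ) (γ t₀)) :
    chartMetric g (γ t₀) u v = 0 := by
  set c := γ t₀ with hc
  obtain ⟨x, h1, h2, h3⟩ := (mem_unitTangents_iff g _ c v).1 hv
  choose t ht using fun n => (h1 n).1
  obtain rfl : x = fun n => γ (t n) := funext fun n => (ht n).symm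
  have hne0 : ∀ n, t n ≠ t₀ := fun n h => (h1 n).2 (by simp only [h, hc])
  have htlim : Tendsto t atTop (𝓝[≠] t₀) := tendsto_nhdsWithin_iff.2
    ⟨hγ.tendsto_of_tendsto_comp hf hne h2, Eventually.of_forall hne0⟩
  set z₀ := extChartAt (𝓡 2) c c with hz₀
  set X := chartField g f c z₀ with hX
  have hXu : chartMetric g c X u = 0 := by
    rw [chartMetric, coordMetric_chartField g hf (mem_extChartAt_target c), hu, neg_zero]
  have hX0 : X ≠ 0 := fun h0 => hγ.not_isCritical hf hne t₀ ((isCritical_iff_chartField g hf c).2 h0)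
  have hd := (hγ.hasDerivAt (c := c) (t := t₀) (mem_extChartAt_source c))
  have hq := (hasDerivAt_iff_tendsto_slope.1 hd).comp htlim
  have hGc : Continuous fun w : Plane => chartMetric g c w w :=
    (chartMetric g c).continuous.clm_apply continuous_id
  -- Squares are compared because a difference quotient points against the secant when `t n < t₀`.
  -- The normalized quantity `G(u, s)²/G(s, s)` is the same for both.
  have hlim1 := (((chartMetric g c u).continuous.tendsto X).comp hq).pow 2 |>.div
    ((hGc.tendsto X).comp hq) (chartMetric_pos g c X hX0).ne'
  rw [chartMetric_symm, hXu] at hlim1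
  have hlim2 := (((chartMetric g c u).continuous.tendsto v).comp h3).pow 2
  have heq : (fun n => ((chartMetric g c u ∘ fun n => direction g c (γ (t n))) n) ^ 2) =ᶠ[atTop]
      fun n => ((chartMetric g c u ∘
        slope (fun s => extChartAt (𝓡 2) c (γ s)) t₀ ∘ t) n) ^ 2 /
        ((fun w => chartMetric g c w w) ∘
          slope (fun s => extChartAt (𝓡 2) c (γ s)) t₀ ∘ t) n := by
    filter_upwards [h2.eventually_mem (extChartAt_source_mem_nhds (I := 𝓡 2) c)] with n hn
    have hpos := chartMetric_pos g c _ (chart_sub_ne_zero hn (h1 n).2)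
    have hsub : t n - t₀ ≠ 0 := sub_ne_zero.2 (hne0 n)
    simp only [Function.comp_apply, slope_def_module, direction, map_smul, _root_.smul_apply,
      smul_eq_mul, mul_pow, inv_pow, Real.sq_sqrt hpos.le, ← hc]
    rw [← hc] at *
    field_simp
  have h0 := tendsto_nhds_unique (hlim2.congr' heq) hlim1
  rw [zero_pow two_ne_zero, zero_div] at h0
  exact pow_eq_zero_iff two_ne_zero |>.1 h0

theorem IsTrajectory.unitTangents_nonempty [T2Space M] {g : SurfaceMetric M} {f : M → ℝ}
    (hf : ContMDiff (𝓡 2) 𝓘(ℝ, ℝ) ∞ f) {γ : ℝ → M} (hγ : IsTrajectory g f γ)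
    (hne : ∃ s t, γ s ≠ γ t) (t₀ : ℝ) : (unitTangents g (range γ) (γ t₀)).Nonempty := by
  refine unitTangents_nonempty_of_seq g (x := fun n : ℕ => γ (t₀ + 1 / ((n : ℝ) + 1)))
    (fun n => ⟨mem_range_self _, fun h => ?_⟩) ?_
  · have h1 := (hγ.strictAnti hf hne).injective (congrArg f h)
    have h2 : (0 : ℝ) < 1 / ((n : ℝ) + 1) := by positivity
    linarith
  · have h1 : Tendsto (fun n : ℕ => t₀ + 1 / ((n : ℝ) + 1)) atTop (𝓝 t₀) := by
      simpa using (tendsto_one_div_add_atTop_nhds_zero_nat (𝕜 := ℝ)).const_add t₀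
    exact (hγ t₀).continuousAt.tendsto.comp h1

/-- The eigenvalue equation at a critical zero reads `l₁ + l₂ = 0`. By nondegeneracy the eigenvalues
are then nonzero, opposite and distinct, so `c` is a saddle and the Neumann line has a principal
tangent. -/
theorem lineAngle_nodal_of_isCritical [T2Space M] {g : SurfaceMetric M} {f : M → ℝ}
    (hf : IsMorseEigenfunction g f) {c : M} {N L : Set M} (hN : IsNodalLine f N)
    (hcN : c ∈ closure N) (hL : IsNeumannLine g f L) (hLc : MeetsAt g f L c)
    (hc : IsCritical f c) : IsSaddle f c ∧
      (unitTangents g N c).Nonempty ∧ (unitTangents g L c).Nonempty ∧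
        ∀ u ∈ unitTangents g N c, ∀ v ∈ unitTangents g L c, lineAngle g c u v = Real.pi / 4 := by
  obtain ⟨hM, -, eig, heig⟩ := hf
  obtain ⟨e₁, e₂, l₁, l₂, h⟩ := exists_isPrincipalFrame g hM.1 c
  have hfc := hN.eq_zero_of_mem_closure hM.1.continuous hcN
  have htr : l₁ + l₂ = 0 := by
    have := heig c
    rw [h.laplaceBeltrami_eq hM.1 hc, hfc, mul_zero] at this
    linarith
  have hl := h.fst_ne_zero hM hc
  have hl2 : l₂ = -l₁ := eq_neg_of_add_eq_zero_right htr
  have hprod : l₁ * l₂ < 0 := by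
    have : 0 < l₁ ^ 2 := by positivity
    rw [hl2]
    linarith
  have hne : l₁ ≠ l₂ := fun h0 => hl (by linarith)
  obtain ⟨v₀, hv₀, hv₀'⟩ := h.unitTangents_endsAt hne hM.1 (hL.endsAt_of_isCritical hM.1 hc hLc)
  obtain ⟨x, hxN, hx⟩ := exists_seq_of_mem_closure hcN
  refine ⟨⟨hc, h.not_isLocalExtr hM.1 hprod⟩, unitTangents_nonempty_of_seq g (x := x)
    (fun n => ⟨hxN n, fun h0 => (hN.subset (hxN n)).2 (by rwa [h0])⟩) hx,
    by rw [hv₀]; exact singleton_nonempty _, fun u hu v hv => ?_⟩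
  rw [hv₀] at hv
  have hv' : v = v₀ := hv
  subst hv'
  exact h.lineAngle_of_hessian_eq_zero hl htr (chartMetric_unitTangent hu)
    (hessian_unitTangent hM.1 hc (fun y hy => (hN.subset hy).1.trans hfc.symm) hu) hv₀'

/-- Trajectories only start or end at critical points, so here the Neumann line passes through `c`.
Its tangent is the gradient direction, orthogonal to the kernel of `df`, which contains the nodal
tangents. -/
theorem lineAngle_nodal_of_not_isCritical [T2Space M] {g : SurfaceMetric M} {f : M → ℝ}
    (hf : ContMDiff (𝓡 2) 𝓘(ℝ, ℝ) ∞ f) {c : M} {N L : Set M} (hN : IsNodalLine f N)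
    (hcN : c ∈ closure N) (hL : IsNeumannLine g f L) (hLc : MeetsAt g f L c)
    (hc : ¬ IsCritical f c) :
      (unitTangents g N c).Nonempty ∧ (unitTangents g L c).Nonempty ∧
        ∀ u ∈ unitTangents g N c, ∀ v ∈ unitTangents g L c, lineAngle g c u v = Real.pi / 2 := by
  have hcL : c ∈ L := (hL.endsAt hLc).resolve_right (by
    rintro (h | h)
    · exact hc (h.isCritical hf)
    · exact hc (isCritical_neg.1 (h.isCritical hf.neg)))
  have hfc := hN.eq_zero_of_mem_closure hf.continuous hcN
  obtain ⟨x, hx, hxlim⟩ := hN.exists_seq_of_not_isCritical hf hcN hc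
  obtain ⟨γ, hγ, hne, rfl, -⟩ := hL
  obtain ⟨t₀, rfl⟩ := hcL
  refine ⟨unitTangents_nonempty_of_seq g hx hxlim, hγ.unitTangents_nonempty hf hne t₀,
    fun u hu v hv => ?_⟩
  have huv := hγ.chartMetric_unitTangent_eq_zero hf hne t₀
    (fderiv_unitTangent hf (fun y hy => (hN.subset hy).1.trans hfc.symm) hu) hv
  have h1 := lineAngle_eq (chartMetric_unitTangent hu) (chartMetric_unitTangent hv)
  rw [huv, Real.arccos_zero] at h1
  refine h1.trans ?_
  rw [sub_half, min_self]

end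

end NeumannLines

/-! ### The three statements on Neumann lines -/

theorem mainTheorem1 {M : Type*} [TopologicalSpace M] [ChartedSpace Plane M]
    [IsManifold (𝓡 2) ∞ M] [T2Space M] [CompactSpace M]
    (g : SurfaceMetric M) (f : M → ℝ) (hf : IsMorse f) :
    -- exactly four Neumann lines meet at a saddle point, at right angles
    (∀ c : M, IsSaddle f c →
      ∃ (L : Fin 4 → Set M) (v : Fin 4 → TangentSpace (𝓡 2) c),
        Function.Injective L ∧
        range L = {K | IsNeumannLine g f K ∧ MeetsAt g f K c} ∧
        (∀ i, unitTangents g (L i) c = {v i}) ∧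
        (∀ i, NeumannLines.angle g c (v i) (v (i + 1)) = Real.pi / 2) ∧
        (∀ i, NeumannLines.angle g c (v i) (v (i + 2)) = Real.pi)) ∧
    -- Neumann lines at an extremal point
    (∀ c : M, IsLocalExtr f c → ¬ HessianProportional g f c →
      ∀ K L : Set M, IsNeumannLine g f K → MeetsAt g f K c →
        IsNeumannLine g f L → MeetsAt g f L c →
        ∃ u v : TangentSpace (𝓡 2) c,
          unitTangents g K c = {u} ∧ unitTangents g L c = {v} ∧
          (NeumannLines.angle g c u v = 0 ∨ NeumannLines.angle g c u v = Real.pi ∨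
            NeumannLines.angle g c u v = Real.pi / 2)) ∧
    -- nodal lines and Neumann lines
    (IsMorseEigenfunction g f →
      ∀ (c : M) (N L : Set M), IsNodalLine f N → c ∈ closure N →
        IsNeumannLine g f L → MeetsAt g f L c →
        (unitTangents g N c).Nonempty ∧ (unitTangents g L c).Nonempty ∧
        ∀ u ∈ unitTangents g N c, ∀ v ∈ unitTangents g L c,
          (IsSaddle f c → lineAngle g c u v = Real.pi / 4) ∧
          (¬ IsSaddle f c → lineAngle g c u v = Real.pi / 2)) := by
  refine ⟨fun c hc => hc.exists_neumannLines g hf, fun c hc hH K L hK hKc hL hLc =>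
    exists_unitTangents_of_isLocalExtr hf.1 hc hH hK hKc hL hLc, fun he c N L hN hcN hL hLc => ?_⟩
  -- At a zero of an eigenfunction the critical case is exactly the saddle case, so no extremum
  -- occurs and the remaining points are regular.
  by_cases hc : IsCritical f c
  · obtain ⟨hs, h1, h2, h3⟩ := lineAngle_nodal_of_isCritical he hN hcN hL hLc hc
    exact ⟨h1, h2, fun u hu v hv => ⟨fun _ => h3 u hu v hv, fun h => absurd hs h⟩⟩
  · obtain ⟨h1, h2, h3⟩ := lineAngle_nodal_of_not_isCritical hf.1 hN hcN hL hLc hc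
    exact ⟨h1, h2, fun u hu v hv => ⟨fun h => absurd h.1 hc, fun _ => h3 u hu v hv⟩⟩
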